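/- Let $V$ be a separable real Hilbert space and let $A,B$ be linear operators in $V$ with domains $D(A),D(B)$. Equip $V\times V$ with the product Hilbert norm and put $J=\mathrm{diag}(A,B)$ with domain $D(A)\times D(B)$. Assume: (H1) $-J$ is a densely defined, closed, positive, symmetric operator with compact inverse. Then $J,A,B$ generate strongly continuous semigroups $S_J,S_A,S_B$. (H2) $F:V\times V\to V\times V$ is Lipschitz continuous. (H3) $G(u)=\begin{pmatrix}h(u_1)&0\\0&\mathrm{id}\end{pmatrix}$ for $u=(u_1,u_2)$, where $h:V\to L_2(V)$ (the Hilbert–Schmidt operators on $V$ with the Hilbert–Schmidt norm) is twice Fréchet differentiable with bounded first and second derivatives. Let $H_1\in(1/2,1)$, $H_2\in(1-H_1,1)$, and let $\alpha,\beta,\gamma,\gamma'$ satisfy $1/2<\beta<H_1$, $0<\alpha<\gamma<\beta$, $\alpha+\beta>1$, $\gamma<\gamma'<H_2$. Let $T>0$ and $u_0=(u_{01},u_{02})\in V\times V$. Let $\omega_1:[0,T]\to V$ be $\beta$-Hölder continuous with $\omega_1(0)=0$, and let $\omega_2:\mathbb R\to V$ be $\gamma'$-Hölder continuous on every compact interval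 with $\omega_2(0)=0$. (These are the path spaces of the canonical Hölder continuous versions of $V$-valued trace class fractional Brownian motions with Hurst parameters $H_1$ and $H_2$.) Let $C^{\gamma,\sim}([0,T];V\times V)$ be the space of continuous $u:[0,T]\to V\times V$ with $\sup_{0<s<t\le T}s^\gamma\,\|u(t)-u(s)\|/(t-s)^\gamma<\infty$. The integral against $\omega_1$ is the pathwise (Zähle) integral $$\int_a^b\Psi\,d\omega=(-1)^\alpha\int_a^b D_{a+}^\alpha\Psi[r]\,D_{b-}^{1-\alpha}\omega_{b-}[r]\,dr,\qquad \omega_{b-}=\omega-\omega(b),$$ $$D_{a+}^\alpha\Psi[r]=\frac1{\Gamma(1-\alpha)}\Big(\frac{\Psi(r)}{(r-a)^\alpha}+\alpha\int_a^r\frac{\Psi(r)-\Psi(q)}{(r-q)^{1+\alpha}}dq\Big),\quad D_{b-}^{1-\alpha}\omega_{b-}[r]=\frac{(-1)^{1-\alpha}}{\Gamma(\alpha)}\Big(\frac{\omega(r)-\omega(b)}{(b-r)^{1-\alpha}}+(1-\alpha)\int_r^b\frac{\omega(r)-\omega(q)}{(q-r)^{2-\alpha}}dq\Big),$$ with $(-1)^\alpha(-1)^{1-\alpha}=-1$,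 and the integral against $\omega_2$ is $$\int_0^tS_B(t-r)\,d\omega_2(r)=B\int_0^tS_B(t-r)\omega_2(r)\,dr+\omega_2(t).$$ Then the equation $du=Ju\,dt+F(u)\,dt+G(u)\,(d\omega_1,d\omega_2)$, $u(0)=u_0$, has a unique mild solution in $C^{\gamma,\sim}([0,T];V\times V)$; that is, there is exactly one $u$ in this space such that, for all $t\in[0,T]$, all integrals below are well defined and $$u(t)=S_J(t)u_0+\int_0^tS_J(t-r)F(u(r))\,dr+\begin{pmatrix}\int_0^tS_A(t-r)h(u_1(r))\,d\omega_1(r)\\ \int_0^tS_B(t-r)\,d\omega_2(r)\end{pmatrix}.$$ If moreover $\omega_2$ grows subexponentially, i.e. $\lim_{t\to\pm\infty}\|\omega_2(t)\|e^{-|t|/m}=0$ for all $m\in\mathbb N$, $m\ge1$, then with $\theta_t\omega_2=\omega_2(\cdot+t)-\omega_2(t)$ the variables $Z(\theta_t\omega_2)=B\int_{-\infty}^0S_B(-q)\,\theta_t\omega_2(q)\,dq$ are well defined for $t\in[0,T]$, and the same $u$ is also the only element of $C^{\gamma,\sim}([0,T];V\times V)$ for which, for all $t\in[0,T]$, all integrals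 are well defined and $$u(t)=\begin{pmatrix}S_A(t)u_{01}\\ S_B(t)(u_{02}-Z(\omega_2))\end{pmatrix}+\begin{pmatrix}0\\ Z(\theta_t\omega_2)\end{pmatrix}+\int_0^tS_J(t-r)F(u(r))\,dr+\begin{pmatrix}\int_0^tS_A(t-r)h(u_1(r))\,d\omega_1(r)\\0\end{pmatrix}.$$ -/

import Mathlib

open Set Filter Topology MeasureTheory
open scoped NNReal

noncomputable section

namespace MixedEvolution

/-! ### Hilbert-Schmidt operators -/

section HilbertSchmidt

variable (V : Type*) [NormedAddCommGroup V] [InnerProductSpace ℝ V] [CompleteSpace V]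

/-- Index set of a complete orthonormal system of `V`. -/
def onbIndex : Set V := Classical.choose (exists_hilbertBasis ℝ V)

/-- A complete orthonormal system of `V`. The Hilbert-Schmidt class and norm do not depend on
the choice. -/
def onb : HilbertBasis (onbIndex V) ℝ V :=
  Classical.choose (Classical.choose_spec (exists_hilbertBasis ℝ V))

/-- The bounded operators `Φ` with `∑ i, ‖Φ e_i‖ ^ 2 < ∞`. -/
def hsSubmodule : Submodule ℝ (V →L[ℝ] V) where
  carrier := {Φ | Memℓp (fun i => Φ (onb V i)) 2}
  zero_mem' := by
    have h : Memℓp (0 : ∀ _ : onbIndex V, V) 2 := zero_memℓp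
    exact h
  add_mem' := by
    intro Φ Ψ hΦ hΨ
    have h := Memℓp.add hΦ hΨ
    exact h
  smul_mem' := by
    intro c Φ hΦ
    have h := Memℓp.const_smul hΦ c
    exact h

/-- The space `L₂(V)` of Hilbert-Schmidt operators; it carries the Hilbert-Schmidt norm
(see `norm_sq_eq`), not the operator norm. -/
def HS : Type _ := hsSubmodule V

instance : AddCommGroup (HS V) := inferInstanceAs (AddCommGroup (hsSubmodule V))

instance : Module ℝ (HS V) := inferInstanceAs (Module ℝ (hsSubmodule V))

variable {V}

/-- The bounded operator underlying a Hilbert-Schmidt operator. -/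
def HS.toCLM : HS V →ₗ[ℝ] (V →L[ℝ] V) := (hsSubmodule V).subtype

theorem HS.memℓp (Φ : HS V) : Memℓp (fun i => Φ.toCLM (onb V i)) 2 := Φ.2

/-- The family `(Φ e_i)_i` as an element of `ℓ²`. -/
def HS.toL2 : HS V →ₗ[ℝ] lp (fun _ : onbIndex V => V) 2 where
  toFun Φ := ⟨fun i => Φ.toCLM (onb V i), Φ.memℓp⟩
  map_add' Φ Ψ := by
    ext i
    simp only [map_add]
    rfl
  map_smul' c Φ := by
    ext i
    simp only [map_smul]
    rfl

theorem HS.toL2_injective : Function.Injective (HS.toL2 (V := V)) := by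
  intro Φ Ψ h
  have h1 : ∀ i, Φ.toCLM (onb V i) = Ψ.toCLM (onb V i) := fun i =>
    congrFun (congrArg Subtype.val h) i
  have h2 : Φ.toCLM = Ψ.toCLM := by
    refine ContinuousLinearMap.ext_on (s := range (onb V)) ?_ ?_
    · have := (onb V).dense_span
      rw [Submodule.dense_iff_topologicalClosure_eq_top]
      exact this
    · rintro _ ⟨i, rfl⟩
      exact h1 i
  exact Subtype.ext h2

instance : NormedAddCommGroup (HS V) :=
  NormedAddCommGroup.induced (HS V) _ HS.toL2 HS.toL2_injective

instance : NormedSpace ℝ (HS V) := NormedSpace.induced ℝ (HS V) _ HS.toL2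

theorem HS.norm_sq_eq (Φ : HS V) : ‖Φ‖ ^ 2 = ∑' i, ‖Φ.toCLM (onb V i)‖ ^ 2 := by
  have h : ‖Φ‖ = ‖HS.toL2 Φ‖ := rfl
  rw [h]
  have h2 := lp.norm_rpow_eq_tsum (p := 2) (by simp) (HS.toL2 Φ)
  simp only [ENNReal.toReal_ofNat, Real.rpow_ofNat] at h2
  exact h2

/-- `L₂(V)` is complete: every `ℓ²` family is `(Φ e_i)_i` for a Hilbert-Schmidt operator `Φ`. -/
theorem HS.toL2_surjective : Function.Surjective (HS.toL2 (V := V)) := by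
  intro f
  have hf : Summable fun i => ‖f i‖ ^ (2 : ℝ) := by
    simpa using (lp.memℓp f).summable (by simp)
  have hx : ∀ x : V, Summable fun i => ‖(onb V).repr x i‖ ^ (2 : ℝ) := fun x => by
    simpa using (lp.memℓp ((onb V).repr x)).summable (by simp)
  have key : ∀ x : V, Summable (fun i => ‖(onb V).repr x i‖ * ‖f i‖) ∧
      ∑' i, ‖(onb V).repr x i‖ * ‖f i‖ ≤ ‖x‖ * ‖f‖ := by
    intro x
    have h := Real.summable_and_inner_le_Lp_mul_Lq_tsum_of_nonneg Real.HolderConjugate.two_two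
      (fun i => norm_nonneg ((onb V).repr x i)) (fun i => norm_nonneg (f i)) (hx x) hf
    refine ⟨h.1, h.2.trans (le_of_eq ?_)⟩
    have e1 := lp.norm_eq_tsum_rpow (p := 2) (by simp) f
    have e2 := lp.norm_eq_tsum_rpow (p := 2) (by simp) ((onb V).repr x)
    simp only [ENNReal.toReal_ofNat, LinearIsometryEquiv.norm_map] at e1 e2
    rw [e1, e2]
  have hs : ∀ x : V, Summable fun i => (onb V).repr x i • f i := fun x =>
    Summable.of_norm (by simpa only [norm_smul] using (key x).1)
  let Φ₀ : V →ₗ[ℝ] V :=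
    { toFun := fun x => ∑' i, (onb V).repr x i • f i
      map_add' := fun x y => by
        rw [← (hs x).tsum_add (hs y)]
        simp [add_smul]
      map_smul' := fun c x => by
        rw [RingHom.id_apply, ← (hs x).tsum_const_smul c]
        simp [mul_smul] }
  let Φ : V →L[ℝ] V := Φ₀.mkContinuous ‖f‖ fun x => by
    have h1 : ‖∑' i, (onb V).repr x i • f i‖ ≤ ∑' i, ‖(onb V).repr x i‖ * ‖f i‖ := by
      have h2 := norm_tsum_le_tsum_norm (f := fun i => (onb V).repr x i • f i)
        (by simpa only [norm_smul] using (key x).1)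
      simpa only [norm_smul] using h2
    exact h1.trans (((key x).2).trans (le_of_eq (mul_comm _ _)))
  have hΦ : ∀ i, Φ (onb V i) = f i := by
    intro i
    classical
    have h1 : Φ (onb V i) = ∑' j, (onb V).repr (onb V i) j • f j := rfl
    rw [h1, HilbertBasis.repr_self, tsum_eq_single i]
    · simp
    · intro j hj
      simp [hj]
  refine ⟨⟨Φ, ?_⟩, ?_⟩
  · have h1 : (fun i => Φ (onb V i)) = f := funext hΦ
    change Memℓp (fun i => Φ (onb V i)) 2
    rw [h1]
    exact lp.memℓp f
  · ext i
    exact hΦ i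

instance : CompleteSpace (HS V) := by
  have hi : Isometry (HS.toL2 (V := V)) := AddMonoidHomClass.isometry_of_norm _ fun _ => rfl
  have hr : IsComplete (range (HS.toL2 (V := V))) := by
    rw [HS.toL2_surjective.range_eq]
    exact isComplete_univ
  exact (completeSpace_iff_isComplete_range hi.isUniformInducing).2 hr

/-- The composition `S ∘ Φ` of a bounded operator `S` with a Hilbert-Schmidt operator `Φ`. -/
def HS.comp (S : V →L[ℝ] V) (Φ : HS V) : HS V :=
  ⟨S ∘L Φ.toCLM, by
    refine memℓp_gen ?_
    have h := (Φ.memℓp.summable (by simp)).mul_left (‖S‖ ^ (2 : ENNReal).toReal)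
    refine Summable.of_nonneg_of_le (fun i => by positivity) (fun i => ?_) h
    rw [← Real.mul_rpow (norm_nonneg _) (norm_nonneg _)]
    exact Real.rpow_le_rpow (norm_nonneg _) (S.le_opNorm _) (by simp)⟩

end HilbertSchmidt

/-! ### Unbounded operators and the semigroups they generate -/

section Operators

variable {E : Type*} [NormedAddCommGroup E] [InnerProductSpace ℝ E]

/-- The assumption on the linear operator `L`: `-L` is a (densely defined) closed positive
symmetric operator which has a compact inverse. -/
structure IsNegWithCompactInverse (L : E →ₗ.[ℝ] E) : Prop where
  dense : Dense (L.domain : Set E)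
  closed : L.IsClosed
  symm : ∀ x y : L.domain, inner ℝ (L x) (y : E) = inner ℝ (x : E) (L y)
  pos : ∀ x : L.domain, (x : E) ≠ 0 → 0 < inner ℝ (-(L x)) (x : E)
  compact_inv : ∃ K : E →L[ℝ] E, IsCompactOperator K ∧
    (∀ y, ∃ hy : K y ∈ L.domain, -(L ⟨K y, hy⟩) = y) ∧ ∀ x : L.domain, K (-(L x)) = x

/-- `S` is a strongly continuous semigroup on `[0, ∞)` whose infinitesimal generator is `L`. -/
structure Generates (L : E →ₗ.[ℝ] E) (S : ℝ → E →L[ℝ] E) : Prop where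
  zero : S 0 = ContinuousLinearMap.id ℝ E
  add : ∀ s t, 0 ≤ s → 0 ≤ t → S (s + t) = S s ∘L S t
  cont : ∀ x, Tendsto (fun t => S t x) (𝓝[≥] 0) (𝓝 x)
  generator : ∀ x y, (x, y) ∈ L.graph ↔
    Tendsto (fun t : ℝ => t⁻¹ • (S t x - x)) (𝓝[>] 0) (𝓝 y)

/-- The strongly continuous semigroup generated by `L`. Only its values at times `t ≥ 0`, which
are uniquely determined by `L`, are meaningful. -/
def semigroup (L : E →ₗ.[ℝ] E) : ℝ → E →L[ℝ] E := Classical.epsilon (Generates L)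

/-- `L x`, for `x` in the domain of `L` (and `0` otherwise). -/
def opApply (L : E →ₗ.[ℝ] E) (x : E) : E :=
  open Classical in if hx : x ∈ L.domain then L ⟨x, hx⟩ else 0

/-- The operator `diag(A, B)` with domain `D(A) × D(B)` in the Hilbert space `E × E`. -/
def blockDiag (A B : E →ₗ.[ℝ] E) : WithLp 2 (E × E) →ₗ.[ℝ] WithLp 2 (E × E) where
  domain :=
    { carrier := {p | p.fst ∈ A.domain ∧ p.snd ∈ B.domain}
      zero_mem' := ⟨A.domain.zero_mem, B.domain.zero_mem⟩
      add_mem' := fun hp hq => ⟨A.domain.add_mem hp.1 hq.1, B.domain.add_mem hp.2 hq.2⟩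
      smul_mem' := fun c _ hp => ⟨A.domain.smul_mem c hp.1, B.domain.smul_mem c hp.2⟩ }
  toFun :=
    { toFun := fun p => WithLp.toLp 2 (A ⟨p.1.fst, p.2.1⟩, B ⟨p.1.snd, p.2.2⟩)
      map_add' := fun p q => by
        rw [← WithLp.toLp_add, Prod.mk_add_mk, ← LinearPMap.map_add, ← LinearPMap.map_add]
        rfl
      map_smul' := fun c p => by
        rw [RingHom.id_apply, ← WithLp.toLp_smul, Prod.smul_mk, ← LinearPMap.map_smul,
          ← LinearPMap.map_smul]
        rfl }

end Operators

/-! ### Path spaces -/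

section Paths

variable {E : Type*} [NormedAddCommGroup E]

/-- `u` is Hölder continuous with exponent `β` on `[a, b]`. -/
def HolderOnIcc (β a b : ℝ) (u : ℝ → E) : Prop :=
  ∃ C : ℝ, ∀ s t, a ≤ s → s < t → t ≤ b → ‖u t - u s‖ ≤ C * (t - s) ^ β

/-- The space `C^{γ,∼}([0, T]; E)`: the continuous functions `u` on `[0, T]` with
`sup_{0 < s < t ≤ T} s ^ γ * ‖u t - u s‖ / (t - s) ^ γ < ∞`. -/
def MemWeightedHolder (γ T : ℝ) (u : ℝ → E) : Prop :=
  ContinuousOn u (Icc 0 T) ∧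
    ∃ C : ℝ, ∀ s t, 0 < s → s < t → t ≤ T → s ^ γ * (‖u t - u s‖ / (t - s) ^ γ) ≤ C

/-- The path space `Ω₁ = C₀([0, T]; E) ∩ C^β([0, T]; E)`. -/
def MemΩ₁ (β T : ℝ) (ω : ℝ → E) : Prop := ω 0 = 0 ∧ HolderOnIcc β 0 T ω

/-- The path space `Ω₂`: continuous paths on `ℝ` that vanish at `0` and are Hölder continuous
with exponent `γ'` on every compact interval. -/
def MemΩ₂ (γ' : ℝ) (ω : ℝ → E) : Prop :=
  Continuous ω ∧ ω 0 = 0 ∧ ∀ a b, a < b → HolderOnIcc γ' a b ω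

/-- Subexponential growth: `‖ω t‖ * exp (-|t| / m) → 0` as `t → ± ∞`, for every `m ≥ 1`. -/
def Subexponential (ω : ℝ → E) : Prop :=
  ∀ m : ℕ, 1 ≤ m →
    Tendsto (fun t : ℝ => ‖ω t‖ * Real.exp (-(1 / (m : ℝ)) * |t|)) atTop (𝓝 0) ∧
    Tendsto (fun t : ℝ => ‖ω t‖ * Real.exp (-(1 / (m : ℝ)) * |t|)) atBot (𝓝 0)

/-- The Wiener shift `(θ_t ω)(s) = ω (s + t) - ω t`. -/
def shift (t : ℝ) (ω : ℝ → E) : ℝ → E := fun s => ω (s + t) - ω t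

end Paths

/-! ### Fractional derivatives and the pathwise integral -/

section FractionalIntegral

variable {E : Type*} [NormedAddCommGroup E] [NormedSpace ℝ E]

/-- The integrand in the left-sided Weyl derivative. -/
def weylLeftKernel (α : ℝ) (Ψ : ℝ → E) (r q : ℝ) : E := (r - q) ^ (-(1 + α)) • (Ψ r - Ψ q)

/-- The left-sided Weyl derivative `D_{a+}^α Ψ[r]`. -/
def weylLeft (α a : ℝ) (Ψ : ℝ → E) (r : ℝ) : E :=
  (Real.Gamma (1 - α))⁻¹ •
    ((r - a) ^ (-α) • Ψ r + α • ∫ q in a..r, weylLeftKernel α Ψ r q)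

/-- The integrand in the right-sided Weyl derivative of order `1 - α`. -/
def weylRightKernel (α : ℝ) (g : ℝ → E) (r q : ℝ) : E := (q - r) ^ (-(2 - α)) • (g r - g q)

/-- The right-sided Weyl derivative `D_{b-}^{1-α} g_{b-}[r]` of `g_{b-} = g - g b`, without the
factor `(-1)^(1-α)`. -/
def weylRight (α b : ℝ) (g : ℝ → E) (r : ℝ) : E :=
  (Real.Gamma α)⁻¹ •
    ((b - r) ^ (-(1 - α)) • (g r - g b) + (1 - α) • ∫ q in r..b, weylRightKernel α g r q)

variable {V : Type*} [NormedAddCommGroup V] [InnerProductSpace ℝ V] [CompleteSpace V]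

/-- The pathwise (Zähle) integral `∫_a^b Ψ dω = (-1)^α ∫_a^b D_{a+}^α Ψ[r] D_{b-}^{1-α} ω_{b-}[r] dr`
of an `L₂(V)`-valued integrand against a `V`-valued path. The factors `(-1)^α` and `(-1)^(1-α)`
multiply to `-1`. -/
def zahleIntegral (α a b : ℝ) (Ψ : ℝ → HS V) (ω : ℝ → V) : V :=
  -∫ r in a..b, (weylLeft α a Ψ r).toCLM (weylRight α b ω r)

/-- The class `I_{a+}^α(L^p((a, b); ℝ))`: the functions on `(a, b)` that are left-sided
Riemann-Liouville integrals of order `α` of some `φ ∈ L^p`. -/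
def MemFracLeft (α : ℝ) (p : ENNReal) (a b : ℝ) (f : ℝ → ℝ) : Prop :=
  ∃ φ : ℝ → ℝ, MemLp φ p (volume.restrict (Ioo a b)) ∧
    ∀ᵐ x ∂(volume.restrict (Ioo a b)),
      f x = (Real.Gamma α)⁻¹ * ∫ y in a..x, (x - y) ^ (α - 1) * φ y

/-- The class `I_{b-}^α(L^p((a, b); ℝ))`: the functions on `(a, b)` that are right-sided
Riemann-Liouville integrals of order `α` of some `φ ∈ L^p`. -/
def MemFracRight (α : ℝ) (p : ENNReal) (a b : ℝ) (f : ℝ → ℝ) : Prop :=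
  ∃ φ : ℝ → ℝ, MemLp φ p (volume.restrict (Ioo a b)) ∧
    ∀ᵐ x ∂(volume.restrict (Ioo a b)),
      f x = (Real.Gamma α)⁻¹ * ∫ y in x..b, (y - x) ^ (α - 1) * φ y

/-- The coordinate `ψ_{ji} = (Ψ, E_{ji})_{L₂(V)} = ⟨e_j, Ψ e_i⟩`. -/
def hsCoord (Ψ : ℝ → HS V) (j i : onbIndex V) (r : ℝ) : ℝ :=
  inner ℝ (onb V j) ((Ψ r).toCLM (onb V i))

/-- For `a < b`, the pathwise integral `∫_a^b Ψ dω` is well defined (an integral with `a = b` is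
`0`): for some `p, p' ∈ [1, ∞]` with `α p < 1` and `1/p + 1/p' ≤ 1`, the coordinates `ψ_{ji}` of
the integrand lie in `I_{a+}^α(L^p)` and have right limits at `a`, the coordinates of
`ω_{b-} = ω - ω b` lie in `I_{b-}^{1-α}(L^{p'})`; the integrals in both vector-valued Weyl
derivatives converge absolutely at almost every `r ∈ (a, b)`; and
`‖D_{a+}^α Ψ‖ * ‖D_{b-}^{1-α} ω_{b-}‖` is integrable on `(a, b)`, as is the integrand. -/
structure ZahleIntegrable (α a b : ℝ) (Ψ : ℝ → HS V) (ω : ℝ → V) : Prop where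
  frac : ∃ p p' : ENNReal, 1 ≤ p ∧ 1 ≤ p' ∧ ENNReal.ofReal α * p < 1 ∧ p⁻¹ + p'⁻¹ ≤ 1 ∧
    (∀ j i, MemFracLeft α p a b (hsCoord Ψ j i)) ∧
    ∀ i, MemFracRight (1 - α) p' a b (fun r => inner ℝ (ω r - ω b) (onb V i))
  limit : ∀ j i, ∃ l, Tendsto (hsCoord Ψ j i) (𝓝[>] a) (𝓝 l)
  left : ∀ᵐ r ∂(volume.restrict (Ioo a b)),
    IntervalIntegrable (weylLeftKernel α Ψ r) volume a r
  right : ∀ᵐ r ∂(volume.restrict (Ioo a b)),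
    IntervalIntegrable (weylRightKernel α ω r) volume r b
  norm_mul : IntervalIntegrable (fun r => ‖weylLeft α a Ψ r‖ * ‖weylRight α b ω r‖) volume a b
  integrand : IntervalIntegrable (fun r => (weylLeft α a Ψ r).toCLM (weylRight α b ω r))
    volume a b

end FractionalIntegral

/-! ### Mild solutions -/

section Mild

variable {V : Type*} [NormedAddCommGroup V] [InnerProductSpace ℝ V] [CompleteSpace V]

/-- The stochastic convolution
`∫_0^t S_B(t-r) dω(r) = B ∫_0^t S_B(t-r) ω(r) dr + ω(t)`, for `ω(0) = 0`. -/
def stochConv (B : V →ₗ.[ℝ] V) (ω : ℝ → V) (t : ℝ) : V :=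
  opApply B (∫ r in (0 : ℝ)..t, semigroup B (t - r) (ω r)) + ω t

/-- The stochastic convolution is well defined at time `t`. -/
def StochConvExists (B : V →ₗ.[ℝ] V) (ω : ℝ → V) (t : ℝ) : Prop :=
  IntervalIntegrable (fun r => semigroup B (t - r) (ω r)) volume 0 t ∧
    (∫ r in (0 : ℝ)..t, semigroup B (t - r) (ω r)) ∈ B.domain

/-- The stationary Ornstein-Uhlenbeck variable `Z(ω) = B ∫_{-∞}^0 S_B(-q) ω(q) dq`; the stationary
process is `t ↦ Z(θ_t ω)`. -/
def ouZ (B : V →ₗ.[ℝ] V) (ω : ℝ → V) : V :=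
  opApply B (∫ q in Iic (0 : ℝ), semigroup B (-q) (ω q))

/-- The variable `Z(ω)` is well defined. -/
def OuZExists (B : V →ₗ.[ℝ] V) (ω : ℝ → V) : Prop :=
  IntegrableOn (fun q => semigroup B (-q) (ω q)) (Iic 0) ∧
    (∫ q in Iic (0 : ℝ), semigroup B (-q) (ω q)) ∈ B.domain

/-- The drift convolution `∫_0^t S_J(t-r) F(u(r)) dr`, `J = diag(A, B)`. -/
def driftConv (A B : V →ₗ.[ℝ] V) (F : WithLp 2 (V × V) → WithLp 2 (V × V))
    (u : ℝ → WithLp 2 (V × V)) (t : ℝ) : WithLp 2 (V × V) :=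
  ∫ r in (0 : ℝ)..t, semigroup (blockDiag A B) (t - r) (F (u r))

/-- The integrand `r ↦ S_A(t-r) h(u₁(r))` of the pathwise integral. -/
def noiseIntegrand (A : V →ₗ.[ℝ] V) (h : V → HS V) (u : ℝ → WithLp 2 (V × V)) (t : ℝ) :
    ℝ → HS V :=
  fun r => HS.comp (semigroup A (t - r)) (h (u r).fst)

/-- `u` is a mild solution on `[0, T]` of
`du = J u dt + F(u) dt + G(u) d(ω₁, ω₂)`, `u(0) = u₀`, with `J = diag(A, B)` and
`G(u) = diag(h(u₁), id)`: for all `t ∈ [0, T]`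
`u(t) = S_J(t) u₀ + ∫_0^t S_J(t-r) F(u(r)) dr
  + (∫_0^t S_A(t-r) h(u₁(r)) dω₁(r), ∫_0^t S_B(t-r) dω₂(r))`,
all integrals being well defined. -/
structure IsMildSolution (α T : ℝ) (A B : V →ₗ.[ℝ] V)
    (F : WithLp 2 (V × V) → WithLp 2 (V × V)) (h : V → HS V) (ω₁ ω₂ : ℝ → V)
    (u₀ : WithLp 2 (V × V)) (u : ℝ → WithLp 2 (V × V)) : Prop where
  drift : ∀ t ∈ Icc 0 T,
    IntervalIntegrable (fun r => semigroup (blockDiag A B) (t - r) (F (u r))) volume 0 t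
  noise₁ : ∀ t ∈ Ioc 0 T, ZahleIntegrable α 0 t (noiseIntegrand A h u t) ω₁
  noise₂ : ∀ t ∈ Icc 0 T, StochConvExists B ω₂ t
  eq : ∀ t ∈ Icc 0 T,
    u t = semigroup (blockDiag A B) t u₀ + driftConv A B F u t +
      WithLp.toLp 2 (zahleIntegral α 0 t (noiseIntegrand A h u t) ω₁, stochConv B ω₂ t)

/-- The same notion, with the second noise expressed through the stationary Ornstein-Uhlenbeck
process `t ↦ Z(θ_t ω₂)`: for all `t ∈ [0, T]`
`u(t) = (S_A(t) u₀₁, S_B(t) (u₀₂ - Z(ω₂))) + (0, Z(θ_t ω₂)) + ∫_0^t S_J(t-r) F(u(r)) dr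
  + (∫_0^t S_A(t-r) h(u₁(r)) dω₁(r), 0)`. -/
structure IsMildSolutionOU (α T : ℝ) (A B : V →ₗ.[ℝ] V)
    (F : WithLp 2 (V × V) → WithLp 2 (V × V)) (h : V → HS V) (ω₁ ω₂ : ℝ → V)
    (u₀ : WithLp 2 (V × V)) (u : ℝ → WithLp 2 (V × V)) : Prop where
  drift : ∀ t ∈ Icc 0 T,
    IntervalIntegrable (fun r => semigroup (blockDiag A B) (t - r) (F (u r))) volume 0 t
  noise₁ : ∀ t ∈ Ioc 0 T, ZahleIntegrable α 0 t (noiseIntegrand A h u t) ω₁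
  noise₂ : ∀ t ∈ Icc 0 T, OuZExists B (shift t ω₂)
  eq : ∀ t ∈ Icc 0 T,
    u t = WithLp.toLp 2 (semigroup A t u₀.fst, semigroup B t (u₀.snd - ouZ B ω₂)) +
      WithLp.toLp 2 (0, ouZ B (shift t ω₂)) + driftConv A B F u t +
      WithLp.toLp 2 (zahleIntegral α 0 t (noiseIntegrand A h u t) ω₁, 0)

end Mild

end MixedEvolution

end

/-!
# Mild solutions for mixed Young and Ornstein-Uhlenbeck noise

Since the inverse of `-J` is compact and symmetric, the spectral theorem makes `J`, and with it its
diagonal blocks `A` and `B`, diagonal in a Hilbert basis, with spectrum in `(-∞, -c]` for some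
`c > 0` (`IsNegWithCompactInverse.exists_isDiagonal`). The semigroups are therefore multiplication
by `exp (-lam i * t)` in coordinates, `S_J` is the block diagonal of `S_A` and `S_B`
(`semigroup_blockDiag`), and elementary inequalities for the exponential give
`‖S t - S s‖ ≤ (t - s) ^ θ * s ^ (-θ)` (`IsDiagonal.isSmoothing`). No other property of an analytic
semigroup enters the estimates of the drift and of the integral against `ω₁`.

The integrands `r ↦ S_A (t - r) (h (u₁ r))` are Hölder continuous up to power singularities at both
ends of the interval (`Admissible`). For such integrands the two Weyl derivatives have explicit
bounds, and the pathwise integral over `[a, b]` is of order `(b - a) ^ (β - σ)`, where `σ` is the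
order of the singularity at `b` (`Admissible.norm_zahleIntegral_le`). The integral is well defined
since a function is the fractional integral of its Weyl derivative
(`ae_eq_fractional_integral_weylLeft`). The definition does not show that it is additive in the
interval. For a differentiable path it is the integral of `Ψ` against the derivative, by the same
inversion formula; a Hölder path is the limit of its Steklov averages, which have the same Hölder
constant, so that the integrals against them converge by dominated convergence
(`Admissible.zahleIntegral_add`).

Additivity lets one split the increments of a convolution, and with the exponential weight
`exp (-ρ t)` both convolutions gain a factor `ρ ^ (-ε)` (`WeightedBound.zahleConv`,
`weightedBound_bochnerConv`). The coefficient `h` is not globally Lipschitz on the Hölder space: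
the second differences of `h` are controlled by products (`norm_sub_sub_sub_le_of_fderiv`), so
that the fixed point map grows linearly but is Lipschitz only on bounded sets (`IsPicardMap`,
`isPicardMap_mildMap`). Hence a first weight gives an invariant ball, and a second, larger weight
makes the map a contraction there; two given solutions lie in a common ball, which gives uniqueness
in the whole space (`IsPicardMap.exists_fixedPoint`, `IsPicardMap.eqOn`).

The stochastic convolution does not depend on `u`. Subtracting the value of `ω₂` at the endpoint
makes `B S_B(t - r) (ω₂ r - ω₂ t)` integrable, which gives its existence and its bounds
(`IsGeneratorComp.stochConv`, `IsGeneratorComp.exists_weightedBound_stochConv`). In coordinates it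
is a scalar convolution, and so equals `Z (θ_t ω₂) - S_B(t) Z (ω₂)`
(`IsGeneratorComp.stochConv_eq_ouZ`). Both formulations of the equation thus have the same fixed
points (`isMildSolution_iff`, `isMildSolutionOU_iff`).
-/

open Set Filter Topology MeasureTheory
open scoped NNReal

noncomputable section

namespace MixedEvolution

/-! ### Operators that are diagonal in a Hilbert basis -/

section Diagonal

variable {E : Type*} [NormedAddCommGroup E] [InnerProductSpace ℝ E] {ι : Type*}

theorem hasSum_sq_coord (b : HilbertBasis ι ℝ E) (x : E) :
    HasSum (fun i => (inner ℝ (b i) x) ^ 2) (‖x‖ ^ 2) := by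
  have h := b.hasSum_inner_mul_inner x x
  rw [real_inner_self_eq_norm_sq] at h
  refine h.congr_fun ?_
  intro i
  rw [real_inner_comm x (b i), sq]

theorem ext_coord (b : HilbertBasis ι ℝ E) {x y : E}
    (h : ∀ i, inner ℝ (b i) x = inner ℝ (b i) y) : x = y := by
  have h1 := hasSum_sq_coord b (x - y)
  have h2 : (fun i => (inner ℝ (b i) (x - y)) ^ 2) = fun _ => 0 := by
    funext i
    rw [inner_sub_right, h i]
    simp
  rw [h2] at h1
  have h3 := h1.unique hasSum_zero
  exact sub_eq_zero.1 (norm_eq_zero.1 (pow_eq_zero_iff (two_ne_zero) |>.1 h3))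

theorem norm_le_of_coord_le (b : HilbertBasis ι ℝ E) {x y : E} {C : ℝ} (hC : 0 ≤ C)
    (h : ∀ i, |inner ℝ (b i) y| ≤ C * |inner ℝ (b i) x|) : ‖y‖ ≤ C * ‖x‖ := by
  have h1 := hasSum_le (fun i => ?_) (hasSum_sq_coord b y) ((hasSum_sq_coord b x).mul_left (C ^ 2))
  · rw [← mul_pow] at h1
    exact le_of_sq_le_sq h1 (by positivity)
  · rw [← sq_abs, ← sq_abs (inner ℝ (b i) x), ← mul_pow]
    exact pow_le_pow_left₀ (abs_nonneg _) (h i) 2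

/-- A bounded family of multipliers acts on the coordinates with respect to a Hilbert basis. -/
theorem exists_multiplier [CompleteSpace E] (b : HilbertBasis ι ℝ E) {f : ι → ℝ} {C : ℝ}
    (hC : 0 ≤ C) (hf : ∀ i, |f i| ≤ C) :
    ∃ D : E →L[ℝ] E, ‖D‖ ≤ C ∧ ∀ x i, inner ℝ (b i) (D x) = f i * inner ℝ (b i) x := by
  have hm : ∀ x : E, Memℓp (fun i => f i * b.repr x i) 2 := by
    intro x
    refine memℓp_gen ?_
    have h := ((lp.memℓp (b.repr x)).summable (by simp)).mul_left (C ^ (2 : ENNReal).toReal)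
    refine Summable.of_nonneg_of_le (fun i => by positivity) (fun i => ?_) h
    rw [← Real.mul_rpow hC (norm_nonneg _)]
    refine Real.rpow_le_rpow (norm_nonneg _) ?_ (by simp)
    rw [norm_mul]
    exact mul_le_mul_of_nonneg_right (hf i) (norm_nonneg _)
  let D₀ : E →ₗ[ℝ] E :=
    { toFun := fun x => b.repr.symm ⟨fun i => f i * b.repr x i, hm x⟩
      map_add' := fun x y => by
        rw [← map_add]
        congr 1
        ext i
        simp only [map_add, lp.coeFn_add, Pi.add_apply, mul_add]
      map_smul' := fun c x => by
        rw [RingHom.id_apply, ← map_smul]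
        congr 1
        ext i
        simp only [map_smul, lp.coeFn_smul, Pi.smul_apply, smul_eq_mul]
        ring }
  have hD : ∀ x i, inner ℝ (b i) (D₀ x) = f i * inner ℝ (b i) x := by
    intro x i
    rw [← b.repr_apply_apply, ← b.repr_apply_apply]
    simp [D₀]
  have hb : ∀ x, ‖D₀ x‖ ≤ C * ‖x‖ := fun x => norm_le_of_coord_le b hC fun i => by
    rw [hD, abs_mul]
    exact mul_le_mul_of_nonneg_right (hf i) (abs_nonneg _)
  exact ⟨D₀.mkContinuous C hb, LinearMap.mkContinuous_norm_le _ hC _, hD⟩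

/-- Uniformly bounded diagonal operators converge strongly once their multipliers converge. -/
theorem tendsto_of_coord (b : HilbertBasis ι ℝ E) {κ : Type*} {l : Filter κ} (y : κ → E) (x z : E)
    {C : ℝ} (hy : ∀ᶠ k in l, ∀ i, |inner ℝ (b i) (y k - z)| ≤ C * |inner ℝ (b i) x|)
    (hl : ∀ i, Tendsto (fun k => inner ℝ (b i) (y k)) l (𝓝 (inner ℝ (b i) z))) :
    Tendsto y l (𝓝 z) := by
  have h1 : ∀ k, ‖y k - z‖ ^ 2 = ∑' i, (inner ℝ (b i) (y k - z)) ^ 2 := fun k =>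
    (hasSum_sq_coord b _).tsum_eq.symm
  have h2 : Tendsto (fun k => ∑' i, (inner ℝ (b i) (y k - z)) ^ 2) l (𝓝 (∑' _ : ι, (0 : ℝ))) := by
    refine tendsto_tsum_of_dominated_convergence
      ((hasSum_sq_coord b x).summable.mul_left (C ^ 2)) (fun i => ?_) ?_
    · have h3 := ((hl i).sub_const (inner ℝ (b i) z)).pow 2
      simpa only [sub_self, ne_eq, OfNat.ofNat_ne_zero, not_false_eq_true, zero_pow,
        inner_sub_right] using h3
    · filter_upwards [hy] with k hk i
      rw [Real.norm_of_nonneg (sq_nonneg _), ← sq_abs, ← sq_abs (inner ℝ (b i) x), ← mul_pow]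
      exact pow_le_pow_left₀ (abs_nonneg _) (hk i) 2
  rw [tendsto_iff_norm_sub_tendsto_zero]
  have h4 : Tendsto (fun k => Real.sqrt (‖y k - z‖ ^ 2)) l (𝓝 0) := by
    simp only [h1]
    rw [tsum_zero] at h2
    simpa [Function.comp_def] using (Real.continuous_sqrt.tendsto 0).comp h2
  simpa only [Real.sqrt_sq (norm_nonneg _)] using h4

/-- `L` is diagonal in the Hilbert basis `b`, with eigenvalues `-lam i ≤ -c < 0`: the graph of
`L` is described by coordinates. -/
structure IsDiagonal (L : E →ₗ.[ℝ] E) (b : HilbertBasis ι ℝ E) (lam : ι → ℝ) (c : ℝ) : Prop where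
  pos : 0 < c
  le : ∀ i, c ≤ lam i
  mem_graph : ∀ x y, (x, y) ∈ L.graph ↔ ∀ i, inner ℝ (b i) y = -lam i * inner ℝ (b i) x

/-- The spectral theorem for the compact inverse diagonalises the unbounded operator. -/
theorem IsNegWithCompactInverse.exists_isDiagonal [CompleteSpace E] {L : E →ₗ.[ℝ] E}
    (hL : IsNegWithCompactInverse L) :
    ∃ (s : Set E) (b : HilbertBasis s ℝ E) (lam : s → ℝ) (c : ℝ), IsDiagonal L b lam c := by
  obtain ⟨K, hK, hKr, hKl⟩ := hL.compact_inv
  have hsymm : (K : E →ₗ[ℝ] E).IsSymmetric := by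
    intro x y
    obtain ⟨hx, hx'⟩ := hKr x
    obtain ⟨hy, hy'⟩ := hKr y
    have h := hL.symm ⟨K x, hx⟩ ⟨K y, hy⟩
    rw [neg_eq_iff_eq_neg] at hx' hy'
    rw [hx', hy'] at h
    simp only [inner_neg_left, inner_neg_right, neg_inj] at h
    exact h.symm
  have hspec := ContinuousLinearMap.orthogonalComplement_iSup_eigenspaces_eq_bot hK hsymm
  set G : ℝ → Submodule ℝ E := fun μ => Module.End.eigenspace (K : Module.End ℝ E) μ with hG
  have hof : OrthogonalFamily ℝ (fun μ => G μ) fun μ => (G μ).subtypeₗᵢ :=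
    LinearMap.IsSymmetric.orthogonalFamily_eigenspaces hsymm
  have hclosed : ∀ μ, IsClosed (G μ : Set E) := by
    intro μ
    have : (G μ : Set E) = {x | K x = μ • x} := by
      ext x
      simp [hG]
    rw [this]
    exact isClosed_eq K.continuous (continuous_const_smul μ)
  have hcomplete : ∀ μ, CompleteSpace (G μ) := fun μ => (hclosed μ).completeSpace_coe
  choose w bw hbw using fun μ => exists_hilbertBasis ℝ (G μ)
  let v : (Σ μ, w μ) → E := fun p => (bw p.1 p.2 : G p.1)
  have hv : Orthonormal ℝ v := hof.orthonormal_sigma_orthonormal fun μ => (bw μ).orthonormal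
  have hvK : ∀ p, K (v p) = p.1 • v p := fun p =>
    Module.End.mem_eigenspace_iff.1 (bw p.1 p.2 : G p.1).2
  have hvbot : (Submodule.span ℝ (range v))ᗮ = ⊥ := by
    rw [eq_bot_iff, ← hspec]
    intro x hx
    rw [Submodule.mem_orthogonal]
    rw [Submodule.mem_orthogonal] at hx
    intro u hu
    induction hu using Submodule.iSup_induction' with
    | mem μ y hy =>
      have h1 : HasSum (fun i => (bw μ).repr ⟨y, hy⟩ i • bw μ i) (⟨y, hy⟩ : G μ) :=
        (bw μ).hasSum_repr _
      have h2 := h1.mapL ((innerSL ℝ x) ∘L (G μ).subtypeL)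
      have h3 : (fun i => ((innerSL ℝ x) ∘L (G μ).subtypeL)
          ((bw μ).repr ⟨y, hy⟩ i • bw μ i)) = fun _ => 0 := by
        funext i
        have h4 : inner ℝ x (v ⟨μ, i⟩) = 0 := by
          rw [real_inner_comm]
          exact hx _ (Submodule.subset_span ⟨_, rfl⟩)
        have h5 : ((innerSL ℝ x) ∘L (G μ).subtypeL) (bw μ i) = inner ℝ x (v ⟨μ, i⟩) := rfl
        rw [map_smul, h5, h4, smul_zero]
      rw [h3] at h2
      have h6 := h2.unique hasSum_zero
      rw [real_inner_comm]
      exact h6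
    | zero => simp
    | add y z _ _ hy hz => rw [inner_add_left, hy, hz, add_zero]
  have hne : ∀ p, v p ≠ 0 := fun p => hv.ne_zero p
  have hμ : ∀ p : (Σ μ, w μ), 0 < p.1 := by
    intro p
    obtain ⟨h1, h2⟩ := hKr (v p)
    have hK0 : K (v p) ≠ 0 := by
      intro h0
      have h3 : (⟨K (v p), h1⟩ : L.domain) = 0 := Subtype.ext h0
      rw [h3, LinearPMap.map_zero, neg_zero] at h2
      exact hne p h2.symm
    have h3 := hL.pos ⟨K (v p), h1⟩ hK0
    rw [h2] at h3
    simp only at h3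
    rw [hvK, inner_smul_right, real_inner_self_eq_norm_sq] at h3
    exact (pos_iff_pos_of_mul_pos h3).2 (by have := norm_pos_iff.2 (hne p); positivity)
  have hle : ∀ p : (Σ μ, w μ), p.1 ≤ ‖K‖ + 1 := by
    intro p
    have h1 := K.le_opNorm (v p)
    rw [hvK, norm_smul, hv.1 p, Real.norm_of_nonneg (hμ p).le] at h1
    linarith
  -- indexing the eigenbasis by its range keeps the index type in the universe of `E`
  have hvr : Orthonormal ℝ ((↑) : range v → E) := hv.toSubtypeRange
  let b : HilbertBasis (range v) ℝ E := HilbertBasis.mkOfOrthogonalEqBot hvr (by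
    rw [Subtype.range_coe]
    exact hvbot)
  have hb : ∀ i, b i = i := fun i => congrFun (HilbertBasis.coe_mkOfOrthogonalEqBot hvr _) i
  choose idx hidx using fun i : range v => i.2
  refine ⟨range v, b, fun i => ((idx i).1)⁻¹, (‖K‖ + 1)⁻¹, by positivity, fun i => ?_, ?_⟩
  · exact inv_anti₀ (hμ _) (hle _)
  · have hbK : ∀ i, K (b i) = (idx i).1 • b i := by
      intro i
      rw [hb i, ← hidx i, hvK]
    have hcoord : ∀ i x, inner ℝ (b i) (K x) = (idx i).1 * inner ℝ (b i) x := by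
      intro i x
      have h1 := hsymm (b i) x
      change inner ℝ (K (b i)) x = inner ℝ (b i) (K x) at h1
      rw [← h1, hbK, real_inner_smul_left]
    intro x y
    have key : (x, y) ∈ L.graph ↔ K (-y) = x := by
      rw [LinearPMap.mem_graph_iff]
      constructor
      · rintro ⟨z, rfl, rfl⟩
        exact hKl z
      · rintro rfl
        obtain ⟨h1, h2⟩ := hKr (-y)
        exact ⟨⟨K (-y), h1⟩, rfl, neg_inj.1 h2⟩
    rw [key]
    constructor
    · rintro rfl i
      rw [hcoord, inner_neg_right]
      have := (hμ (idx i)).ne'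
      field_simp
    · intro h
      refine ext_coord b fun i => ?_
      rw [hcoord, inner_neg_right, h i]
      have := (hμ (idx i)).ne'
      field_simp

end Diagonal

/-! ### The generated semigroup -/

section Semigroups

variable {E : Type*} [NormedAddCommGroup E] [InnerProductSpace ℝ E] {ι : Type*}
  {L : E →ₗ.[ℝ] E} {b : HilbertBasis ι ℝ E} {lam : ι → ℝ} {c : ℝ}

theorem IsDiagonal.lam_pos (hD : IsDiagonal L b lam c) (i : ι) : 0 < lam i :=
  hD.pos.trans_le (hD.le i)

theorem IsDiagonal.eigenvector_mem_graph (hD : IsDiagonal L b lam c) (i : ι) :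
    (b i, -lam i • b i) ∈ L.graph := by
  rw [hD.mem_graph]
  intro j
  rw [inner_smul_right]
  by_cases hij : j = i
  · rw [hij]
  · rw [b.orthonormal.2 hij]
    simp

theorem tendsto_exp_slope (l : ℝ) :
    Tendsto (fun t : ℝ => t⁻¹ * (Real.exp (-l * t) - 1)) (𝓝[>] 0) (𝓝 (-l)) := by
  have h : HasDerivAt (fun t : ℝ => Real.exp (-l * t)) (-l) 0 := by
    have h1 := ((hasDerivAt_id (0 : ℝ)).const_mul (-l)).exp
    simpa using h1
  have h2 := (hasDerivAt_iff_tendsto_slope_zero.1 h).mono_left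
    (nhdsWithin_mono 0 fun t (ht : t ∈ Ioi 0) => (mem_Ioi.1 ht).ne')
  simpa using h2

theorem one_sub_exp_le (l t : ℝ) : 1 - Real.exp (-l * t) ≤ l * t := by
  have := Real.add_one_le_exp (-l * t)
  linarith

theorem exp_neg_mul_le_one {l t : ℝ} (hl : 0 ≤ l) (ht : 0 ≤ t) : Real.exp (-l * t) ≤ 1 := by
  rw [Real.exp_le_one_iff]
  nlinarith [mul_nonneg hl ht]

/-- A diagonal operator with negative eigenvalues generates the diagonal semigroup
`exp (-lam i t)`. -/
theorem IsDiagonal.exists_generates [CompleteSpace E] (hD : IsDiagonal L b lam c) :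
    ∃ S, Generates L S := by
  have hex : ∀ t : ℝ, ∃ D : E →L[ℝ] E,
      0 ≤ t → ∀ x i, inner ℝ (b i) (D x) = Real.exp (-lam i * t) * inner ℝ (b i) x := by
    intro t
    by_cases ht : 0 ≤ t
    · obtain ⟨D, -, hD'⟩ := exists_multiplier b (f := fun i => Real.exp (-lam i * t))
        zero_le_one fun i => by
          rw [abs_of_pos (Real.exp_pos _)]
          exact exp_neg_mul_le_one (hD.lam_pos i).le ht
      exact ⟨D, fun _ => hD'⟩
    · exact ⟨0, fun h => absurd h ht⟩
  choose S hS using hex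
  have hcoord : ∀ x i, ∀ t : ℝ, 0 < t → inner ℝ (b i) (t⁻¹ • (S t x - x)) =
      t⁻¹ * (Real.exp (-lam i * t) - 1) * inner ℝ (b i) x := by
    intro x i t ht
    rw [inner_smul_right, inner_sub_right, hS t ht.le]
    ring
  refine ⟨S, ?_, ?_, ?_, ?_⟩
  · ext x
    refine ext_coord b fun i => ?_
    rw [hS 0 le_rfl]
    simp
  · intro s t hs ht
    ext x
    refine ext_coord b fun i => ?_
    rw [ContinuousLinearMap.comp_apply, hS _ (add_nonneg hs ht), hS s hs, hS t ht, ← mul_assoc,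
      ← Real.exp_add, mul_add]
  · intro x
    refine tendsto_of_coord b (fun t => S t x) x x (C := 1) ?_ fun i => ?_
    · filter_upwards [self_mem_nhdsWithin] with t ht i
      rw [inner_sub_right, hS t ht, ← sub_one_mul, abs_mul]
      refine mul_le_mul_of_nonneg_right ?_ (abs_nonneg _)
      have h1 := exp_neg_mul_le_one (hD.lam_pos i).le ht
      have h2 := Real.exp_pos (-lam i * t)
      rw [abs_le]
      constructor <;> linarith
    · have h1 : Tendsto (fun t : ℝ => Real.exp (-lam i * t) * inner ℝ (b i) x) (𝓝[≥] 0)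
          (𝓝 (Real.exp (-lam i * 0) * inner ℝ (b i) x)) := by
        refine Tendsto.mono_left ?_ nhdsWithin_le_nhds
        exact Continuous.tendsto (by fun_prop) 0
      rw [mul_zero, Real.exp_zero, one_mul] at h1
      refine h1.congr' ?_
      filter_upwards [self_mem_nhdsWithin] with t ht
      rw [hS t ht]
  · intro x y
    rw [hD.mem_graph]
    constructor
    · intro h
      refine tendsto_of_coord b _ y y (C := 1) ?_ fun i => ?_
      · filter_upwards [self_mem_nhdsWithin] with t ht i
        have ht' : 0 < t := ht
        rw [inner_sub_right, hcoord x i t ht, h i, ← sub_mul, one_mul, abs_mul, abs_mul]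
        refine mul_le_mul_of_nonneg_right ?_ (abs_nonneg _)
        have h1 := exp_neg_mul_le_one (hD.lam_pos i).le ht'.le
        have h2 := one_sub_exp_le (lam i) t
        have h3 : t⁻¹ * (Real.exp (-lam i * t) - 1) ≤ 0 :=
          mul_nonpos_of_nonneg_of_nonpos (by positivity) (by linarith)
        have h4 : -lam i ≤ t⁻¹ * (Real.exp (-lam i * t) - 1) := by
          rw [inv_mul_eq_div, le_div_iff₀ ht']
          linarith
        have h5 := hD.lam_pos i
        rw [abs_neg, abs_of_pos h5, abs_le]
        constructor <;> linarith
      · rw [h i]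
        refine ((tendsto_exp_slope (lam i)).mul_const (inner ℝ (b i) x)).congr' ?_
        filter_upwards [self_mem_nhdsWithin] with t ht
        rw [hcoord x i t ht]
    · intro h i
      have h1 : Tendsto (fun t : ℝ => inner ℝ (b i) (t⁻¹ • (S t x - x))) (𝓝[>] 0)
          (𝓝 (inner ℝ (b i) y)) := ((innerSL ℝ (b i)).continuous.tendsto y).comp h
      refine tendsto_nhds_unique h1 ?_
      refine ((tendsto_exp_slope (lam i)).mul_const (inner ℝ (b i) x)).congr' ?_
      filter_upwards [self_mem_nhdsWithin] with t ht
      rw [hcoord x i t ht]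

/-- By the uniform boundedness principle a strongly continuous semigroup is bounded on compact
time intervals. -/
theorem Generates.exists_norm_le [CompleteSpace E] {S : ℝ → E →L[ℝ] E} (hS : Generates L S)
    (t : ℝ) : ∃ M, ∀ s, 0 ≤ s → s ≤ t → ‖S s‖ ≤ M := by
  have hloc : ∃ n : ℕ, ∀ s, 0 ≤ s → s ≤ 1 / ((n : ℝ) + 1) → ‖S s‖ ≤ n := by
    by_contra! hcon
    choose τ hτ0 hτ hτn using hcon
    have hlim : Tendsto τ atTop (𝓝[≥] 0) := by
      refine tendsto_nhdsWithin_iff.2 ⟨?_, Eventually.of_forall hτ0⟩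
      exact squeeze_zero hτ0 hτ tendsto_one_div_add_atTop_nhds_zero_nat
    obtain ⟨C, hC⟩ := banach_steinhaus (g := fun n => S (τ n)) fun x => by
      have h1 := ((hS.cont x).comp hlim).norm
      obtain ⟨C, hC⟩ := h1.bddAbove_range
      exact ⟨C, fun n => hC ⟨n, rfl⟩⟩
    obtain ⟨n, hn⟩ := exists_nat_gt C
    linarith [hC n, hτn n]
  obtain ⟨n, hn⟩ := hloc
  have hpow : ∀ (k : ℕ) (s : ℝ), 0 ≤ s → S (k * s) = S s ^ k := by
    intro k s hs
    induction k with
    | zero => rw [Nat.cast_zero, zero_mul, hS.zero]; rfl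
    | succ k ih =>
      rw [Nat.cast_succ, add_mul, one_mul, hS.add _ _ (by positivity) hs, ih, pow_succ]
      rfl
  obtain ⟨N, hN⟩ := exists_nat_gt (max 0 (t * (n + 1)))
  have hN0 : (0 : ℝ) < N := (le_max_left _ _).trans_lt hN
  refine ⟨(n : ℝ) ^ N, fun s hs hst => ?_⟩
  have h1 : S s = S (s / N) ^ N := by
    rw [← hpow N _ (by positivity)]
    congr 1
    field_simp
  have h2 : ‖S (s / N)‖ ≤ n := by
    refine hn _ (by positivity) ?_
    rw [div_le_div_iff₀ hN0 (by positivity)]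
    have := (le_max_right _ _).trans_lt hN
    nlinarith
  rw [h1]
  have hN1 : 0 < N := by exact_mod_cast hN0
  exact (norm_pow_le' _ hN1).trans (pow_le_pow_left₀ (norm_nonneg _) h2 _)

theorem Generates.continuousOn [CompleteSpace E] {S : ℝ → E →L[ℝ] E} (hS : Generates L S)
    (x : E) : ContinuousOn (fun t => S t x) (Ici 0) := by
  intro t ht
  obtain ⟨M, hM⟩ := hS.exists_norm_le (t + 1)
  have hM0 : 0 ≤ M := (norm_nonneg _).trans (hM 0 le_rfl (by linarith [mem_Ici.1 ht]))
  have hT : Tendsto (fun s : ℝ => M * ‖S |s - t| x - x‖) (𝓝 t) (𝓝 0) := by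
    have h1 : Tendsto (fun s : ℝ => |s - t|) (𝓝 t) (𝓝[≥] 0) := by
      refine tendsto_nhdsWithin_iff.2 ⟨?_, Eventually.of_forall fun s => mem_Ici.2 (abs_nonneg _)⟩
      have : Continuous fun s : ℝ => |s - t| := by fun_prop
      simpa using this.tendsto t
    have h2 := (((hS.cont x).comp h1).sub_const x).norm.const_mul M
    simpa only [sub_self, norm_zero, mul_zero, Function.comp_apply] using h2
  rw [ContinuousWithinAt, tendsto_iff_norm_sub_tendsto_zero]
  refine squeeze_zero' (Eventually.of_forall fun s => norm_nonneg _) ?_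
    (hT.mono_left nhdsWithin_le_nhds)
  filter_upwards [self_mem_nhdsWithin] with s hs
  rcases le_total s t with hst | hst
  · have h1 : S t x = S s (S |s - t| x) := by
      rw [← ContinuousLinearMap.comp_apply, ← hS.add s _ hs (abs_nonneg _),
        abs_of_nonpos (by linarith)]
      congr 2
      ring
    rw [h1, ← norm_neg, neg_sub, ← map_sub]
    exact ((S s).le_opNorm _).trans
      (mul_le_mul_of_nonneg_right (hM s hs (by linarith)) (norm_nonneg _))
  · have h1 : S s x = S t (S |s - t| x) := by
      rw [← ContinuousLinearMap.comp_apply, ← hS.add t _ ht (abs_nonneg _),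
        abs_of_nonneg (by linarith)]
      congr 2
      ring
    rw [h1, ← map_sub]
    exact ((S t).le_opNorm _).trans
      (mul_le_mul_of_nonneg_right (hM t ht (by linarith)) (norm_nonneg _))

/-- A semigroup generated by `L` acts on eigenvectors of `L` by exponentials: the function
`exp (l t) • S t e` is continuous and has vanishing right derivative. -/
theorem Generates.apply_eigenvector [CompleteSpace E] {S : ℝ → E →L[ℝ] E} (hS : Generates L S)
    {e : E} {l : ℝ} (he : (e, -l • e) ∈ L.graph) {t : ℝ} (ht : 0 ≤ t) :
    S t e = Real.exp (-l * t) • e := by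
  have hc := hS.continuousOn e
  have hder : ∀ s, 0 ≤ s → HasDerivWithinAt (fun r => S r e) (-l • S s e) (Ici s) s := by
    intro s hs
    have h1 := (hS.generator _ _).1 he
    have h2 : Tendsto (fun r : ℝ => r - s) (𝓝[>] s) (𝓝[>] 0) := by
      refine tendsto_nhdsWithin_iff.2 ⟨?_, ?_⟩
      · have : Continuous fun r : ℝ => r - s := by fun_prop
        simpa using (this.tendsto s).mono_left (nhdsWithin_le_nhds (s := Ioi s))
      · filter_upwards [self_mem_nhdsWithin] with r hr
        exact mem_Ioi.2 (sub_pos.2 (mem_Ioi.1 hr))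
    have h3 := ((S s).continuous.tendsto _).comp (h1.comp h2)
    rw [← hasDerivWithinAt_Ioi_iff_Ici, hasDerivWithinAt_iff_tendsto_slope' (by simp),
      ← map_smul]
    refine h3.congr' ?_
    filter_upwards [self_mem_nhdsWithin] with r hr
    have hr' : s < r := hr
    simp only [Function.comp_apply, slope_def_module, map_smul, map_sub]
    rw [← ContinuousLinearMap.comp_apply, ← hS.add s _ hs (by linarith)]
    congr 4
    ring
  have key := constant_of_has_deriv_right_zero (f := fun s => Real.exp (l * s) • S s e)
    (a := 0) (b := t) ?_ ?_ t ⟨ht, le_rfl⟩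
  · simp only [mul_zero, Real.exp_zero, one_smul, hS.zero, ContinuousLinearMap.id_apply] at key
    calc S t e = Real.exp (-l * t) • Real.exp (l * t) • S t e := by
          rw [smul_smul, ← Real.exp_add]
          simp
      _ = _ := by rw [key]
  · refine ContinuousOn.smul (by fun_prop) (hc.mono fun s hs => hs.1)
  · intro s hs
    have h1 : HasDerivWithinAt (fun r : ℝ => Real.exp (l * r)) (Real.exp (l * s) * l) (Ici s) s :=
      by simpa using (((hasDerivAt_id s).const_mul l).exp).hasDerivWithinAt
    have h2 := h1.smul (hder s hs.1)
    refine h2.congr_deriv ?_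
    module

theorem IsDiagonal.generates_semigroup [CompleteSpace E] (hD : IsDiagonal L b lam c) :
    Generates L (semigroup L) :=
  Classical.epsilon_spec hD.exists_generates

/-- The coordinates of the semigroup generated by a diagonal operator. -/
theorem IsDiagonal.semigroup_coord [CompleteSpace E] (hD : IsDiagonal L b lam c) {t : ℝ}
    (ht : 0 ≤ t) (x : E) (i : ι) :
    inner ℝ (b i) (semigroup L t x) = Real.exp (-lam i * t) * inner ℝ (b i) x := by
  have h1 : (innerSL ℝ (b i)) ∘L (semigroup L t) = Real.exp (-lam i * t) • innerSL ℝ (b i) := by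
    refine ContinuousLinearMap.ext_on (s := range b) ?_ ?_
    · have := b.dense_span
      rw [Submodule.dense_iff_topologicalClosure_eq_top]
      exact this
    · rintro _ ⟨j, rfl⟩
      have h2 := hD.generates_semigroup.apply_eigenvector (hD.eigenvector_mem_graph j) ht
      change inner ℝ (b i) (semigroup L t (b j)) = Real.exp (-lam i * t) * inner ℝ (b i) (b j)
      rw [h2, inner_smul_right]
      by_cases hij : i = j
      · rw [hij]
      · rw [b.orthonormal.2 hij]
        simp
  exact congrArg (fun f => f x) h1

end Semigroups

/-! ### Smoothing estimates -/

section Smoothing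

variable {E : Type*} [NormedAddCommGroup E] [InnerProductSpace ℝ E] {ι : Type*}
  {L : E →ₗ.[ℝ] E} {b : HilbertBasis ι ℝ E} {lam : ι → ℝ} {c : ℝ}

/-- The properties of an analytic contraction semigroup on `[0, ∞)` that the estimates of the
convolutions need. -/
structure IsSmoothing {E : Type*} [NormedAddCommGroup E] [NormedSpace ℝ E]
    (S : ℝ → E →L[ℝ] E) : Prop where
  add : ∀ s t, 0 ≤ s → 0 ≤ t → S (s + t) = S s ∘L S t
  norm_le_one : ∀ t, 0 ≤ t → ‖S t‖ ≤ 1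
  norm_sub_le : ∀ θ : ℝ, 0 ≤ θ → θ ≤ 1 → ∀ s t : ℝ, 0 < s → s ≤ t →
    ‖S t - S s‖ ≤ (t - s) ^ θ * s ^ (-θ)
  continuousOn : ∀ x, ContinuousOn (fun t => S t x) (Ici 0)

theorem norm_clm_le_of_coord (b : HilbertBasis ι ℝ E) {D : E →L[ℝ] E} {f : ι → ℝ} {C : ℝ}
    (hC : 0 ≤ C) (hD : ∀ x i, inner ℝ (b i) (D x) = f i * inner ℝ (b i) x)
    (hf : ∀ i, |f i| ≤ C) : ‖D‖ ≤ C :=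
  D.opNorm_le_bound hC fun x => norm_le_of_coord_le b hC fun i => by
    rw [hD, abs_mul]
    exact mul_le_mul_of_nonneg_right (hf i) (abs_nonneg _)

theorem rpow_mul_exp_neg_le_one {θ x : ℝ} (hθ : 0 ≤ θ) (hθ' : θ ≤ 1) (hx : 0 ≤ x) :
    x ^ θ * Real.exp (-x) ≤ 1 := by
  have h1 : x ^ θ ≤ Real.exp x := by
    rcases le_total x 1 with h | h
    · exact (Real.rpow_le_one hx h hθ).trans (Real.one_le_exp hx)
    · calc x ^ θ ≤ x ^ (1 : ℝ) := Real.rpow_le_rpow_of_exponent_le h hθ'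
        _ = x := Real.rpow_one x
        _ ≤ Real.exp x := by linarith [Real.add_one_le_exp x]
  rw [Real.exp_neg, ← div_eq_mul_inv]
  exact (div_le_one (Real.exp_pos x)).2 h1

theorem one_sub_exp_neg_le_rpow {θ x : ℝ} (hθ : 0 ≤ θ) (hθ' : θ ≤ 1) (hx : 0 ≤ x) :
    1 - Real.exp (-x) ≤ x ^ θ := by
  rcases le_total x 1 with h | h
  · rcases hx.eq_or_lt with rfl | hx0
    · simpa using Real.rpow_nonneg le_rfl θ
    · calc 1 - Real.exp (-x) ≤ x := by linarith [Real.add_one_le_exp (-x)]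
        _ = x ^ (1 : ℝ) := (Real.rpow_one x).symm
        _ ≤ x ^ θ := Real.rpow_le_rpow_of_exponent_ge hx0 h hθ'
  · linarith [Real.one_le_rpow h hθ, Real.exp_pos (-x)]

theorem IsDiagonal.isSmoothing [CompleteSpace E] (hD : IsDiagonal L b lam c) :
    IsSmoothing (semigroup L) where
  add := hD.generates_semigroup.add
  norm_le_one t ht := norm_clm_le_of_coord b zero_le_one (fun x i => hD.semigroup_coord ht x i)
    fun i => by
      rw [abs_of_pos (Real.exp_pos _)]
      exact exp_neg_mul_le_one (hD.lam_pos i).le ht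
  norm_sub_le θ hθ hθ' s t hs hst := by
    have hts : 0 ≤ t - s := by linarith
    refine norm_clm_le_of_coord b (f := fun i => Real.exp (-lam i * t) - Real.exp (-lam i * s))
      (by positivity) (fun x i => ?_) fun i => ?_
    · rw [sub_apply, inner_sub_right, hD.semigroup_coord (hs.le.trans hst),
        hD.semigroup_coord hs.le]
      ring
    · have hl := hD.lam_pos i
      have h1 : Real.exp (-lam i * t) - Real.exp (-lam i * s)
          = -((1 - Real.exp (-(lam i * (t - s)))) * Real.exp (-(lam i * s))) := by
        rw [sub_mul, ← Real.exp_add]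
        ring_nf
      have h2 : 0 ≤ 1 - Real.exp (-(lam i * (t - s))) := by
        have : Real.exp (-(lam i * (t - s))) ≤ 1 := by
          rw [Real.exp_le_one_iff]
          nlinarith [mul_nonneg hl.le hts]
        linarith
      rw [h1, abs_neg, abs_of_nonneg (by positivity)]
      have h3 := one_sub_exp_neg_le_rpow hθ hθ' (mul_nonneg hl.le hts)
      have h4 := rpow_mul_exp_neg_le_one hθ hθ' (mul_nonneg hl.le hs.le)
      rw [Real.mul_rpow hl.le hs.le] at h4
      rw [Real.mul_rpow hl.le hts] at h3
      calc (1 - Real.exp (-(lam i * (t - s)))) * Real.exp (-(lam i * s))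
          ≤ (lam i ^ θ * (t - s) ^ θ) * Real.exp (-(lam i * s)) :=
            mul_le_mul_of_nonneg_right h3 (Real.exp_pos _).le
        _ = (t - s) ^ θ * s ^ (-θ) * (lam i ^ θ * s ^ θ * Real.exp (-(lam i * s))) := by
            have : s ^ (-θ) * s ^ θ = 1 := by
              rw [← Real.rpow_add hs]
              simp
            linear_combination (-(lam i ^ θ * (t - s) ^ θ * Real.exp (-(lam i * s)))) * this
        _ ≤ (t - s) ^ θ * s ^ (-θ) * 1 :=
            mul_le_mul_of_nonneg_left h4 (by positivity)
        _ = _ := mul_one _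
  continuousOn x := hD.generates_semigroup.continuousOn x

variable {F : Type*} [NormedAddCommGroup F] [NormedSpace ℝ F] {S : ℝ → F →L[ℝ] F}

theorem IsSmoothing.continuousOn_norm (hS : IsSmoothing S) : ContinuousOn S (Ioi 0) := by
  intro t ht
  have ht0 : 0 < t := ht
  refine ContinuousAt.continuousWithinAt ?_
  rw [ContinuousAt, tendsto_iff_norm_sub_tendsto_zero]
  have h1 : Tendsto (fun s : ℝ => |s - t| * (t / 2)⁻¹) (𝓝 t) (𝓝 0) := by
    have : Continuous fun s : ℝ => |s - t| * (t / 2)⁻¹ := by fun_prop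
    simpa using this.tendsto t
  refine squeeze_zero' (Eventually.of_forall fun s => norm_nonneg _) ?_ h1
  filter_upwards [lt_mem_nhds (half_lt_self ht0)] with s hs
  have hs0 : 0 < s := (half_pos ht0).trans hs
  rcases le_total s t with hst | hst
  · have h2 := hS.norm_sub_le 1 zero_le_one le_rfl s t hs0 hst
    rw [← norm_neg, neg_sub, abs_sub_comm, abs_of_nonneg (by linarith)]
    refine h2.trans ?_
    rw [Real.rpow_one, Real.rpow_neg_one]
    exact mul_le_mul_of_nonneg_left (inv_anti₀ (by linarith) hs.le) (by linarith)
  · have h2 := hS.norm_sub_le 1 zero_le_one le_rfl t s ht0 hst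
    rw [abs_of_nonneg (by linarith)]
    refine h2.trans ?_
    rw [Real.rpow_one, Real.rpow_neg_one]
    exact mul_le_mul_of_nonneg_left (inv_anti₀ (by linarith) (by linarith)) (by linarith)

theorem half_rpow_neg_le {θ x : ℝ} (hθ' : θ ≤ 1) (hx : 0 < x) :
    (x / 2) ^ (-θ) ≤ 2 * x ^ (-θ) := by
  rw [Real.div_rpow hx.le (by norm_num), Real.rpow_neg (by norm_num : (0 : ℝ) ≤ 2), div_inv_eq_mul,
    mul_comm]
  refine mul_le_mul_of_nonneg_right ?_ (by positivity)
  calc (2 : ℝ) ^ θ ≤ 2 ^ (1 : ℝ) := Real.rpow_le_rpow_of_exponent_le (by norm_num) hθ'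
    _ = 2 := Real.rpow_one 2

/-- Mixed second differences of the semigroup gain smallness in both increments. -/
theorem IsSmoothing.norm_sub_sub_sub_le (hS : IsSmoothing S) {g a x τ η : ℝ} (hg : 0 ≤ g)
    (hg' : g ≤ 1) (ha : 0 ≤ a) (ha' : a ≤ 1) (hx : 0 < x) (hτ : 0 ≤ τ) (hη : 0 ≤ η) :
    ‖(S (x + τ) - S x) - (S (x + η + τ) - S (x + η))‖ ≤ 4 * τ ^ g * η ^ a * x ^ (-g - a) := by
  have hx2 : 0 < x / 2 := by linarith
  have e : (S (x + τ) - S x) - (S (x + η + τ) - S (x + η)) =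
      -((S (x / 2 + τ) - S (x / 2)) ∘L (S (x / 2 + η) - S (x / 2))) := by
    rw [ContinuousLinearMap.sub_comp, ContinuousLinearMap.comp_sub, ContinuousLinearMap.comp_sub,
      ← hS.add _ _ (by linarith) (by linarith), ← hS.add _ _ (by linarith) (by linarith),
      ← hS.add _ _ (by linarith) (by linarith), ← hS.add _ _ (by linarith) (by linarith),
      show x / 2 + τ + (x / 2 + η) = x + η + τ by ring, show x / 2 + τ + x / 2 = x + τ by ring,
      show x / 2 + (x / 2 + η) = x + η by ring, show x / 2 + x / 2 = x by ring]
    abel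
  rw [e, norm_neg]
  have h1 := hS.norm_sub_le g hg hg' (x / 2) (x / 2 + τ) hx2 (by linarith)
  have h2 := hS.norm_sub_le a ha ha' (x / 2) (x / 2 + η) hx2 (by linarith)
  rw [add_sub_cancel_left] at h1 h2
  have h3 : τ ^ g * (x / 2) ^ (-g) ≤ τ ^ g * (2 * x ^ (-g)) :=
    mul_le_mul_of_nonneg_left (half_rpow_neg_le hg' hx) (by positivity)
  have h4 : η ^ a * (x / 2) ^ (-a) ≤ η ^ a * (2 * x ^ (-a)) :=
    mul_le_mul_of_nonneg_left (half_rpow_neg_le ha' hx) (by positivity)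
  calc _ ≤ ‖S (x / 2 + τ) - S (x / 2)‖ * ‖S (x / 2 + η) - S (x / 2)‖ :=
        ContinuousLinearMap.opNorm_comp_le _ _
    _ ≤ (τ ^ g * (2 * x ^ (-g))) * (η ^ a * (2 * x ^ (-a))) :=
        mul_le_mul (h1.trans h3) (h2.trans h4) (norm_nonneg _) (by positivity)
    _ = _ := by
        rw [sub_eq_add_neg (-g) a, Real.rpow_add hx]
        ring

/-- The operators `L S(t)`, `t > 0`. -/
theorem IsDiagonal.exists_generator_comp [CompleteSpace E] (hD : IsDiagonal L b lam c) :
    ∃ R : ℝ → E →L[ℝ] E, (∀ t, 0 < t → ∀ x i, inner ℝ (b i) (R t x) =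
        -lam i * Real.exp (-lam i * t) * inner ℝ (b i) x) ∧
      (∀ t, 0 < t → ‖R t‖ ≤ t⁻¹ * Real.exp (-(c / 2) * t)) ∧
      (∀ t x, 0 ≤ t → 0 < x → R (t + x) = semigroup L t ∘L R x) ∧
      ContinuousOn R (Ioi 0) := by
  have hbd : ∀ t, 0 < t → ∀ i, |-lam i * Real.exp (-lam i * t)| ≤
      t⁻¹ * Real.exp (-(c / 2) * t) := by
    intro t ht i
    have hl := hD.lam_pos i
    have hc := hD.pos
    have hcl := hD.le i
    rw [abs_mul, abs_neg, abs_of_pos hl, abs_of_pos (Real.exp_pos _), inv_mul_eq_div,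
      le_div_iff₀ ht]
    have h1 : Real.exp (-lam i * t) = Real.exp (-(lam i / 2 * t)) * Real.exp (-(lam i / 2 * t)) := by
      rw [← Real.exp_add]
      ring_nf
    have h2 : lam i * t * Real.exp (-(lam i / 2 * t)) ≤ 1 := by
      have h3 := Real.add_one_le_exp (lam i / 2 * t - 1)
      have h4 : Real.exp (lam i / 2 * t - 1) * Real.exp (-(lam i / 2 * t)) = Real.exp (-1) := by
        rw [← Real.exp_add]
        ring_nf
      have h5 : Real.exp (-1) ≤ 1 / 2 := by
        rw [Real.exp_neg, one_div]
        exact inv_anti₀ (by norm_num) (by linarith [Real.add_one_le_exp 1])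
      have h6 := mul_le_mul_of_nonneg_right h3 (Real.exp_pos (-(lam i / 2 * t))).le
      linarith
    have h7 : Real.exp (-(lam i / 2 * t)) ≤ Real.exp (-(c / 2) * t) := by
      rw [Real.exp_le_exp]
      nlinarith
    calc lam i * Real.exp (-lam i * t) * t
        = lam i * t * Real.exp (-(lam i / 2 * t)) * Real.exp (-(lam i / 2 * t)) := by
          rw [h1]; ring
      _ ≤ 1 * Real.exp (-(lam i / 2 * t)) := mul_le_mul_of_nonneg_right h2 (Real.exp_pos _).le
      _ ≤ _ := by linarith
  have hex : ∀ t : ℝ, ∃ D : E →L[ℝ] E, 0 < t → ‖D‖ ≤ t⁻¹ * Real.exp (-(c / 2) * t) ∧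
      ∀ x i, inner ℝ (b i) (D x) = -lam i * Real.exp (-lam i * t) * inner ℝ (b i) x := by
    intro t
    by_cases ht : 0 < t
    · obtain ⟨D, hD'⟩ := exists_multiplier b (by positivity) (hbd t ht)
      exact ⟨D, fun _ => hD'⟩
    · exact ⟨0, fun h => absurd h ht⟩
  choose R hR using hex
  have hadd : ∀ t x, 0 ≤ t → 0 < x → R (t + x) = semigroup L t ∘L R x := by
    intro t x ht hx
    ext y
    refine ext_coord b fun i => ?_
    rw [(hR (t + x) (by linarith)).2, ContinuousLinearMap.comp_apply, hD.semigroup_coord ht,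
      (hR x hx).2, mul_add, Real.exp_add]
    ring
  refine ⟨R, fun t ht => (hR t ht).2, fun t ht => (hR t ht).1, hadd, ?_⟩
  intro t ht
  have ht0 : 0 < t := ht
  refine ContinuousAt.continuousWithinAt ?_
  have h1 : ContinuousAt (fun s => semigroup L (s - t / 2) ∘L R (t / 2)) t := by
    have h2 : ContinuousAt (semigroup L) (t - t / 2) :=
      hD.isSmoothing.continuousOn_norm.continuousAt (Ioi_mem_nhds (by linarith))
    exact (ContinuousAt.comp (f := fun s : ℝ => s - t / 2) h2 (by fun_prop)).clm_comp
      continuousAt_const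
  refine h1.congr ?_
  filter_upwards [lt_mem_nhds (half_lt_self ht0)] with s hs
  rw [← hadd _ _ (by linarith) (by linarith), sub_add_cancel]

end Smoothing

/-! ### Fubini's theorem on a triangle and the beta integral -/

section Triangle

/-- The triangle `a < q < r < b`, as a set of pairs `(r, q)`. -/
def triangle (a b : ℝ) : Set (ℝ × ℝ) := {z | a < z.2 ∧ z.2 < z.1 ∧ z.1 < b}

theorem isOpen_triangle (a b : ℝ) : IsOpen (triangle a b) :=
  (isOpen_lt continuous_const continuous_snd).inter
    ((isOpen_lt continuous_snd continuous_fst).inter (isOpen_lt continuous_fst continuous_const))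

theorem triangle_subset_prod (a b : ℝ) : triangle a b ⊆ Ioo a b ×ˢ Ioo a b := fun _ hz =>
  ⟨⟨hz.1.trans hz.2.1, hz.2.2⟩, ⟨hz.1, hz.2.1.trans hz.2.2⟩⟩

theorem measurableSet_triangle (a b : ℝ) : MeasurableSet (triangle a b) :=
  (isOpen_triangle a b).measurableSet

theorem indicator_triangle_left {F : Type*} [Zero F] (a b : ℝ) (K : ℝ × ℝ → F) (r : ℝ) :
    (fun q => (triangle a b).indicator K (r, q)) =
      (Ioo a b).indicator (fun r => (Ioo a r).indicator fun q => K (r, q)) r := by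
  funext q
  by_cases hr : r ∈ Ioo a b
  · rw [indicator_of_mem hr]
    by_cases hq : q ∈ Ioo a r
    · rw [indicator_of_mem hq, indicator_of_mem (show (r, q) ∈ triangle a b from
        ⟨hq.1, hq.2, hr.2⟩)]
    · rw [indicator_of_notMem hq, indicator_of_notMem]
      exact fun h => hq ⟨h.1, h.2.1⟩
  · rw [indicator_of_notMem hr, indicator_of_notMem]
    · rfl
    · exact fun h => hr ⟨h.1.trans h.2.1, h.2.2⟩

theorem indicator_triangle_right {F : Type*} [Zero F] (a b : ℝ) (K : ℝ × ℝ → F) (q : ℝ) :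
    (fun r => (triangle a b).indicator K (r, q)) =
      (Ioo a b).indicator (fun q => (Ioo q b).indicator fun r => K (r, q)) q := by
  funext r
  by_cases hq : q ∈ Ioo a b
  · rw [indicator_of_mem hq]
    by_cases hr : r ∈ Ioo q b
    · rw [indicator_of_mem hr, indicator_of_mem (show (r, q) ∈ triangle a b from
        ⟨hq.1, hr.1, hr.2⟩)]
    · rw [indicator_of_notMem hr, indicator_of_notMem]
      exact fun h => hr ⟨h.2.1, h.2.2⟩
  · rw [indicator_of_notMem hq, indicator_of_notMem]
    · rfl
    · exact fun h => hq ⟨h.1, h.2.1.trans h.2.2⟩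

theorem integral_indicator_triangle_left {E : Type*} [NormedAddCommGroup E] [NormedSpace ℝ E]
    (a b : ℝ) (K : ℝ × ℝ → E) (r : ℝ) :
    ∫ q, (triangle a b).indicator K (r, q) =
      (Ioo a b).indicator (fun r => ∫ q in a..r, K (r, q)) r := by
  rw [indicator_triangle_left]
  by_cases hr : r ∈ Ioo a b
  · rw [indicator_of_mem hr, indicator_of_mem hr, integral_indicator measurableSet_Ioo,
      intervalIntegral.integral_of_le hr.1.le, integral_Ioc_eq_integral_Ioo]
  · rw [indicator_of_notMem hr, indicator_of_notMem hr]
    simp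

theorem integral_indicator_triangle_right {E : Type*} [NormedAddCommGroup E] [NormedSpace ℝ E]
    (a b : ℝ) (K : ℝ × ℝ → E) (q : ℝ) :
    ∫ r, (triangle a b).indicator K (r, q) =
      (Ioo a b).indicator (fun q => ∫ r in q..b, K (r, q)) q := by
  rw [indicator_triangle_right]
  by_cases hq : q ∈ Ioo a b
  · rw [indicator_of_mem hq, indicator_of_mem hq, integral_indicator measurableSet_Ioo,
      intervalIntegral.integral_of_le hq.2.le, integral_Ioc_eq_integral_Ioo]
  · rw [indicator_of_notMem hq, indicator_of_notMem hq]
    simp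

variable {E : Type*} [NormedAddCommGroup E] {a b : ℝ} {K : ℝ × ℝ → E}

theorem integrableOn_triangle_of_left
    (hK : AEStronglyMeasurable K (volume.restrict (triangle a b)))
    (h1 : ∀ r ∈ Ioo a b, IntervalIntegrable (fun q => K (r, q)) volume a r)
    (h2 : IntegrableOn (fun r => ∫ q in a..r, ‖K (r, q)‖) (Ioo a b)) :
    IntegrableOn K (triangle a b) := by
  rw [← integrable_indicator_iff (measurableSet_triangle a b), Measure.volume_eq_prod]
  rw [integrable_prod_iff ((aestronglyMeasurable_indicator_iff
    (measurableSet_triangle a b)).2 hK)]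
  constructor
  · refine Eventually.of_forall fun r => ?_
    rw [indicator_triangle_left]
    by_cases hr : r ∈ Ioo a b
    · rw [indicator_of_mem hr, integrable_indicator_iff measurableSet_Ioo]
      exact (((intervalIntegrable_iff_integrableOn_Ioc_of_le hr.1.le).1 (h1 r hr))).mono_set
        Ioo_subset_Ioc_self
    · rw [indicator_of_notMem hr]
      exact integrable_zero _ _ _
  · have : (fun r => ∫ q, ‖(triangle a b).indicator K (r, q)‖) =
        (Ioo a b).indicator (fun r => ∫ q in a..r, ‖K (r, q)‖) := by
      funext r
      rw [← integral_indicator_triangle_left a b (fun z => ‖K z‖)]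
      simp only [norm_indicator_eq_indicator_norm]
    rw [this, integrable_indicator_iff measurableSet_Ioo]
    exact h2

theorem integrableOn_triangle_of_right
    (hK : AEStronglyMeasurable K (volume.restrict (triangle a b)))
    (h1 : ∀ q ∈ Ioo a b, IntervalIntegrable (fun r => K (r, q)) volume q b)
    (h2 : IntegrableOn (fun q => ∫ r in q..b, ‖K (r, q)‖) (Ioo a b)) :
    IntegrableOn K (triangle a b) := by
  rw [← integrable_indicator_iff (measurableSet_triangle a b), Measure.volume_eq_prod]
  rw [integrable_prod_iff' ((aestronglyMeasurable_indicator_iff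
    (measurableSet_triangle a b)).2 hK)]
  constructor
  · refine Eventually.of_forall fun q => ?_
    rw [indicator_triangle_right]
    by_cases hq : q ∈ Ioo a b
    · rw [indicator_of_mem hq, integrable_indicator_iff measurableSet_Ioo]
      exact (((intervalIntegrable_iff_integrableOn_Ioc_of_le hq.2.le).1 (h1 q hq))).mono_set
        Ioo_subset_Ioc_self
    · rw [indicator_of_notMem hq]
      exact integrable_zero _ _ _
  · have : (fun q => ∫ r, ‖(triangle a b).indicator K (r, q)‖) =
        (Ioo a b).indicator (fun q => ∫ r in q..b, ‖K (r, q)‖) := by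
      funext q
      rw [← integral_indicator_triangle_right a b (fun z => ‖K z‖)]
      simp only [norm_indicator_eq_indicator_norm]
    rw [this, integrable_indicator_iff measurableSet_Ioo]
    exact h2

theorem aestronglyMeasurable_fst_triangle {f : ℝ → E}
    (hf : AEStronglyMeasurable f (volume.restrict (Ioo a b))) :
    AEStronglyMeasurable (fun z : ℝ × ℝ => f z.1) (volume.restrict (triangle a b)) := by
  have h1 : AEStronglyMeasurable (fun z : ℝ × ℝ => f z.1)
      ((volume.restrict (Ioo a b)).prod (volume.restrict (Ioo a b))) := hf.comp_fst
  refine h1.mono_measure ?_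
  rw [Measure.prod_restrict, ← Measure.volume_eq_prod]
  exact Measure.restrict_mono (triangle_subset_prod a b) le_rfl

theorem aestronglyMeasurable_snd_triangle {f : ℝ → E}
    (hf : AEStronglyMeasurable f (volume.restrict (Ioo a b))) :
    AEStronglyMeasurable (fun z : ℝ × ℝ => f z.2) (volume.restrict (triangle a b)) := by
  have h1 : AEStronglyMeasurable (fun z : ℝ × ℝ => f z.2)
      ((volume.restrict (Ioo a b)).prod (volume.restrict (Ioo a b))) := hf.comp_snd
  refine h1.mono_measure ?_
  rw [Measure.prod_restrict, ← Measure.volume_eq_prod]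
  exact Measure.restrict_mono (triangle_subset_prod a b) le_rfl

variable [NormedSpace ℝ E]

theorem intervalIntegrable_integral_left (hab : a ≤ b) (hK : IntegrableOn K (triangle a b)) :
    IntervalIntegrable (fun r => ∫ q in a..r, K (r, q)) volume a b := by
  rw [← integrable_indicator_iff (measurableSet_triangle a b), Measure.volume_eq_prod] at hK
  have h := hK.integral_prod_left
  simp only [integral_indicator_triangle_left] at h
  rw [intervalIntegrable_iff_integrableOn_Ioo_of_le hab]
  exact (integrable_indicator_iff measurableSet_Ioo).1 h

theorem integral_integral_left (hab : a ≤ b) (hK : IntegrableOn K (triangle a b)) :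
    ∫ r in a..b, ∫ q in a..r, K (r, q) = ∫ z in triangle a b, K z := by
  rw [← integral_indicator (measurableSet_triangle a b), Measure.volume_eq_prod, integral_prod]
  · simp only [integral_indicator_triangle_left]
    rw [integral_indicator measurableSet_Ioo, intervalIntegral.integral_of_le hab,
      integral_Ioc_eq_integral_Ioo]
  · rw [← Measure.volume_eq_prod, integrable_indicator_iff (measurableSet_triangle a b)]
    exact hK

theorem integral_integral_right (hab : a ≤ b) (hK : IntegrableOn K (triangle a b)) :
    ∫ q in a..b, ∫ r in q..b, K (r, q) = ∫ z in triangle a b, K z := by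
  rw [← integral_indicator (measurableSet_triangle a b), Measure.volume_eq_prod,
    integral_prod_symm]
  · simp only [integral_indicator_triangle_right]
    rw [integral_indicator measurableSet_Ioo, intervalIntegral.integral_of_le hab,
      integral_Ioc_eq_integral_Ioo]
  · rw [← Measure.volume_eq_prod, integrable_indicator_iff (measurableSet_triangle a b)]
    exact hK

/-- Fubini's theorem for iterated integrals over the triangle `a < q < r < b`. -/
theorem integral_triangle_swap (hab : a ≤ b) (hK : IntegrableOn K (triangle a b)) :
    ∫ r in a..b, ∫ q in a..r, K (r, q) = ∫ q in a..b, ∫ r in q..b, K (r, q) := by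
  rw [integral_integral_left hab hK, integral_integral_right hab hK]

/-- The beta integral `∫_0^1 (1 - r)^p r^q dr`, with the exponents of the integrand as
arguments. -/
def betaInt (p q : ℝ) : ℝ := ∫ r in (0 : ℝ)..1, (1 - r) ^ p * r ^ q

theorem betaInt_nonneg (p q : ℝ) : 0 ≤ betaInt p q := by
  refine intervalIntegral.integral_nonneg zero_le_one fun r hr => ?_
  exact mul_nonneg (Real.rpow_nonneg (by linarith [hr.2]) _) (Real.rpow_nonneg hr.1 _)

theorem betaInt_eq_gamma {p q : ℝ} (hp : 0 < p) (hq : 0 < q) :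
    betaInt (p - 1) (q - 1) = Real.Gamma p * Real.Gamma q / Real.Gamma (p + q) := by
  have h1 := Complex.Gamma_mul_Gamma_eq_betaIntegral (s := (q : ℂ)) (t := (p : ℂ))
    (by simpa using hq) (by simpa using hp)
  have h2 : Complex.betaIntegral q p = (betaInt (p - 1) (q - 1) : ℂ) := by
    rw [Complex.betaIntegral, betaInt, ← intervalIntegral.integral_ofReal]
    refine intervalIntegral.integral_congr fun r hr => ?_
    rw [uIcc_of_le zero_le_one] at hr
    push_cast
    rw [Complex.ofReal_cpow hr.1, Complex.ofReal_cpow (by linarith [hr.2])]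
    push_cast
    ring
  rw [h2, ← Complex.ofReal_add, Complex.Gamma_ofReal, Complex.Gamma_ofReal,
    Complex.Gamma_ofReal] at h1
  have h3 : Real.Gamma q * Real.Gamma p = Real.Gamma (q + p) * betaInt (p - 1) (q - 1) := by
    exact_mod_cast h1
  have h4 : Real.Gamma (p + q) ≠ 0 := (Real.Gamma_pos_of_pos (by linarith)).ne'
  rw [eq_div_iff h4, mul_comm, add_comm p q, ← h3, mul_comm]

theorem intervalIntegrable_beta {p q x y : ℝ} (hp : -1 < p) (hq : -1 < q) (hxy : x ≤ y) :
    IntervalIntegrable (fun r => (y - r) ^ p * (r - x) ^ q) volume x y := by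
  rcases hxy.eq_or_lt with rfl | hxy
  · simp
  have hm1 : x < (x + y) / 2 := by linarith
  have hm2 : (x + y) / 2 < y := by linarith
  refine IntervalIntegrable.trans (b := (x + y) / 2) ?_ ?_
  · have h1 : IntervalIntegrable (fun r => (r - x) ^ q) volume x ((x + y) / 2) := by
      have := (intervalIntegral.intervalIntegrable_rpow' (a := 0) (b := (x + y) / 2 - x)
        hq).comp_sub_right x
      simpa using this
    refine h1.continuousOn_mul ?_
    refine ContinuousOn.rpow_const (by fun_prop) fun r hr => Or.inl ?_
    rw [uIcc_of_le hm1.le] at hr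
    linarith [hr.2]
  · have h1 : IntervalIntegrable (fun r => (y - r) ^ p) volume ((x + y) / 2) y := by
      have := (intervalIntegral.intervalIntegrable_rpow' (a := y - (x + y) / 2) (b := 0)
        hp).comp_sub_left y
      simpa using this
    refine h1.mul_continuousOn ?_
    refine ContinuousOn.rpow_const (by fun_prop) fun r hr => Or.inl ?_
    rw [uIcc_of_le hm2.le] at hr
    linarith [hr.1]

theorem integral_beta {p q x y : ℝ} (hxy : x < y) :
    ∫ r in x..y, (y - r) ^ p * (r - x) ^ q = betaInt p q * (y - x) ^ (p + q + 1) := by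
  have h0 : 0 < y - x := sub_pos.2 hxy
  have h1 := intervalIntegral.smul_integral_comp_mul_add
    (fun r => (y - r) ^ p * (r - x) ^ q) (y - x) x (a := 0) (b := 1)
  rw [mul_zero, mul_one, zero_add, sub_add_cancel] at h1
  rw [← h1, betaInt, smul_eq_mul, ← intervalIntegral.integral_const_mul,
    ← intervalIntegral.integral_mul_const]
  refine intervalIntegral.integral_congr fun r hr => ?_
  rw [uIcc_of_le zero_le_one] at hr
  rw [show y - ((y - x) * r + x) = (y - x) * (1 - r) by ring, add_sub_cancel_right,
    Real.mul_rpow h0.le (by linarith [hr.2]), Real.mul_rpow h0.le hr.1, Real.rpow_add h0,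
    Real.rpow_add h0, Real.rpow_one]
  ring

theorem integral_rpow_left {p x y : ℝ} (hp : -1 < p) :
    ∫ r in x..y, (y - r) ^ p = (y - x) ^ (p + 1) / (p + 1) := by
  rw [intervalIntegral.integral_comp_sub_left (fun s => s ^ p) y, sub_self,
    integral_rpow (Or.inl hp), Real.zero_rpow (by linarith), sub_zero]

theorem integral_rpow_right {p x y : ℝ} (hp : -1 < p) :
    ∫ r in x..y, (r - x) ^ p = (y - x) ^ (p + 1) / (p + 1) := by
  rw [intervalIntegral.integral_comp_sub_right (fun s => s ^ p) x, sub_self,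
    integral_rpow (Or.inl hp), Real.zero_rpow (by linarith), sub_zero]

theorem intervalIntegrable_rpow_left {p x y z : ℝ} (hp : -1 < p) :
    IntervalIntegrable (fun r => (z - r) ^ p) volume x y := by
  have := (intervalIntegral.intervalIntegrable_rpow' (a := z - x) (b := z - y) hp).comp_sub_left z
  simpa using this

theorem intervalIntegrable_rpow_right {p x y z : ℝ} (hp : -1 < p) :
    IntervalIntegrable (fun r => (r - z) ^ p) volume x y := by
  have := (intervalIntegral.intervalIntegrable_rpow' (a := x - z) (b := y - z) hp).comp_sub_right z
  simpa using this

end Triangle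

/-! ### Inversion of fractional derivatives -/

section Inversion

variable {E : Type*} [NormedAddCommGroup E] [NormedSpace ℝ E] {a b x : ℝ} {f : ℝ → E}

theorem integrableOn_fractional_comp {p q : ℝ} (hp : -1 < p) (hq : -1 < q) (hpq : 0 ≤ p + q + 1)
    (hax : a ≤ x) (hf : IntervalIntegrable f volume a x) :
    IntegrableOn (fun z : ℝ × ℝ => ((x - z.1) ^ p * (z.1 - z.2) ^ q) • f z.2)
      (triangle a x) := by
  have hfm : AEStronglyMeasurable f (volume.restrict (Ioo a x)) :=
    ((intervalIntegrable_iff_integrableOn_Ioo_of_le hax).1 hf).aestronglyMeasurable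
  refine integrableOn_triangle_of_right ?_ ?_ ?_
  · refine AEStronglyMeasurable.smul ?_ (aestronglyMeasurable_snd_triangle hfm)
    exact Measurable.aestronglyMeasurable (by fun_prop)
  · intro s hs
    exact (intervalIntegrable_beta hp hq hs.2.le).smul_continuousOn
      (g := fun _ => f s) continuousOn_const
  · have h1 : IntervalIntegrable
        (fun s => betaInt p q * (x - s) ^ (p + q + 1) * ‖f s‖) volume a x := by
      refine hf.norm.continuousOn_mul ?_
      refine ContinuousOn.mul continuousOn_const ?_
      exact ContinuousOn.rpow_const (by fun_prop) fun s _ => Or.inr hpq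
    refine ((intervalIntegrable_iff_integrableOn_Ioo_of_le hax).1 h1).congr_fun ?_
      measurableSet_Ioo
    intro s hs
    simp only
    rw [← integral_beta hs.2, ← intervalIntegral.integral_mul_const]
    refine intervalIntegral.integral_congr fun r hr => ?_
    rw [uIcc_of_le hs.2.le] at hr
    rw [norm_smul, Real.norm_of_nonneg]
    exact mul_nonneg (Real.rpow_nonneg (by linarith [hr.2]) _)
      (Real.rpow_nonneg (by linarith [hr.1]) _)

/-- The composition rule for Riemann-Liouville integrals. -/
theorem integral_fractional_comp [CompleteSpace E] {p q : ℝ} (hp : -1 < p) (hq : -1 < q)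
    (hpq : 0 ≤ p + q + 1) (hax : a ≤ x) (hf : IntervalIntegrable f volume a x) :
    ∫ r in a..x, (x - r) ^ p • ∫ s in a..r, (r - s) ^ q • f s =
      betaInt p q • ∫ s in a..x, (x - s) ^ (p + q + 1) • f s := by
  have h := integral_triangle_swap hax (integrableOn_fractional_comp hp hq hpq hax hf)
  simp only at h
  calc _ = ∫ r in a..x, ∫ s in a..r, ((x - r) ^ p * (r - s) ^ q) • f s := by
        simp only [mul_smul, intervalIntegral.integral_smul]
    _ = _ := h
    _ = ∫ s in a..x, betaInt p q • ((x - s) ^ (p + q + 1) • f s) := by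
        rw [intervalIntegral.integral_of_le hax, intervalIntegral.integral_of_le hax,
          integral_Ioc_eq_integral_Ioo, integral_Ioc_eq_integral_Ioo]
        refine setIntegral_congr_fun measurableSet_Ioo fun s hs => ?_
        rw [intervalIntegral.integral_smul_const, integral_beta hs.2, mul_smul]
    _ = _ := by rw [intervalIntegral.integral_smul]

/-- The kernel of the Weyl derivative as a function of two variables. -/
def marchaudKernel (α : ℝ) (f : ℝ → E) (z : ℝ × ℝ) : E := weylLeftKernel α f z.1 z.2

theorem integral_shifted_rpow {α ε y : ℝ} (hε : 0 < ε) (hy : 0 ≤ y) :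
    ∫ s in (0 : ℝ)..y, α * (s + ε) ^ (-(1 + α)) = ε ^ (-α) - (y + ε) ^ (-α) := by
  have h1 : ∀ s ∈ uIcc 0 y, HasDerivAt (fun s : ℝ => -(s + ε) ^ (-α))
      (α * (s + ε) ^ (-(1 + α))) s := by
    intro s hs
    rw [uIcc_of_le hy] at hs
    have h2 := ((hasDerivAt_id s).add_const ε).rpow_const (p := -α)
      (Or.inl (ne_of_gt (by change 0 < s + ε; linarith [hs.1])))
    refine h2.neg.congr_deriv ?_
    simp only [id_eq]
    rw [show -α - 1 = -(1 + α) by ring]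
    ring
  rw [intervalIntegral.integral_eq_sub_of_hasDerivAt h1]
  · simp only [zero_add]
    ring
  · refine ContinuousOn.intervalIntegrable ?_
    refine ContinuousOn.mul continuousOn_const (ContinuousOn.rpow_const (by fun_prop) fun s hs => ?_)
    rw [uIcc_of_le hy] at hs
    exact Or.inl (by linarith [hs.1])

theorem integrableOn_fst_triangle {E : Type*} [NormedAddCommGroup E] {f : ℝ → E}
    (hf : IntegrableOn f (Ioo a b)) :
    IntegrableOn (fun z : ℝ × ℝ => f z.1) (triangle a b) := by
  have h1 : Integrable (fun z : ℝ × ℝ => f z.1)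
      ((volume.restrict (Ioo a b)).prod (volume.restrict (Ioo a b))) := hf.comp_fst _
  rw [Measure.prod_restrict, ← Measure.volume_eq_prod] at h1
  exact IntegrableOn.mono_set h1 (triangle_subset_prod a b)

theorem integrableOn_snd_triangle {E : Type*} [NormedAddCommGroup E] {f : ℝ → E}
    (hf : IntegrableOn f (Ioo a b)) :
    IntegrableOn (fun z : ℝ × ℝ => f z.2) (triangle a b) := by
  have h1 : Integrable (fun z : ℝ × ℝ => f z.2)
      ((volume.restrict (Ioo a b)).prod (volume.restrict (Ioo a b))) := hf.comp_snd _
  rw [Measure.prod_restrict, ← Measure.volume_eq_prod] at h1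
  exact IntegrableOn.mono_set h1 (triangle_subset_prod a b)

/-- The integral of the regularised kernel: shifting the singularity by `ε` makes the two parts
of the difference `f r - f q` separately integrable. -/
theorem integral_regularised_kernel [CompleteSpace E] {α ε : ℝ} (hα : 0 < α) (hε : 0 < ε)
    (hax : a ≤ x) (hf : IntegrableOn f (Ioo a x)) :
    ∫ z in triangle a x, (α * (z.1 - z.2 + ε) ^ (-(1 + α))) • (f z.1 - f z.2) =
      ∫ q in a..x, ((x - q + ε) ^ (-α) - (q - a + ε) ^ (-α)) • f q := by
  have hbd : ∀ g : ℝ × ℝ → E, IntegrableOn g (triangle a x) →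
      IntegrableOn (fun z : ℝ × ℝ => (α * (z.1 - z.2 + ε) ^ (-(1 + α))) • g z)
        (triangle a x) := by
    intro g hg
    refine Integrable.bdd_smul hg (α * ε ^ (-(1 + α))) ?_ ?_
    · exact Measurable.aestronglyMeasurable (by fun_prop)
    · refine (ae_restrict_iff' (measurableSet_triangle a x)).2 (Eventually.of_forall fun z hz => ?_)
      have h1 : 0 < z.1 - z.2 := sub_pos.2 hz.2.1
      rw [Real.norm_of_nonneg (by positivity)]
      exact mul_le_mul_of_nonneg_left
        (Real.rpow_le_rpow_of_nonpos hε (by linarith) (by linarith)) hα.le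
  have h1 := hbd _ (integrableOn_fst_triangle hf)
  have h2 := hbd _ (integrableOn_snd_triangle hf)
  have e1 : ∫ z in triangle a x, (α * (z.1 - z.2 + ε) ^ (-(1 + α))) • f z.1 =
      ∫ r in a..x, (ε ^ (-α) - (r - a + ε) ^ (-α)) • f r := by
    rw [← integral_integral_left hax h1, intervalIntegral.integral_of_le hax,
      intervalIntegral.integral_of_le hax, integral_Ioc_eq_integral_Ioo,
      integral_Ioc_eq_integral_Ioo]
    refine setIntegral_congr_fun measurableSet_Ioo fun r hr => ?_
    simp only
    rw [intervalIntegral.integral_smul_const,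
      intervalIntegral.integral_comp_sub_left (fun s => α * (s + ε) ^ (-(1 + α))) r, sub_self,
      integral_shifted_rpow hε (by linarith [hr.1])]
  have e2 : ∫ z in triangle a x, (α * (z.1 - z.2 + ε) ^ (-(1 + α))) • f z.2 =
      ∫ q in a..x, (ε ^ (-α) - (x - q + ε) ^ (-α)) • f q := by
    rw [← integral_integral_right hax h2, intervalIntegral.integral_of_le hax,
      intervalIntegral.integral_of_le hax, integral_Ioc_eq_integral_Ioo,
      integral_Ioc_eq_integral_Ioo]
    refine setIntegral_congr_fun measurableSet_Ioo fun r hr => ?_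
    simp only
    rw [intervalIntegral.integral_smul_const,
      intervalIntegral.integral_comp_sub_right (fun s => α * (s + ε) ^ (-(1 + α))) r, sub_self,
      integral_shifted_rpow hε (by linarith [hr.2])]
  simp only [smul_sub]
  rw [integral_sub h1 h2, e1, e2, ← intervalIntegral.integral_sub]
  · refine intervalIntegral.integral_congr fun q _ => ?_
    module
  · refine IntervalIntegrable.continuousOn_smul
      ((intervalIntegrable_iff_integrableOn_Ioo_of_le hax).2 hf) ?_
    refine ContinuousOn.sub continuousOn_const (ContinuousOn.rpow_const (by fun_prop) fun r hr => ?_)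
    rw [uIcc_of_le hax] at hr
    exact Or.inl (by linarith [hr.1])
  · refine IntervalIntegrable.continuousOn_smul
      ((intervalIntegrable_iff_integrableOn_Ioo_of_le hax).2 hf) ?_
    refine ContinuousOn.sub continuousOn_const (ContinuousOn.rpow_const (by fun_prop) fun r hr => ?_)
    rw [uIcc_of_le hax] at hr
    exact Or.inl (by linarith [hr.2])

theorem integrableOn_of_bounded {E : Type*} [NormedAddCommGroup E] {f : ℝ → E} {M : ℝ}
    (hfm : AEStronglyMeasurable f (volume.restrict (Ioo a x)))
    (hM : ∀ r ∈ Ioo a x, ‖f r‖ ≤ M) : IntegrableOn f (Ioo a x) :=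
  Integrable.of_bound hfm M
    ((ae_restrict_iff' measurableSet_Ioo).2 (Eventually.of_forall hM))

theorem intervalIntegrable_rpow_smul {M : ℝ} {g : ℝ → ℝ} (hax : a ≤ x)
    (hg : IntervalIntegrable g volume a x)
    (hfm : AEStronglyMeasurable f (volume.restrict (Ioo a x)))
    (hM : ∀ r ∈ Ioo a x, ‖f r‖ ≤ M) : IntervalIntegrable (fun r => g r • f r) volume a x := by
  rw [intervalIntegrable_iff_integrableOn_Ioo_of_le hax] at hg ⊢
  exact Integrable.smul_bdd hg M hfm
    ((ae_restrict_iff' measurableSet_Ioo).2 (Eventually.of_forall hM))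

/-- The primitive of the Weyl derivative of order `α` is, up to constants, the fractional integral of
order `1 - α`. The regularised kernels converge under the domination by the Marchaud kernel. -/
theorem integral_weylLeft_eq [CompleteSpace E] {α M : ℝ} (hα : 0 < α) (hα' : α < 1)
    (hax : a ≤ x) (hfm : AEStronglyMeasurable f (volume.restrict (Ioo a x)))
    (hM : ∀ r ∈ Ioo a x, ‖f r‖ ≤ M) (hK : IntegrableOn (marchaudKernel α f) (triangle a x)) :
    ∫ r in a..x, ((r - a) ^ (-α) • f r + α • ∫ q in a..r, weylLeftKernel α f r q) =
      ∫ q in a..x, (x - q) ^ (-α) • f q := by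
  have hf := integrableOn_of_bounded hfm hM
  have hα1 : -1 < -α := by linarith
  have i1 : IntervalIntegrable (fun r => (r - a) ^ (-α)) volume a x :=
    intervalIntegrable_rpow_right hα1
  have i2 : IntervalIntegrable (fun r => (x - r) ^ (-α)) volume a x :=
    intervalIntegrable_rpow_left hα1
  have j1 := intervalIntegrable_rpow_smul hax i1 hfm hM
  have j2 := intervalIntegrable_rpow_smul hax i2 hfm hM
  have hpos : ∀ᶠ ε in 𝓝[>] (0 : ℝ), 0 < ε := self_mem_nhdsWithin
  have hε0 : Tendsto (fun ε : ℝ => ε) (𝓝[>] 0) (𝓝 0) := nhdsWithin_le_nhds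
  have l1 : Tendsto (fun ε : ℝ => ∫ z in triangle a x,
      (α * (z.1 - z.2 + ε) ^ (-(1 + α))) • (f z.1 - f z.2)) (𝓝[>] 0)
      (𝓝 (∫ z in triangle a x, α • marchaudKernel α f z)) := by
    refine tendsto_integral_filter_of_dominated_convergence
      (fun z => α * ‖marchaudKernel α f z‖) ?_ ?_ (hK.norm.const_mul α) ?_
    · refine Eventually.of_forall fun ε => ?_
      refine AEStronglyMeasurable.smul (Measurable.aestronglyMeasurable (by fun_prop)) ?_
      exact (aestronglyMeasurable_fst_triangle hfm).sub (aestronglyMeasurable_snd_triangle hfm)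
    · filter_upwards [hpos] with ε hε
      refine (ae_restrict_iff' (measurableSet_triangle a x)).2 (Eventually.of_forall fun z hz => ?_)
      have h1 : 0 < z.1 - z.2 := sub_pos.2 hz.2.1
      rw [marchaudKernel, weylLeftKernel, norm_smul, norm_smul, Real.norm_of_nonneg (by positivity),
        Real.norm_of_nonneg (by positivity), ← mul_assoc]
      refine mul_le_mul_of_nonneg_right (mul_le_mul_of_nonneg_left ?_ hα.le) (norm_nonneg _)
      exact Real.rpow_le_rpow_of_nonpos h1 (by linarith) (by linarith)
    · refine (ae_restrict_iff' (measurableSet_triangle a x)).2 (Eventually.of_forall fun z hz => ?_)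
      have h1 : 0 < z.1 - z.2 := sub_pos.2 hz.2.1
      rw [marchaudKernel, weylLeftKernel, smul_smul]
      refine Tendsto.smul_const (Tendsto.const_mul α ?_) _
      have h2 : Tendsto (fun ε : ℝ => z.1 - z.2 + ε) (𝓝[>] 0) (𝓝 (z.1 - z.2)) := by
        simpa using hε0.const_add (z.1 - z.2)
      exact h2.rpow_const (Or.inl h1.ne')
  have l2 : Tendsto (fun ε : ℝ => ∫ q in a..x,
      ((x - q + ε) ^ (-α) - (q - a + ε) ^ (-α)) • f q) (𝓝[>] 0)
      (𝓝 (∫ q in a..x, ((x - q) ^ (-α) - (q - a) ^ (-α)) • f q)) := by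
    simp only [intervalIntegral.integral_of_le hax, integral_Ioc_eq_integral_Ioo]
    refine tendsto_integral_filter_of_dominated_convergence
      (fun q => ((x - q) ^ (-α) + (q - a) ^ (-α)) * M) ?_ ?_ ?_ ?_
    · refine Eventually.of_forall fun ε => ?_
      exact AEStronglyMeasurable.smul (Measurable.aestronglyMeasurable (by fun_prop)) hfm
    · filter_upwards [hpos] with ε hε
      refine (ae_restrict_iff' measurableSet_Ioo).2 (Eventually.of_forall fun q hq => ?_)
      have h1 : 0 < x - q := sub_pos.2 hq.2
      have h2 : 0 < q - a := sub_pos.2 hq.1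
      rw [norm_smul]
      refine mul_le_mul ?_ (hM q hq) (norm_nonneg _) (by positivity)
      refine (norm_sub_le _ _).trans (add_le_add ?_ ?_)
      · rw [Real.norm_of_nonneg (by positivity)]
        exact Real.rpow_le_rpow_of_nonpos h1 (by linarith) (by linarith)
      · rw [Real.norm_of_nonneg (by positivity)]
        exact Real.rpow_le_rpow_of_nonpos h2 (by linarith) (by linarith)
    · exact (intervalIntegrable_iff_integrableOn_Ioo_of_le hax).1 ((i2.add i1).mul_const M)
    · refine (ae_restrict_iff' measurableSet_Ioo).2 (Eventually.of_forall fun q hq => ?_)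
      have h1 : 0 < x - q := sub_pos.2 hq.2
      have h2 : 0 < q - a := sub_pos.2 hq.1
      refine Tendsto.smul_const (Tendsto.sub ?_ ?_) _
      · have h3 : Tendsto (fun ε : ℝ => x - q + ε) (𝓝[>] 0) (𝓝 (x - q)) := by
          simpa using hε0.const_add (x - q)
        exact h3.rpow_const (Or.inl h1.ne')
      · have h3 : Tendsto (fun ε : ℝ => q - a + ε) (𝓝[>] 0) (𝓝 (q - a)) := by
          simpa using hε0.const_add (q - a)
        exact h3.rpow_const (Or.inl h2.ne')
  have key : ∫ z in triangle a x, α • marchaudKernel α f z =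
      ∫ q in a..x, ((x - q) ^ (-α) - (q - a) ^ (-α)) • f q := by
    refine tendsto_nhds_unique l1 (l2.congr' ?_)
    filter_upwards [hpos] with ε hε
    exact (integral_regularised_kernel hα hε hax hf).symm
  have e1 : ∫ z in triangle a x, α • marchaudKernel α f z =
      ∫ r in a..x, α • ∫ q in a..r, weylLeftKernel α f r q := by
    rw [integral_smul, ← integral_integral_left hax hK, intervalIntegral.integral_smul]
    rfl
  have j3 : IntervalIntegrable (fun r => α • ∫ q in a..r, weylLeftKernel α f r q) volume a x :=
    (intervalIntegrable_integral_left hax hK).smul α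
  rw [intervalIntegral.integral_add j1 j3, ← e1, key]
  simp only [sub_smul]
  rw [intervalIntegral.integral_sub j2 j1]
  abel

theorem triangle_mono {a b x : ℝ} (h : x ≤ b) : triangle a x ⊆ triangle a b := fun _ hz =>
  ⟨hz.1, hz.2.1, hz.2.2.trans_le h⟩

theorem intervalIntegrable_weylLeft {α M : ℝ} (hα' : α < 1)
    (hab : a ≤ b) (hfm : AEStronglyMeasurable f (volume.restrict (Ioo a b)))
    (hM : ∀ r ∈ Ioo a b, ‖f r‖ ≤ M) (hK : IntegrableOn (marchaudKernel α f) (triangle a b)) :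
    IntervalIntegrable (weylLeft α a f) volume a b := by
  have i1 : IntervalIntegrable (fun r => (r - a) ^ (-α)) volume a b :=
    intervalIntegrable_rpow_right (by linarith)
  have j1 := intervalIntegrable_rpow_smul hab i1 hfm hM
  exact (j1.add ((intervalIntegrable_integral_left hab hK).smul α)).smul _

/-- Two integrable functions with the same primitive agree almost everywhere. -/
theorem ae_eq_of_integral_eq [CompleteSpace E] {g : ℝ → E} (hab : a ≤ b)
    (hf : IntervalIntegrable f volume a b) (hg : IntervalIntegrable g volume a b)
    (h : ∀ x ∈ Ioo a b, ∫ r in a..x, f r = ∫ r in a..x, g r) :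
    ∀ᵐ x ∂(volume.restrict (Ioo a b)), f x = g x := by
  rw [ae_restrict_iff' measurableSet_Ioo]
  filter_upwards [hf.ae_hasDerivAt_integral, hg.ae_hasDerivAt_integral] with x h1 h2 hx
  have hx' : x ∈ uIcc a b := by
    rw [uIcc_of_le hab]
    exact Ioo_subset_Icc_self hx
  have h3 := h1 hx' a left_mem_uIcc
  have h4 := h2 hx' a left_mem_uIcc
  refine h3.unique (h4.congr_of_eventuallyEq ?_)
  filter_upwards [isOpen_Ioo.mem_nhds hx] with y hy
  exact h y hy

/-- A bounded function whose Weyl derivative converges absolutely is the Riemann-Liouville integral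
of its Weyl derivative. Applying the integral of order `α` to
`∫_a^y D^α f = I^(1-α) f (y)` shows that both sides have the same primitive. -/
theorem ae_eq_fractional_integral_weylLeft [CompleteSpace E] {α M : ℝ} (hα : 0 < α) (hα' : α < 1)
    (hab : a ≤ b) (hfm : AEStronglyMeasurable f (volume.restrict (Ioo a b)))
    (hM : ∀ r ∈ Ioo a b, ‖f r‖ ≤ M) (hK : IntegrableOn (marchaudKernel α f) (triangle a b)) :
    ∀ᵐ x ∂(volume.restrict (Ioo a b)),
      f x = (Real.Gamma α)⁻¹ • ∫ y in a..x, (x - y) ^ (α - 1) • weylLeft α a f y := by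
  have hf := (intervalIntegrable_iff_integrableOn_Ioo_of_le hab).2 (integrableOn_of_bounded hfm hM)
  have hφ := intervalIntegrable_weylLeft hα' hab hfm hM hK
  have hsub : ∀ {g : ℝ → E} {x : ℝ}, x ∈ Ioo a b → IntervalIntegrable g volume a b →
      IntervalIntegrable g volume a x := by
    intro g x hx hg
    refine hg.mono_set ?_
    rw [uIcc_of_le hx.1.le, uIcc_of_le hab]
    exact Icc_subset_Icc_right hx.2.le
  have hG0 := Real.Gamma_pos_of_pos hα
  have hG1 := Real.Gamma_pos_of_pos (sub_pos.2 hα')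
  refine ae_eq_of_integral_eq hab hf ?_ ?_
  · refine IntervalIntegrable.smul ?_ _
    have h1 := integrableOn_fractional_comp (p := 0) (q := α - 1) (by norm_num) (by linarith)
      (by linarith) hab hφ
    refine (intervalIntegrable_integral_left hab h1).congr ?_
    intro r _
    simp
  · intro x hx
    have hax := hx.1.le
    have hfx : ∀ {y}, y ∈ Ioo a x → AEStronglyMeasurable f (volume.restrict (Ioo a y)) := fun hy =>
      hfm.mono_measure (Measure.restrict_mono (Ioo_subset_Ioo_right (hy.2.trans hx.2).le) le_rfl)
    -- the identity `∫_a^y D^α f = I^(1-α) f (y)`, up to the normalising constants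
    have h1 : ∀ y ∈ Ioo a x, ∫ r in a..y, weylLeft α a f r =
        (Real.Gamma (1 - α))⁻¹ • ∫ q in a..y, (y - q) ^ (-α) • f q := by
      intro y hy
      have h2 := integral_weylLeft_eq hα hα' hy.1.le (hfx hy)
        (fun r hr => hM r ⟨hr.1, hr.2.trans (hy.2.trans hx.2)⟩)
        (hK.mono_set (triangle_mono (hy.2.trans hx.2).le))
      rw [← h2, ← intervalIntegral.integral_smul]
      rfl
    have h3 : ∫ y in a..x, (x - y) ^ (α - 1) • ∫ r in a..y, (y - r) ^ (0 : ℝ) • weylLeft α a f r =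
        ∫ y in a..x, (x - y) ^ (α - 1) •
          ((Real.Gamma (1 - α))⁻¹ • ∫ q in a..y, (y - q) ^ (-α) • f q) := by
      rw [intervalIntegral.integral_of_le hax, intervalIntegral.integral_of_le hax,
        integral_Ioc_eq_integral_Ioo, integral_Ioc_eq_integral_Ioo]
      refine setIntegral_congr_fun measurableSet_Ioo fun y hy => ?_
      simp only [Real.rpow_zero, one_smul]
      rw [h1 y hy]
    simp only [smul_comm _ (Real.Gamma (1 - α))⁻¹] at h3
    rw [intervalIntegral.integral_smul,
      integral_fractional_comp (by linarith) (by norm_num) (by linarith) hax (hsub hx hφ),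
      integral_fractional_comp (by linarith) (by linarith) (by linarith) hax (hsub hx hf)] at h3
    have h4 := integral_fractional_comp (p := 0) (q := α - 1) (by norm_num) (by linarith)
      (by linarith) hax (hsub hx hφ)
    have h5 : betaInt 0 (α - 1) = betaInt (α - 1) 0 := by
      have h6 := betaInt_eq_gamma (p := 1) (q := α) one_pos hα
      have h7 := betaInt_eq_gamma (p := α) (q := 1) hα one_pos
      rw [sub_self] at h6 h7
      rw [h6, h7, add_comm, mul_comm]
    have h8 := betaInt_eq_gamma hα (sub_pos.2 hα')
    rw [show (1 : ℝ) - α - 1 = -α by ring, show α + (1 - α) = 1 by ring, Real.Gamma_one,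
      div_one] at h8
    rw [h5, show (0 : ℝ) + (α - 1) + 1 = α - 1 + 0 + 1 by ring, h3, h8] at h4
    simp only [Real.rpow_zero, one_smul] at h4
    rw [intervalIntegral.integral_smul, h4, show α - 1 + -α + 1 = 0 by ring]
    simp only [Real.rpow_zero, one_smul, smul_smul]
    rw [show (Real.Gamma α)⁻¹ * ((Real.Gamma (1 - α))⁻¹ *
      (Real.Gamma α * Real.Gamma (1 - α))) = 1 by field_simp, one_smul]

end Inversion

/-! ### Weyl derivatives of singular Hölder functions -/

section Weyl

/-- Functions on `(a, b)` with a weighted Hölder singularity of order `γ` at `a` and power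
singularities at `b`: the size is controlled by `(b - r) ^ (-σ)`, and the increments pick up an
additional `(b - r) ^ (-η)` with Hölder exponent `η`. This is the behaviour of
`r ↦ S (b - r) (Ψ r)` for a smoothing semigroup `S`. -/
structure Admissible {E : Type*} [NormedAddCommGroup E] (a b γ η σ K : ℝ) (Ψ : ℝ → E) : Prop where
  continuousOn : ContinuousOn Ψ (Ioo a b)
  norm_le : ∀ r ∈ Ioo a b, ‖Ψ r‖ ≤ K * (b - r) ^ (-σ)
  norm_sub_le : ∀ q r, a < q → q < r → r < b → ‖Ψ r - Ψ q‖ ≤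
    K * ((b - r) ^ (-σ) * ((q - a) ^ (-γ) * (r - q) ^ γ) + (b - r) ^ (-σ - η) * (r - q) ^ η)

/-- The size of the Weyl derivative of an admissible function. -/
def leftWeight (a b α η σ r : ℝ) : ℝ :=
  (b - r) ^ (-σ) * (r - a) ^ (-α) + (b - r) ^ (-σ - η) * (r - a) ^ (η - α)

/-- The constant in the bound of the singular integral in the Weyl derivative. -/
def kernelConst (α γ η : ℝ) : ℝ := betaInt (γ - 1 - α) (-γ) + (η - α)⁻¹

/-- The constant in the bound of the left-sided Weyl derivative. -/
def leftConst (α γ η : ℝ) : ℝ := (Real.Gamma (1 - α))⁻¹ * (1 + α * kernelConst α γ η)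

/-- The constant in the bound of the right-sided Weyl derivative. -/
def rightConst (α β : ℝ) : ℝ := (Real.Gamma α)⁻¹ * (1 + (1 - α) * (α + β - 1)⁻¹)

theorem kernelConst_nonneg {α η : ℝ} (γ : ℝ) (hη : α < η) : 0 ≤ kernelConst α γ η :=
  add_nonneg (betaInt_nonneg _ _) (inv_nonneg.2 (by linarith))

theorem leftConst_nonneg {α η : ℝ} (γ : ℝ) (hα : 0 < α) (hα' : α < 1) (hη : α < η) :
    0 ≤ leftConst α γ η := by
  have := kernelConst_nonneg γ hη
  have := Real.Gamma_pos_of_pos (sub_pos.2 hα')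
  unfold leftConst
  positivity

theorem rightConst_nonneg {α β : ℝ} (hα : 0 < α) (hα' : α < 1) (hαβ : 1 < α + β) :
    0 ≤ rightConst α β := by
  have h1 := Real.Gamma_pos_of_pos hα
  have h2 : 0 < (α + β - 1)⁻¹ := inv_pos.2 (by linarith)
  have h3 : 0 < 1 - α := by linarith
  unfold rightConst
  positivity

theorem leftWeight_nonneg {a b r : ℝ} (α η σ : ℝ) (hr : r ∈ Ioo a b) :
    0 ≤ leftWeight a b α η σ r := by
  have h1 : 0 < b - r := sub_pos.2 hr.2
  have h2 : 0 < r - a := sub_pos.2 hr.1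
  unfold leftWeight
  positivity

variable {E : Type*} [NormedAddCommGroup E] {a b α γ η σ K : ℝ} {Ψ : ℝ → E}

theorem Admissible.const_nonneg (h : Admissible a b γ η σ K Ψ) (hab : a < b) : 0 ≤ K := by
  have h1 : (a + b) / 2 ∈ Ioo a b := ⟨by linarith, by linarith⟩
  have h2 := (norm_nonneg _).trans (h.norm_le _ h1)
  have h3 : 0 < b - (a + b) / 2 := by linarith [h1.2]
  exact nonneg_of_mul_nonneg_left h2 (by positivity)

theorem Admissible.aestronglyMeasurable (h : Admissible a b γ η σ K Ψ) :
    AEStronglyMeasurable Ψ (volume.restrict (Ioo a b)) :=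
  h.continuousOn.aestronglyMeasurable measurableSet_Ioo

theorem Admissible.restrict_left (h : Admissible a b γ η σ K Ψ) {s : ℝ} (has : a < s) (hsb : s ≤ b)
    (hσ : 0 ≤ σ) (hη : 0 ≤ η) : Admissible a s γ η σ K Ψ := by
  have hK := h.const_nonneg (has.trans_le hsb)
  have hmono : ∀ {r p : ℝ}, r < s → p ≤ 0 → (b - r) ^ p ≤ (s - r) ^ p := fun hr hp =>
    Real.rpow_le_rpow_of_nonpos (sub_pos.2 hr) (by linarith) hp
  refine ⟨h.continuousOn.mono (Ioo_subset_Ioo_right hsb), fun r hr => ?_, fun q r haq hqr hrs => ?_⟩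
  · exact (h.norm_le r ⟨hr.1, hr.2.trans_le hsb⟩).trans
      (mul_le_mul_of_nonneg_left (hmono hr.2 (by linarith)) hK)
  · refine (h.norm_sub_le q r haq hqr (hrs.trans_le hsb)).trans (mul_le_mul_of_nonneg_left ?_ hK)
    have h1 : 0 < q - a := sub_pos.2 haq
    have h2 : 0 < r - q := sub_pos.2 hqr
    exact add_le_add (mul_le_mul_of_nonneg_right (hmono hrs (by linarith)) (by positivity))
      (mul_le_mul_of_nonneg_right (hmono hrs (by linarith)) (by positivity))

theorem Admissible.restrict_right (h : Admissible a b γ η σ K Ψ) {s : ℝ} (has : a ≤ s) (hsb : s < b)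
    (hγ : 0 ≤ γ) : Admissible s b γ η σ K Ψ := by
  have hK := h.const_nonneg (has.trans_lt hsb)
  refine ⟨h.continuousOn.mono (Ioo_subset_Ioo_left has), fun r hr => ?_, fun q r hsq hqr hrb => ?_⟩
  · exact h.norm_le r ⟨has.trans_lt hr.1, hr.2⟩
  · refine (h.norm_sub_le q r (has.trans_lt hsq) hqr hrb).trans (mul_le_mul_of_nonneg_left ?_ hK)
    have h1 : 0 < q - s := sub_pos.2 hsq
    have h2 : 0 < r - q := sub_pos.2 hqr
    have h3 : 0 < b - r := sub_pos.2 hrb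
    have h4 : (q - a) ^ (-γ) ≤ (q - s) ^ (-γ) :=
      Real.rpow_le_rpow_of_nonpos h1 (by linarith) (by linarith)
    have h5 := mul_le_mul_of_nonneg_right h4 (show 0 ≤ (r - q) ^ γ by positivity)
    exact add_le_add (mul_le_mul_of_nonneg_left h5 (by positivity)) le_rfl

theorem Admissible.norm_le_const (h : Admissible a b γ η 0 K Ψ) :
    ∀ r ∈ Ioo a b, ‖Ψ r‖ ≤ K := fun r hr => by
  simpa using h.norm_le r hr

variable [NormedSpace ℝ E]

theorem Admissible.clm_comp {F : Type*} [NormedAddCommGroup F] [NormedSpace ℝ F]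
    (h : Admissible a b γ η σ K Ψ) (ℓ : E →L[ℝ] F) :
    Admissible a b γ η σ (‖ℓ‖ * K) fun r => ℓ (Ψ r) := by
  refine ⟨ℓ.continuous.comp_continuousOn h.continuousOn, fun r hr => ?_, fun q r h1 h2 h3 => ?_⟩
  · rw [mul_assoc]
    exact (ℓ.le_opNorm _).trans (mul_le_mul_of_nonneg_left (h.norm_le r hr) (norm_nonneg _))
  · rw [mul_assoc, ← map_sub]
    exact (ℓ.le_opNorm _).trans
      (mul_le_mul_of_nonneg_left (h.norm_sub_le q r h1 h2 h3) (norm_nonneg _))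

/-- The pointwise bound of the kernel of the Weyl derivative. -/
theorem Admissible.norm_kernel_le (h : Admissible a b γ η σ K Ψ) {q r : ℝ} (haq : a < q)
    (hqr : q < r) (hrb : r < b) : ‖weylLeftKernel α Ψ r q‖ ≤
      K * ((b - r) ^ (-σ) * ((r - q) ^ (γ - 1 - α) * (q - a) ^ (-γ)) +
        (b - r) ^ (-σ - η) * (r - q) ^ (η - 1 - α)) := by
  have h1 : 0 < r - q := sub_pos.2 hqr
  rw [weylLeftKernel, norm_smul, Real.norm_of_nonneg (by positivity)]
  refine (mul_le_mul_of_nonneg_left (h.norm_sub_le q r haq hqr hrb) (by positivity)).trans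
    (le_of_eq ?_)
  rw [show γ - 1 - α = γ + -(1 + α) by ring, show η - 1 - α = η + -(1 + α) by ring,
    Real.rpow_add h1, Real.rpow_add h1]
  ring

theorem intervalIntegrable_of_norm_le {E : Type*} [NormedAddCommGroup E] {f : ℝ → E} {g : ℝ → ℝ}
    (hab : a ≤ b)
    (hg : IntervalIntegrable g volume a b)
    (hf : AEStronglyMeasurable f (volume.restrict (Ioo a b)))
    (hfg : ∀ r ∈ Ioo a b, ‖f r‖ ≤ g r) : IntervalIntegrable f volume a b := by
  rw [intervalIntegrable_iff_integrableOn_Ioo_of_le hab] at hg ⊢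
  exact Integrable.mono' hg hf ((ae_restrict_iff' measurableSet_Ioo).2 (Eventually.of_forall hfg))

theorem norm_integral_le_of_norm_le_Ioo {f : ℝ → E} {g : ℝ → ℝ} (hab : a ≤ b)
    (hg : IntervalIntegrable g volume a b)
    (hfg : ∀ r ∈ Ioo a b, ‖f r‖ ≤ g r) : ‖∫ r in a..b, f r‖ ≤ ∫ r in a..b, g r := by
  rw [intervalIntegrable_iff_integrableOn_Ioo_of_le hab] at hg
  rw [intervalIntegral.integral_of_le hab, intervalIntegral.integral_of_le hab,
    integral_Ioc_eq_integral_Ioo, integral_Ioc_eq_integral_Ioo]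
  exact norm_integral_le_of_norm_le hg
    ((ae_restrict_iff' measurableSet_Ioo).2 (Eventually.of_forall hfg))

theorem intervalIntegrable_kernel_majorant (hγ : α < γ) (hγ' : γ < 1) (hη : α < η) {r : ℝ}
    (hr : r ∈ Ioo a b) : IntervalIntegrable (fun q =>
      K * ((b - r) ^ (-σ) * ((r - q) ^ (γ - 1 - α) * (q - a) ^ (-γ)) +
        (b - r) ^ (-σ - η) * (r - q) ^ (η - 1 - α))) volume a r := by
  have h1 := intervalIntegrable_beta (p := γ - 1 - α) (q := -γ) (by linarith) (by linarith) hr.1.le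
  have h2 : IntervalIntegrable (fun q => (r - q) ^ (η - 1 - α)) volume a r :=
    intervalIntegrable_rpow_left (by linarith)
  exact ((h1.const_mul _).add (h2.const_mul _)).const_mul _

theorem Admissible.aestronglyMeasurable_kernel (h : Admissible a b γ η σ K Ψ) :
    AEStronglyMeasurable (marchaudKernel α Ψ) (volume.restrict (triangle a b)) := by
  refine AEStronglyMeasurable.smul (Measurable.aestronglyMeasurable (by fun_prop)) ?_
  exact (aestronglyMeasurable_fst_triangle h.aestronglyMeasurable).sub
    (aestronglyMeasurable_snd_triangle h.aestronglyMeasurable)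

theorem Admissible.intervalIntegrable_kernel (h : Admissible a b γ η σ K Ψ) (hγ : α < γ)
    (hγ' : γ < 1) (hη : α < η) {r : ℝ} (hr : r ∈ Ioo a b) :
    IntervalIntegrable (weylLeftKernel α Ψ r) volume a r := by
  refine intervalIntegrable_of_norm_le hr.1.le
    (intervalIntegrable_kernel_majorant (K := K) (σ := σ) hγ hγ' hη hr) ?_
    fun q hq => h.norm_kernel_le hq.1 hq.2 hr.2
  refine AEStronglyMeasurable.smul (Measurable.aestronglyMeasurable (by fun_prop)) ?_
  refine aestronglyMeasurable_const.sub ?_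
  exact h.aestronglyMeasurable.mono_measure
    (Measure.restrict_mono (Ioo_subset_Ioo_right hr.2.le) le_rfl)

theorem Admissible.integral_kernel_le (h : Admissible a b γ η σ K Ψ) (hγ : α < γ)
    (hγ' : γ < 1) (hη : α < η) {r : ℝ} (hr : r ∈ Ioo a b) :
    ∫ q in a..r, ‖weylLeftKernel α Ψ r q‖ ≤ K * kernelConst α γ η * leftWeight a b α η σ r := by
  have hK := h.const_nonneg (hr.1.trans hr.2)
  have hra : 0 < r - a := sub_pos.2 hr.1
  have hbr : 0 < b - r := sub_pos.2 hr.2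
  have h1 := norm_integral_le_of_norm_le_Ioo (f := fun q => ‖weylLeftKernel α Ψ r q‖) hr.1.le
    (intervalIntegrable_kernel_majorant (K := K) (σ := σ) hγ hγ' hη hr)
    fun q hq => by
      rw [norm_norm]
      exact h.norm_kernel_le hq.1 hq.2 hr.2
  refine (le_abs_self _).trans (h1.trans ?_)
  have h2 := intervalIntegrable_beta (p := γ - 1 - α) (q := -γ) (by linarith) (by linarith) hr.1.le
  have h3 : IntervalIntegrable (fun q => (r - q) ^ (η - 1 - α)) volume a r :=
    intervalIntegrable_rpow_left (by linarith)
  rw [intervalIntegral.integral_const_mul, intervalIntegral.integral_add (h2.const_mul _)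
    (h3.const_mul _), intervalIntegral.integral_const_mul, intervalIntegral.integral_const_mul,
    integral_beta hr.1, integral_rpow_left (by linarith), mul_assoc]
  refine mul_le_mul_of_nonneg_left ?_ hK
  rw [show γ - 1 - α + -γ + 1 = -α by ring, show η - 1 - α + 1 = η - α by ring]
  have h4 : 0 < (η - α)⁻¹ := inv_pos.2 (by linarith)
  have h5 := betaInt_nonneg (γ - 1 - α) (-γ)
  have h6 : 0 ≤ (b - r) ^ (-σ) * (r - a) ^ (-α) := by positivity
  have h7 : 0 ≤ (b - r) ^ (-σ - η) * (r - a) ^ (η - α) := by positivity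
  unfold kernelConst leftWeight
  rw [div_eq_mul_inv]
  nlinarith [mul_nonneg h5 h7, mul_nonneg h4.le h6]

theorem Admissible.norm_weylLeft_le (h : Admissible a b γ η σ K Ψ) (hα : 0 < α) (hα' : α < 1)
    (hγ : α < γ) (hγ' : γ < 1) (hη : α < η) {r : ℝ} (hr : r ∈ Ioo a b) :
    ‖weylLeft α a Ψ r‖ ≤ K * leftConst α γ η * leftWeight a b α η σ r := by
  have hK := h.const_nonneg (hr.1.trans hr.2)
  have hra : 0 < r - a := sub_pos.2 hr.1
  have hbr : 0 < b - r := sub_pos.2 hr.2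
  have hG := Real.Gamma_pos_of_pos (sub_pos.2 hα')
  have h1 : ‖(r - a) ^ (-α) • Ψ r‖ ≤ K * leftWeight a b α η σ r := by
    rw [norm_smul, Real.norm_of_nonneg (by positivity)]
    refine (mul_le_mul_of_nonneg_left (h.norm_le r hr) (by positivity)).trans ?_
    unfold leftWeight
    have : 0 ≤ K * ((b - r) ^ (-σ - η) * (r - a) ^ (η - α)) := by positivity
    linarith
  have h2 : ‖∫ q in a..r, weylLeftKernel α Ψ r q‖ ≤
      K * kernelConst α γ η * leftWeight a b α η σ r :=
    (intervalIntegral.norm_integral_le_integral_norm hr.1.le).trans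
      (h.integral_kernel_le hγ hγ' hη hr)
  rw [weylLeft, norm_smul, Real.norm_of_nonneg (by positivity)]
  calc _ ≤ (Real.Gamma (1 - α))⁻¹ * (K * leftWeight a b α η σ r +
        α * (K * kernelConst α γ η * leftWeight a b α η σ r)) := by
        refine mul_le_mul_of_nonneg_left ?_ (by positivity)
        refine (norm_add_le _ _).trans (add_le_add h1 ?_)
        rw [norm_smul, Real.norm_of_nonneg hα.le]
        exact mul_le_mul_of_nonneg_left h2 hα.le
    _ = _ := by
        unfold leftConst
        ring

theorem aestronglyMeasurable_integral_left {K : ℝ × ℝ → E}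
    (hK : AEStronglyMeasurable K (volume.restrict (triangle a b))) :
    AEStronglyMeasurable (fun r => ∫ q in a..r, K (r, q)) (volume.restrict (Ioo a b)) := by
  have h1 := (aestronglyMeasurable_indicator_iff (measurableSet_triangle a b)).2 hK
  rw [Measure.volume_eq_prod] at h1
  have h2 := h1.integral_prod_right'
  simp only [integral_indicator_triangle_left] at h2
  exact (aestronglyMeasurable_indicator_iff measurableSet_Ioo).1 h2

theorem aestronglyMeasurable_integral_right {K : ℝ × ℝ → E}
    (hK : AEStronglyMeasurable K (volume.restrict (triangle a b))) :
    AEStronglyMeasurable (fun q => ∫ r in q..b, K (r, q)) (volume.restrict (Ioo a b)) := by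
  have h1 := (aestronglyMeasurable_indicator_iff (measurableSet_triangle a b)).2 hK
  rw [Measure.volume_eq_prod] at h1
  have h2 := h1.prod_swap.integral_prod_right'
  simp only [Prod.swap_prod_mk, integral_indicator_triangle_right] at h2
  exact (aestronglyMeasurable_indicator_iff measurableSet_Ioo).1 h2

theorem Admissible.aestronglyMeasurable_weylLeft (h : Admissible a b γ η σ K Ψ) :
    AEStronglyMeasurable (weylLeft α a Ψ) (volume.restrict (Ioo a b)) := by
  refine AEStronglyMeasurable.const_smul (AEStronglyMeasurable.add ?_ ?_) _
  · exact AEStronglyMeasurable.smul (Measurable.aestronglyMeasurable (by fun_prop))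
      h.aestronglyMeasurable
  · exact (aestronglyMeasurable_integral_left h.aestronglyMeasurable_kernel).const_smul α

/-- Without a singularity of the size at the right endpoint the kernel is integrable in both
variables jointly. -/
theorem Admissible.integrableOn_kernel (h : Admissible a b γ η 0 K Ψ) (hab : a ≤ b)
    (hγ : α < γ) (hγ' : γ < 1) (hη : α < η) (hη' : η < 1) :
    IntegrableOn (marchaudKernel α Ψ) (triangle a b) := by
  have h1 : IntervalIntegrable (leftWeight a b α η 0) volume a b := by
    refine IntervalIntegrable.add ?_ ?_
    · exact intervalIntegrable_beta (by norm_num) (by linarith) hab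
    · exact intervalIntegrable_beta (by linarith) (by linarith) hab
  refine integrableOn_triangle_of_left h.aestronglyMeasurable_kernel
    (fun r hr => h.intervalIntegrable_kernel hγ hγ' hη hr) ?_
  rw [← intervalIntegrable_iff_integrableOn_Ioo_of_le hab]
  refine intervalIntegrable_of_norm_le hab (h1.const_mul (K * kernelConst α γ η))
    (aestronglyMeasurable_integral_left h.aestronglyMeasurable_kernel.norm) fun r hr => ?_
  rw [Real.norm_of_nonneg]
  · exact h.integral_kernel_le hγ hγ' hη hr
  · exact intervalIntegral.integral_nonneg hr.1.le fun q _ => norm_nonneg _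

theorem weylLeft_sub {Φ : ℝ → E} {r : ℝ}
    (hΨ : IntervalIntegrable (weylLeftKernel α Ψ r) volume a r)
    (hΦ : IntervalIntegrable (weylLeftKernel α Φ r) volume a r) :
    weylLeft α a (fun s => Ψ s - Φ s) r = weylLeft α a Ψ r - weylLeft α a Φ r := by
  have h1 : ∫ q in a..r, weylLeftKernel α (fun s => Ψ s - Φ s) r q =
      (∫ q in a..r, weylLeftKernel α Ψ r q) - ∫ q in a..r, weylLeftKernel α Φ r q := by
    rw [← intervalIntegral.integral_sub hΨ hΦ]
    refine intervalIntegral.integral_congr fun q _ => ?_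
    simp only [weylLeftKernel]
    module
  simp only [weylLeft, h1]
  module

theorem weylLeft_congr {Φ : ℝ → E} {r : ℝ} (har : a < r) (h : ∀ s ∈ Ioc a r, Ψ s = Φ s) :
    weylLeft α a Ψ r = weylLeft α a Φ r := by
  have h1 : ∫ q in a..r, weylLeftKernel α Ψ r q = ∫ q in a..r, weylLeftKernel α Φ r q := by
    rw [intervalIntegral.integral_of_le har.le, intervalIntegral.integral_of_le har.le]
    refine setIntegral_congr_fun measurableSet_Ioc fun q hq => ?_
    simp only [weylLeftKernel]
    rw [h q hq, h r ⟨har, le_rfl⟩]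
  rw [weylLeft, weylLeft, h1, h r ⟨har, le_rfl⟩]

end Weyl

/-! ### The right-sided derivative of a Hölder path -/

section Path

/-- Hölder continuity on the whole line, with constant `C`. -/
def HolderLine {E : Type*} [NormedAddCommGroup E] (β C : ℝ) (ω : ℝ → E) : Prop :=
  0 ≤ C ∧ ∀ s t, s ≤ t → ‖ω t - ω s‖ ≤ C * (t - s) ^ β

variable {E : Type*} [NormedAddCommGroup E] {a b α β C : ℝ} {ω : ℝ → E}

theorem HolderLine.continuous (h : HolderLine β C ω) (hβ : 0 < β) : Continuous ω := by
  rw [continuous_iff_continuousAt]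
  intro t
  rw [ContinuousAt, tendsto_iff_norm_sub_tendsto_zero]
  have h1 : Tendsto (fun s : ℝ => C * |s - t| ^ β) (𝓝 t) (𝓝 0) := by
    have : Continuous fun s : ℝ => C * |s - t| ^ β :=
      continuous_const.mul (Continuous.rpow_const (by fun_prop) fun _ => Or.inr hβ.le)
    simpa [Real.zero_rpow hβ.ne'] using this.tendsto t
  refine squeeze_zero (fun s => norm_nonneg _) (fun s => ?_) h1
  rcases le_total s t with hst | hst
  · rw [norm_sub_rev, abs_of_nonpos (by linarith), neg_sub]
    exact h.2 s t hst
  · rw [abs_of_nonneg (by linarith)]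
    exact h.2 t s hst

variable [NormedSpace ℝ E]

theorem HolderLine.norm_kernel_le (h : HolderLine β C ω) {r q : ℝ} (hrq : r < q) :
    ‖weylRightKernel α ω r q‖ ≤ C * (q - r) ^ (α + β - 2) := by
  have h1 : 0 < q - r := sub_pos.2 hrq
  rw [weylRightKernel, norm_smul, Real.norm_of_nonneg (by positivity), norm_sub_rev]
  refine (mul_le_mul_of_nonneg_left (h.2 r q hrq.le) (by positivity)).trans (le_of_eq ?_)
  rw [show α + β - 2 = -(2 - α) + β by ring, Real.rpow_add h1]
  ring

theorem HolderLine.intervalIntegrable_kernel (h : HolderLine β C ω) (hβ : 0 < β)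
    (hαβ : 1 < α + β) {r : ℝ} (hr : r ≤ b) :
    IntervalIntegrable (weylRightKernel α ω r) volume r b := by
  have h1 : IntervalIntegrable (fun q => C * (q - r) ^ (α + β - 2)) volume r b :=
    (intervalIntegrable_rpow_right (by linarith)).const_mul _
  refine intervalIntegrable_of_norm_le hr h1 ?_ fun q hq => h.norm_kernel_le hq.1
  refine AEStronglyMeasurable.smul (Measurable.aestronglyMeasurable (by fun_prop)) ?_
  exact aestronglyMeasurable_const.sub (h.continuous hβ).aestronglyMeasurable

theorem HolderLine.norm_weylRight_le (h : HolderLine β C ω) (hα : 0 < α) (hα' : α < 1)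
    (hαβ : 1 < α + β) {r : ℝ} (hr : r < b) :
    ‖weylRight α b ω r‖ ≤ C * rightConst α β * (b - r) ^ (α + β - 1) := by
  have hbr : 0 < b - r := sub_pos.2 hr
  have hG := Real.Gamma_pos_of_pos hα
  have hC := h.1
  have h1 : ‖(b - r) ^ (-(1 - α)) • (ω r - ω b)‖ ≤ C * (b - r) ^ (α + β - 1) := by
    rw [norm_smul, Real.norm_of_nonneg (by positivity), norm_sub_rev]
    refine (mul_le_mul_of_nonneg_left (h.2 r b hr.le) (by positivity)).trans (le_of_eq ?_)
    rw [show α + β - 1 = -(1 - α) + β by ring, Real.rpow_add hbr]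
    ring
  have h2 : ‖∫ q in r..b, weylRightKernel α ω r q‖ ≤
      C * ((α + β - 1)⁻¹ * (b - r) ^ (α + β - 1)) := by
    have h3 : IntervalIntegrable (fun q => C * (q - r) ^ (α + β - 2)) volume r b :=
      (intervalIntegrable_rpow_right (by linarith)).const_mul _
    refine (norm_integral_le_of_norm_le_Ioo hr.le h3 fun q hq => h.norm_kernel_le hq.1).trans
      (le_of_eq ?_)
    rw [intervalIntegral.integral_const_mul, integral_rpow_right (by linarith),
      show α + β - 2 + 1 = α + β - 1 by ring]
    ring
  have h1α : 0 < 1 - α := by linarith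
  rw [weylRight, norm_smul, Real.norm_of_nonneg (by positivity)]
  calc _ ≤ (Real.Gamma α)⁻¹ * (C * (b - r) ^ (α + β - 1) +
        (1 - α) * (C * ((α + β - 1)⁻¹ * (b - r) ^ (α + β - 1)))) := by
        refine mul_le_mul_of_nonneg_left ?_ (by positivity)
        refine (norm_add_le _ _).trans (add_le_add h1 ?_)
        rw [norm_smul, Real.norm_of_nonneg h1α.le]
        exact mul_le_mul_of_nonneg_left h2 h1α.le
    _ = _ := by
        unfold rightConst
        ring

theorem aestronglyMeasurable_weylRight (hω : Continuous ω) :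
    AEStronglyMeasurable (weylRight α b ω) (volume.restrict (Ioo a b)) := by
  refine AEStronglyMeasurable.const_smul (AEStronglyMeasurable.add ?_ ?_) _
  · refine AEStronglyMeasurable.smul (Measurable.aestronglyMeasurable (by fun_prop)) ?_
    exact (hω.sub continuous_const).aestronglyMeasurable
  · have h1 : AEStronglyMeasurable (fun z : ℝ × ℝ => weylRightKernel α ω z.2 z.1)
        (volume.restrict (triangle a b)) := by
      refine AEStronglyMeasurable.smul (Measurable.aestronglyMeasurable (by fun_prop)) ?_
      exact ((hω.comp continuous_snd).sub (hω.comp continuous_fst)).aestronglyMeasurable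
    exact (aestronglyMeasurable_integral_right h1).const_smul (1 - α)

theorem weylRight_congr {ω' : ℝ → E} {r : ℝ} (hrb : r ≤ b) (h : ∀ s ∈ Icc r b, ω s = ω' s) :
    weylRight α b ω r = weylRight α b ω' r := by
  have h1 : ∫ q in r..b, weylRightKernel α ω r q = ∫ q in r..b, weylRightKernel α ω' r q := by
    refine intervalIntegral.integral_congr fun q hq => ?_
    rw [uIcc_of_le hrb] at hq
    simp only [weylRightKernel]
    rw [h q hq, h r ⟨le_rfl, hrb⟩]
  rw [weylRight, weylRight, h1, h r ⟨le_rfl, hrb⟩, h b ⟨hrb, le_rfl⟩]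

/-- Reflection exchanges the right-sided and the left-sided derivative. -/
theorem weylLeft_reflect (z : ℝ) :
    weylLeft (1 - α) (-b) (fun z => ω (-z) - ω b) z = weylRight α b ω (-z) := by
  have h1 : ∫ q in (-b)..z, weylLeftKernel (1 - α) (fun z => ω (-z) - ω b) z q =
      ∫ q in (-z)..b, weylRightKernel α ω (-z) q := by
    have h2 := intervalIntegral.integral_comp_neg (weylRightKernel α ω (-z)) (a := -b) (b := z)
    rw [neg_neg] at h2
    rw [← h2]
    refine intervalIntegral.integral_congr fun q _ => ?_
    simp only [weylLeftKernel, weylRightKernel]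
    rw [show -q - -z = z - q by ring, show 1 + (1 - α) = 2 - α by ring]
    congr 1
    abel
  rw [weylLeft, weylRight, h1, sub_sub_cancel, show z - -b = b - -z by ring]

/-- The right-sided derivative of a continuously differentiable path is the Riemann-Liouville
integral of its derivative, up to the sign. -/
theorem weylRight_of_hasDerivAt [CompleteSpace E] {ω' : ℝ → E} (hα : 0 < α)
    (hd : ∀ t, HasDerivAt ω (ω' t) t) (hω' : Continuous ω') {r : ℝ} (hrb : r < b) :
    weylRight α b ω r = -((Real.Gamma α)⁻¹ • ∫ q in r..b, (q - r) ^ (α - 1) • ω' q) := by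
  have hω : Continuous ω := continuous_iff_continuousAt.2 fun t => (hd t).continuousAt
  obtain ⟨M, hM⟩ := (isCompact_Icc (a := r) (b := b)).exists_bound_of_continuousOn
    hω'.continuousOn
  have hM0 : 0 ≤ M := (norm_nonneg _).trans (hM r ⟨le_rfl, hrb.le⟩)
  have hlip : ∀ q ∈ Icc r b, ‖ω r - ω q‖ ≤ M * (q - r) := by
    intro q hq
    have h1 := norm_image_sub_le_of_norm_deriv_le_segment' (f := ω) (f' := ω') (a := r) (b := b)
      (C := M) (fun x _ => (hd x).hasDerivWithinAt) (fun x hx => hM x ⟨hx.1, hx.2.le⟩) q hq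
    rwa [norm_sub_rev]
  have hi1 : IntervalIntegrable (fun q => (q - r) ^ (α - 1) • ω' q) volume r b :=
    (intervalIntegrable_rpow_right (by linarith)).smul_continuousOn hω'.continuousOn
  have hi2 : IntervalIntegrable (weylRightKernel α ω r) volume r b := by
    have h1 : IntervalIntegrable (fun q => M * (q - r) ^ (α - 1)) volume r b :=
      (intervalIntegrable_rpow_right (by linarith)).const_mul _
    refine intervalIntegrable_of_norm_le hrb.le h1 ?_ fun q hq => ?_
    · refine AEStronglyMeasurable.smul (Measurable.aestronglyMeasurable (by fun_prop)) ?_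
      exact aestronglyMeasurable_const.sub hω.aestronglyMeasurable
    · have h2 : 0 < q - r := sub_pos.2 hq.1
      rw [weylRightKernel, norm_smul, Real.norm_of_nonneg (by positivity)]
      refine (mul_le_mul_of_nonneg_left (hlip q ⟨hq.1.le, hq.2.le⟩) (by positivity)).trans
        (le_of_eq ?_)
      rw [show α - 1 = -(2 - α) + 1 by ring, Real.rpow_add h2, Real.rpow_one]
      ring
  have hcont : ContinuousOn (fun q => (q - r) ^ (-(1 - α)) • (ω r - ω q)) (Icc r b) := by
    intro q hq
    rcases hq.1.eq_or_lt with rfl | hrq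
    · rw [ContinuousWithinAt, sub_self, sub_self, smul_zero]
      have h1 : Tendsto (fun q : ℝ => M * (q - r) ^ α) (𝓝[Icc r b] r) (𝓝 0) := by
        have : Continuous fun q : ℝ => M * (q - r) ^ α :=
          continuous_const.mul (Continuous.rpow_const (by fun_prop) fun _ => Or.inr hα.le)
        have h2 := this.tendsto r
        rw [sub_self, Real.zero_rpow hα.ne', mul_zero] at h2
        exact h2.mono_left nhdsWithin_le_nhds
      refine squeeze_zero_norm' ?_ h1
      filter_upwards [self_mem_nhdsWithin] with q hq
      rcases hq.1.eq_or_lt with rfl | hrq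
      · simp [Real.zero_rpow hα.ne']
      · have h2 : 0 < q - r := sub_pos.2 hrq
        rw [norm_smul, Real.norm_of_nonneg (by positivity)]
        refine (mul_le_mul_of_nonneg_left (hlip q hq) (by positivity)).trans (le_of_eq ?_)
        have h5 : (q - r) ^ α = (q - r) ^ (-(1 - α)) * (q - r) := by
          rw [← Real.rpow_add_one h2.ne']
          congr 1
          ring
        rw [h5]
        ring
    · refine ContinuousAt.continuousWithinAt ?_
      refine ContinuousAt.smul ?_ (by fun_prop)
      exact ContinuousAt.rpow_const (by fun_prop) (Or.inl (sub_pos.2 hrq).ne')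
  have hder : ∀ q ∈ Ioo r b, HasDerivAt (fun q => (q - r) ^ (-(1 - α)) • (ω r - ω q))
      (-((1 - α) • weylRightKernel α ω r q) - (q - r) ^ (α - 1) • ω' q) q := by
    intro q hq
    have h2 : 0 < q - r := sub_pos.2 hq.1
    have h3 := ((hasDerivAt_id q).sub_const r).rpow_const (p := -(1 - α)) (Or.inl h2.ne')
    have h4 := h3.smul ((hd q).const_sub (ω r))
    refine h4.congr_deriv ?_
    simp only [id_eq, weylRightKernel]
    rw [show -(1 - α) - 1 = -(2 - α) by ring, show -(1 - α) = α - 1 by ring]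
    module
  have hi3 : IntervalIntegrable (fun q => -((1 - α) • weylRightKernel α ω r q)) volume r b :=
    (hi2.smul (1 - α)).neg
  have hftc := intervalIntegral.integral_eq_sub_of_hasDerivAt_of_le hrb.le hcont hder
    (hi3.sub hi1)
  rw [intervalIntegral.integral_sub hi3 hi1] at hftc
  simp only [intervalIntegral.integral_neg,
    intervalIntegral.integral_smul, sub_self, smul_zero, sub_zero] at hftc
  rw [weylRight, ← smul_neg, ← hftc]
  congr 1
  abel

end Path

/-! ### The pathwise integral -/

section HSOperators

variable {V : Type*} [NormedAddCommGroup V] [InnerProductSpace ℝ V] [CompleteSpace V]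

theorem HS.norm_apply_le (Φ : HS V) (x : V) : ‖Φ.toCLM x‖ ≤ ‖Φ‖ * ‖x‖ := by
  have h1 : HasSum (fun i => (onb V).repr x i • Φ.toCLM (onb V i)) (Φ.toCLM x) := by
    have h2 := ((onb V).hasSum_repr x).mapL Φ.toCLM
    simpa only [map_smul] using h2
  have hf : Summable fun i => ‖Φ.toCLM (onb V i)‖ ^ (2 : ℝ) := by
    simpa using Φ.memℓp.summable (by simp)
  have hx : Summable fun i => ‖(onb V).repr x i‖ ^ (2 : ℝ) := by
    simpa using (lp.memℓp ((onb V).repr x)).summable (by simp)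
  have h := Real.summable_and_inner_le_Lp_mul_Lq_tsum_of_nonneg Real.HolderConjugate.two_two
    (fun i => norm_nonneg ((onb V).repr x i)) (fun i => norm_nonneg (Φ.toCLM (onb V i))) hx hf
  have e1 := lp.norm_eq_tsum_rpow (p := 2) (by simp) (HS.toL2 Φ)
  have e2 := lp.norm_eq_tsum_rpow (p := 2) (by simp) ((onb V).repr x)
  simp only [ENNReal.toReal_ofNat, LinearIsometryEquiv.norm_map] at e1 e2
  have e3 : ‖Φ‖ = ‖HS.toL2 Φ‖ := rfl
  have e4 : ∀ i, (HS.toL2 Φ) i = Φ.toCLM (onb V i) := fun _ => rfl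
  simp only [e4] at e1
  rw [← h1.tsum_eq, e3, e1, e2, mul_comm]
  refine le_trans ?_ h.2
  have h3 := norm_tsum_le_tsum_norm (f := fun i => (onb V).repr x i • Φ.toCLM (onb V i))
    (by simpa only [norm_smul] using h.1)
  simpa only [norm_smul] using h3

/-- The inclusion of the Hilbert-Schmidt operators into the bounded operators is bounded. -/
def HS.toCLML : HS V →L[ℝ] V →L[ℝ] V :=
  (HS.toCLM (V := V)).mkContinuous 1 fun Φ => by
    rw [one_mul]
    exact ContinuousLinearMap.opNorm_le_bound _ (norm_nonneg _) (HS.norm_apply_le Φ)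

theorem HS.toCLML_apply (Φ : HS V) : HS.toCLML Φ = Φ.toCLM := rfl

/-- The matrix coefficient `Φ ↦ ⟨x, Φ y⟩`. -/
def HS.coeff (x y : V) : HS V →L[ℝ] ℝ :=
  innerSL ℝ x ∘L (ContinuousLinearMap.apply ℝ V y) ∘L HS.toCLML

end HSOperators

section Zahle

/-- The relations between the exponents under which an admissible integrand can be integrated
against a `β`-Hölder path. -/
structure Exponents (α β γ η σ : ℝ) : Prop where
  α_pos : 0 < α
  α_lt_one : α < 1
  α_lt_γ : α < γ
  γ_lt_one : γ < 1
  α_lt_η : α < η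
  one_lt : 1 < α + β
  σ_nonneg : 0 ≤ σ
  σ_add_lt : σ + η < α + β

variable {V : Type*} [NormedAddCommGroup V] [InnerProductSpace ℝ V] [CompleteSpace V]
  {a b α β γ η σ K C : ℝ} {Ψ : ℝ → HS V} {ω : ℝ → V}

theorem Exponents.β_pos (he : Exponents α β γ η σ) : 0 < β := by
  linarith [he.one_lt, he.α_lt_one]

/-- The majorant of the integrand of the pathwise integral. -/
def pairWeight (a b α β η σ r : ℝ) : ℝ :=
  (b - r) ^ (α + β - 1 - σ) * (r - a) ^ (-α) +
    (b - r) ^ (α + β - 1 - σ - η) * (r - a) ^ (η - α)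

/-- The integral of `pairWeight` over an interval of length one. -/
def pairConst (α β η σ : ℝ) : ℝ :=
  betaInt (α + β - 1 - σ) (-α) + betaInt (α + β - 1 - σ - η) (η - α)

theorem Exponents.intervalIntegrable_pairWeight (he : Exponents α β γ η σ) (hab : a ≤ b) :
    IntervalIntegrable (pairWeight a b α β η σ) volume a b := by
  have h1 := he.σ_add_lt
  have h2 := he.α_lt_η
  have h3 := he.α_pos
  have h4 := he.α_lt_one
  exact (intervalIntegrable_beta (by linarith) (by linarith) hab).add
    (intervalIntegrable_beta (by linarith) (by linarith) hab)

theorem Exponents.integral_pairWeight (he : Exponents α β γ η σ) (hab : a < b) :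
    ∫ r in a..b, pairWeight a b α β η σ r = pairConst α β η σ * (b - a) ^ (β - σ) := by
  have h1 := he.σ_add_lt
  have h2 := he.α_lt_η
  have h3 := he.α_pos
  have h4 := he.α_lt_one
  simp only [pairWeight]
  rw [intervalIntegral.integral_add
    (intervalIntegrable_beta (by linarith) (by linarith) hab.le)
    (intervalIntegrable_beta (by linarith) (by linarith) hab.le), integral_beta hab,
    integral_beta hab, pairConst, add_mul]
  congr 3 <;> ring

/-- The constant in the bound of the pathwise integral. -/
def zahleConst (α β γ η σ : ℝ) : ℝ := leftConst α γ η * rightConst α β * pairConst α β η σ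

theorem Exponents.zahleConst_nonneg (he : Exponents α β γ η σ) : 0 ≤ zahleConst α β γ η σ := by
  have h1 := leftConst_nonneg γ he.α_pos he.α_lt_one he.α_lt_η
  have h2 := rightConst_nonneg he.α_pos he.α_lt_one he.one_lt
  have h3 := betaInt_nonneg (α + β - 1 - σ) (-α)
  have h4 := betaInt_nonneg (α + β - 1 - σ - η) (η - α)
  unfold zahleConst pairConst
  positivity

theorem Admissible.norm_weyl_mul_le (he : Exponents α β γ η σ) (hΨ : Admissible a b γ η σ K Ψ)
    (hω : HolderLine β C ω) {r : ℝ} (hr : r ∈ Ioo a b) :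
    ‖weylLeft α a Ψ r‖ * ‖weylRight α b ω r‖ ≤
      K * C * (leftConst α γ η * rightConst α β) * pairWeight a b α β η σ r := by
  have hK := hΨ.const_nonneg (hr.1.trans hr.2)
  have h1 := hΨ.norm_weylLeft_le he.α_pos he.α_lt_one he.α_lt_γ he.γ_lt_one he.α_lt_η hr
  have h2 := hω.norm_weylRight_le he.α_pos he.α_lt_one he.one_lt hr.2
  have h3 := leftConst_nonneg γ he.α_pos he.α_lt_one he.α_lt_η
  have h4 := leftWeight_nonneg α η σ hr
  have hbr : 0 < b - r := sub_pos.2 hr.2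
  refine (mul_le_mul h1 h2 (norm_nonneg _) (by positivity)).trans (le_of_eq ?_)
  rw [pairWeight, leftWeight, show α + β - 1 - σ = (α + β - 1) + -σ by ring,
    show (α + β - 1) + -σ - η = (α + β - 1) + (-σ - η) by ring, Real.rpow_add hbr,
    Real.rpow_add hbr]
  ring

theorem Admissible.norm_pair_le (he : Exponents α β γ η σ) (hΨ : Admissible a b γ η σ K Ψ)
    (hω : HolderLine β C ω) {r : ℝ} (hr : r ∈ Ioo a b) :
    ‖(weylLeft α a Ψ r).toCLM (weylRight α b ω r)‖ ≤
      K * C * (leftConst α γ η * rightConst α β) * pairWeight a b α β η σ r :=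
  (HS.norm_apply_le _ _).trans (hΨ.norm_weyl_mul_le he hω hr)

theorem Admissible.aestronglyMeasurable_pair (hΨ : Admissible a b γ η σ K Ψ) (hω : Continuous ω) :
    AEStronglyMeasurable (fun r => (weylLeft α a Ψ r).toCLM (weylRight α b ω r))
      (volume.restrict (Ioo a b)) := by
  exact HS.toCLML.aestronglyMeasurable_comp₂ hΨ.aestronglyMeasurable_weylLeft
    (aestronglyMeasurable_weylRight hω)

theorem Admissible.intervalIntegrable_pair (he : Exponents α β γ η σ)
    (hΨ : Admissible a b γ η σ K Ψ) (hω : HolderLine β C ω) (hab : a ≤ b) :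
    IntervalIntegrable (fun r => (weylLeft α a Ψ r).toCLM (weylRight α b ω r)) volume a b :=
  intervalIntegrable_of_norm_le hab ((he.intervalIntegrable_pairWeight hab).const_mul _)
    (hΨ.aestronglyMeasurable_pair (hω.continuous he.β_pos))
    fun _ hr => hΨ.norm_pair_le he hω hr

/-- The pathwise integral is bounded by the size of the integrand, the Hölder constant of the path
and a power of the length of the interval. -/
theorem Admissible.norm_zahleIntegral_le (he : Exponents α β γ η σ)
    (hΨ : Admissible a b γ η σ K Ψ) (hω : HolderLine β C ω) (hab : a < b) :
    ‖zahleIntegral α a b Ψ ω‖ ≤ zahleConst α β γ η σ * C * K * (b - a) ^ (β - σ) := by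
  rw [zahleIntegral, norm_neg]
  refine (norm_integral_le_of_norm_le_Ioo hab.le
    ((he.intervalIntegrable_pairWeight hab.le).const_mul _)
    fun r hr => hΨ.norm_pair_le he hω hr).trans (le_of_eq ?_)
  rw [intervalIntegral.integral_const_mul, he.integral_pairWeight hab, zahleConst]
  ring

theorem Admissible.zahleIntegral_sub {σ' γ' η' K' : ℝ} {Φ : ℝ → HS V} (he : Exponents α β γ η σ)
    (he' : Exponents α β γ' η' σ') (hΨ : Admissible a b γ η σ K Ψ)
    (hΦ : Admissible a b γ' η' σ' K' Φ) (hω : HolderLine β C ω) (hab : a ≤ b) :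
    zahleIntegral α a b (fun r => Ψ r - Φ r) ω =
      zahleIntegral α a b Ψ ω - zahleIntegral α a b Φ ω := by
  have h1 : ∫ r in a..b, (weylLeft α a (fun r => Ψ r - Φ r) r).toCLM (weylRight α b ω r) =
      ∫ r in a..b, ((weylLeft α a Ψ r).toCLM (weylRight α b ω r) -
        (weylLeft α a Φ r).toCLM (weylRight α b ω r)) := by
    rw [intervalIntegral.integral_of_le hab, intervalIntegral.integral_of_le hab,
      integral_Ioc_eq_integral_Ioo, integral_Ioc_eq_integral_Ioo]
    refine setIntegral_congr_fun measurableSet_Ioo fun r hr => ?_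
    rw [weylLeft_sub (hΨ.intervalIntegrable_kernel he.α_lt_γ he.γ_lt_one he.α_lt_η hr)
      (hΦ.intervalIntegrable_kernel he'.α_lt_γ he'.γ_lt_one he'.α_lt_η hr), map_sub]
    rfl
  rw [zahleIntegral, h1, intervalIntegral.integral_sub (hΨ.intervalIntegrable_pair he hω hab)
    (hΦ.intervalIntegrable_pair he' hω hab), zahleIntegral, zahleIntegral]
  abel

theorem zahleIntegral_congr {Φ : ℝ → HS V} {ω' : ℝ → V} (hab : a ≤ b)
    (hΨ : ∀ r ∈ Ioo a b, Ψ r = Φ r) (hω : ∀ r ∈ Icc a b, ω r = ω' r) :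
    zahleIntegral α a b Ψ ω = zahleIntegral α a b Φ ω' := by
  rw [zahleIntegral, zahleIntegral, intervalIntegral.integral_of_le hab,
    intervalIntegral.integral_of_le hab, integral_Ioc_eq_integral_Ioo,
    integral_Ioc_eq_integral_Ioo]
  congr 1
  refine setIntegral_congr_fun measurableSet_Ioo fun r hr => ?_
  rw [weylLeft_congr hr.1 fun s hs => hΨ s ⟨hs.1, hs.2.trans_lt hr.2⟩,
    weylRight_congr hr.2.le fun s hs => hω s ⟨hr.1.le.trans hs.1, hs.2⟩]

/-- The pathwise integral is continuous along pointwise convergent paths with a common Hölder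
constant. -/
theorem Admissible.tendsto_zahleIntegral (he : Exponents α β γ η σ)
    (hΨ : Admissible a b γ η σ K Ψ) {ωs : ℕ → ℝ → V} (hωs : ∀ n, HolderLine β C (ωs n))
    (hlim : ∀ t, Tendsto (fun n => ωs n t) atTop (𝓝 (ω t)))
    (hab : a ≤ b) :
    Tendsto (fun n => zahleIntegral α a b Ψ (ωs n)) atTop (𝓝 (zahleIntegral α a b Ψ ω)) := by
  have hright : ∀ r ∈ Ioo a b,
      Tendsto (fun n => weylRight α b (ωs n) r) atTop (𝓝 (weylRight α b ω r)) := by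
    intro r hr
    refine Tendsto.const_smul (Tendsto.add ?_ (Tendsto.const_smul ?_ _)) _
    · exact ((hlim r).sub (hlim b)).const_smul _
    · refine intervalIntegral.tendsto_integral_filter_of_dominated_convergence
        (fun q => C * (q - r) ^ (α + β - 2)) ?_ ?_ ?_ ?_
      · refine Eventually.of_forall fun n => ?_
        rw [uIoc_of_le hr.2.le]
        exact ((intervalIntegrable_iff_integrableOn_Ioc_of_le hr.2.le).1
          ((hωs n).intervalIntegrable_kernel he.β_pos he.one_lt hr.2.le)).aestronglyMeasurable
      · refine Eventually.of_forall fun n => Eventually.of_forall fun q hq => ?_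
        rw [uIoc_of_le hr.2.le] at hq
        exact (hωs n).norm_kernel_le hq.1
      · exact (intervalIntegrable_rpow_right (by linarith [he.one_lt])).const_mul _
      · exact Eventually.of_forall fun q _ => ((hlim r).sub (hlim q)).const_smul _
  refine Tendsto.neg ?_
  simp only [intervalIntegral.integral_of_le hab, integral_Ioc_eq_integral_Ioo]
  refine tendsto_integral_of_dominated_convergence
    (fun r => K * C * (leftConst α γ η * rightConst α β) * pairWeight a b α β η σ r) ?_ ?_ ?_ ?_
  · exact fun n => hΨ.aestronglyMeasurable_pair ((hωs n).continuous he.β_pos)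
  · exact (intervalIntegrable_iff_integrableOn_Ioo_of_le hab).1
      ((he.intervalIntegrable_pairWeight hab).const_mul _)
  · exact fun n => (ae_restrict_iff' measurableSet_Ioo).2 (Eventually.of_forall
      fun r hr => hΨ.norm_pair_le he (hωs n) hr)
  · refine (ae_restrict_iff' measurableSet_Ioo).2 (Eventually.of_forall fun r hr => ?_)
    exact (((weylLeft α a Ψ r).toCLM).continuous.tendsto _).comp (hright r hr)

theorem ae_intervalIntegrable_left {E : Type*} [NormedAddCommGroup E] {K : ℝ × ℝ → E}
    (hK : IntegrableOn K (triangle a b)) :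
    ∀ᵐ r ∂(volume.restrict (Ioo a b)), IntervalIntegrable (fun q => K (r, q)) volume a r := by
  rw [← integrable_indicator_iff (measurableSet_triangle a b), Measure.volume_eq_prod] at hK
  rw [ae_restrict_iff' measurableSet_Ioo]
  filter_upwards [hK.prod_right_ae] with r hr hrab
  rw [indicator_triangle_left, indicator_of_mem hrab, integrable_indicator_iff measurableSet_Ioo]
    at hr
  exact (intervalIntegrable_iff_integrableOn_Ioo_of_le hrab.1.le).2 hr

/-- Against a continuously differentiable path the pathwise integral is an ordinary one: Fubini's
theorem moves the fractional integral from the path to the integrand. -/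
theorem Admissible.zahleIntegral_of_hasDerivAt (hα : 0 < α) (hα' : α < 1) (hγ : α < γ)
    (hγ' : γ < 1) (hη : α < η) (hη' : η < 1)
    (hΨ : Admissible a b γ η 0 K Ψ) {ω' : ℝ → V} (hd : ∀ t, HasDerivAt ω (ω' t) t)
    (hω' : Continuous ω') (hab : a ≤ b) :
    zahleIntegral α a b Ψ ω = ∫ r in a..b, (Ψ r).toCLM (ω' r) := by
  have hG := (Real.Gamma_pos_of_pos hα).ne'
  have hK := hΨ.integrableOn_kernel hab hγ hγ' hη hη'
  have hφ : IntervalIntegrable (weylLeft α a Ψ) volume a b :=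
    intervalIntegrable_weylLeft hα' hab hΨ.aestronglyMeasurable hΨ.norm_le_const hK
  obtain ⟨M, hM⟩ := (isCompact_Icc (a := a) (b := b)).exists_bound_of_continuousOn
    hω'.continuousOn
  -- the kernel `(q - r) ^ (α - 1) • D^α Ψ r` on the triangle `r < q`
  have hker : IntegrableOn (fun z : ℝ × ℝ => (z.1 - z.2) ^ (α - 1) • weylLeft α a Ψ z.2)
      (triangle a b) := by
    have h1 := integrableOn_fractional_comp (p := 0) (q := α - 1) (by norm_num) (by linarith)
      (by linarith) hab hφ
    simpa only [Real.rpow_zero, one_mul] using h1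
  have hpair : IntegrableOn (fun z : ℝ × ℝ =>
      HS.toCLML ((z.1 - z.2) ^ (α - 1) • weylLeft α a Ψ z.2) (ω' z.1)) (triangle a b) := by
    refine Integrable.mono' (hker.norm.mul_const M) ?_ ?_
    · exact HS.toCLML.aestronglyMeasurable_comp₂ hker.aestronglyMeasurable
        (hω'.comp continuous_fst).aestronglyMeasurable
    · refine (ae_restrict_iff' (measurableSet_triangle a b)).2 (Eventually.of_forall fun z hz => ?_)
      refine (HS.norm_apply_le _ _).trans ?_
      exact mul_le_mul_of_nonneg_left (hM _ ⟨(hz.1.trans hz.2.1).le, hz.2.2.le⟩) (norm_nonneg _)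
  have hswap := integral_triangle_swap hab hpair
  have e1 : zahleIntegral α a b Ψ ω = (Real.Gamma α)⁻¹ • ∫ r in a..b, ∫ q in r..b,
      HS.toCLML ((q - r) ^ (α - 1) • weylLeft α a Ψ r) (ω' q) := by
    rw [zahleIntegral, ← intervalIntegral.integral_smul, ← intervalIntegral.integral_neg,
      intervalIntegral.integral_of_le hab, intervalIntegral.integral_of_le hab,
      integral_Ioc_eq_integral_Ioo, integral_Ioc_eq_integral_Ioo]
    refine setIntegral_congr_fun measurableSet_Ioo fun r hr => ?_
    rw [weylRight_of_hasDerivAt hα hd hω' hr.2, map_neg, neg_neg, map_smul,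
      ← ContinuousLinearMap.intervalIntegral_comp_comm]
    · simp only [map_smul, smul_apply]
      rfl
    · exact (intervalIntegrable_rpow_right (by linarith)).smul_continuousOn hω'.continuousOn
  have hinv := ae_eq_fractional_integral_weylLeft hα hα' hab hΨ.aestronglyMeasurable
    hΨ.norm_le_const hK
  rw [e1, ← hswap, ← intervalIntegral.integral_smul, intervalIntegral.integral_of_le hab,
    intervalIntegral.integral_of_le hab, integral_Ioc_eq_integral_Ioo,
    integral_Ioc_eq_integral_Ioo]
  refine integral_congr_ae ?_
  filter_upwards [hinv, ae_intervalIntegrable_left hker] with q hq hq'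
  have h2 := ContinuousLinearMap.intervalIntegral_comp_comm
    ((ContinuousLinearMap.apply ℝ V (ω' q)) ∘L HS.toCLML) hq'
  simp only [ContinuousLinearMap.comp_apply, ContinuousLinearMap.apply_apply] at h2
  rw [h2, ← HS.toCLML_apply, hq]
  simp only [map_smul, smul_apply]

end Zahle

section Steklov

variable {V : Type*} [NormedAddCommGroup V] [NormedSpace ℝ V] {β C : ℝ} {ω : ℝ → V}

/-- The average of a path over the interval of length `1 / (n + 1)` to the right. -/
def steklov (n : ℕ) (ω : ℝ → V) (t : ℝ) : V :=
  ((n : ℝ) + 1) • ∫ v in t..t + 1 / ((n : ℝ) + 1), ω v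

theorem steklov_eq (n : ℕ) (ω : ℝ → V) (t : ℝ) :
    steklov n ω t = ((n : ℝ) + 1) • ∫ v in (0 : ℝ)..1 / ((n : ℝ) + 1), ω (t + v) := by
  rw [steklov, intervalIntegral.integral_comp_add_left, add_zero]

theorem hasDerivAt_steklov [CompleteSpace V] (n : ℕ) (hω : Continuous ω) (t : ℝ) :
    HasDerivAt (steklov n ω) (((n : ℝ) + 1) • (ω (t + 1 / ((n : ℝ) + 1)) - ω t)) t := by
  refine HasDerivAt.const_smul _ ?_
  have h1 : ∀ s, HasDerivAt (fun x => ∫ v in (0 : ℝ)..x, ω v) (ω s) s := fun s =>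
    intervalIntegral.integral_hasDerivAt_right (hω.intervalIntegrable _ _)
      (hω.stronglyMeasurableAtFilter _ _) hω.continuousAt
  have h2 : (fun t => ∫ v in t..t + 1 / ((n : ℝ) + 1), ω v) =
      fun t => (∫ v in (0 : ℝ)..t + 1 / ((n : ℝ) + 1), ω v) - ∫ v in (0 : ℝ)..t, ω v := by
    funext t
    rw [intervalIntegral.integral_interval_sub_left (hω.intervalIntegrable _ _)
      (hω.intervalIntegrable _ _)]
  rw [h2]
  refine HasDerivAt.sub ?_ (h1 t)
  have h3 := (h1 (t + 1 / ((n : ℝ) + 1))).scomp t ((hasDerivAt_id t).add_const (1 / ((n : ℝ) + 1)))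
  simpa [Function.comp_def] using h3

theorem norm_average_le {f : ℝ → V} {M : ℝ} (n : ℕ)
    (hf : ∀ v ∈ Icc 0 (1 / ((n : ℝ) + 1)), ‖f v‖ ≤ M) :
    ‖((n : ℝ) + 1) • ∫ v in (0 : ℝ)..1 / ((n : ℝ) + 1), f v‖ ≤ M := by
  have hn : (0 : ℝ) < (n : ℝ) + 1 := by positivity
  have h1 := intervalIntegral.norm_integral_le_of_norm_le_const (f := f) (a := 0)
    (b := 1 / ((n : ℝ) + 1)) (C := M) fun v hv => by
      rw [uIoc_of_le (by positivity)] at hv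
      exact hf v ⟨hv.1.le, hv.2⟩
  rw [norm_smul, Real.norm_of_nonneg hn.le]
  refine (mul_le_mul_of_nonneg_left h1 hn.le).trans (le_of_eq ?_)
  rw [sub_zero, abs_of_pos (by positivity)]
  field_simp

/-- Averaging preserves the Hölder constant, which makes the bounds on the integrals against the
averages uniform. -/
theorem HolderLine.steklov_average (h : HolderLine β C ω) (hβ : 0 < β) (n : ℕ) :
    HolderLine β C (steklov n ω) := by
  have hω := h.continuous hβ
  refine ⟨h.1, fun s t hst => ?_⟩
  rw [steklov_eq, steklov_eq, ← smul_sub, ← intervalIntegral.integral_sub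
    ((by fun_prop : Continuous fun v => ω (t + v)).intervalIntegrable _ _)
    ((by fun_prop : Continuous fun v => ω (s + v)).intervalIntegrable _ _)]
  refine norm_average_le n fun v _ => ?_
  have h1 := h.2 (s + v) (t + v) (by linarith)
  rwa [add_sub_add_right_eq_sub] at h1

theorem HolderLine.tendsto_steklov [CompleteSpace V] (h : HolderLine β C ω) (hβ : 0 < β) (t : ℝ) :
    Tendsto (fun n => steklov n ω t) atTop (𝓝 (ω t)) := by
  have hω := h.continuous hβ
  have h1 : Tendsto (fun n : ℕ => C * (1 / ((n : ℝ) + 1)) ^ β) atTop (𝓝 0) := by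
    have h2 := (tendsto_one_div_add_atTop_nhds_zero_nat (𝕜 := ℝ)).rpow_const
      (p := β) (Or.inr hβ.le)
    have h3 := h2.const_mul C
    simpa [Real.zero_rpow hβ.ne'] using h3
  rw [tendsto_iff_norm_sub_tendsto_zero]
  refine squeeze_zero (fun n => norm_nonneg _) (fun n => ?_) h1
  have hn : (0 : ℝ) < (n : ℝ) + 1 := by positivity
  have h2 : ω t = ((n : ℝ) + 1) • ∫ _ in (0 : ℝ)..1 / ((n : ℝ) + 1), ω t := by
    rw [intervalIntegral.integral_const, smul_smul, sub_zero, mul_one_div_cancel hn.ne', one_smul]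
  rw [steklov_eq]
  rw [h2, ← smul_sub, ← intervalIntegral.integral_sub
    ((by fun_prop : Continuous fun v => ω (t + v)).intervalIntegrable _ _)
    (intervalIntegrable_const)]
  refine norm_average_le n fun v hv => ?_
  refine (h.2 t (t + v) (by linarith [hv.1])).trans ?_
  rw [add_sub_cancel_left]
  exact mul_le_mul_of_nonneg_left (Real.rpow_le_rpow hv.1 hv.2 hβ.le) h.1

end Steklov

section Additivity

variable {V : Type*} [NormedAddCommGroup V] [InnerProductSpace ℝ V] [CompleteSpace V]
  {a b α β γ η σ K C : ℝ} {Ψ : ℝ → HS V} {ω : ℝ → V}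

/-- The pathwise integral is additive with respect to the interval: this holds for the smooth
averages of the path and passes to the limit. -/
theorem Admissible.zahleIntegral_add (he : Exponents α β γ η 0) (hη' : η < 1)
    (hΨ : Admissible a b γ η 0 K Ψ) (hω : HolderLine β C ω) {s : ℝ} (has : a < s) (hsb : s < b) :
    zahleIntegral α a b Ψ ω = zahleIntegral α a s Ψ ω + zahleIntegral α s b Ψ ω := by
  have hη0 : 0 ≤ η := (he.α_pos.trans he.α_lt_η).le
  have hγ0 : 0 ≤ γ := (he.α_pos.trans he.α_lt_γ).le
  have hl := hΨ.restrict_left has hsb.le le_rfl hη0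
  have hr := hΨ.restrict_right has.le hsb hγ0
  have hn := fun n => hω.steklov_average he.β_pos n
  have hlim := hω.tendsto_steklov he.β_pos
  have hωc := hω.continuous he.β_pos
  have t1 := hΨ.tendsto_zahleIntegral he hn hlim (has.trans hsb).le
  have t2 := (hl.tendsto_zahleIntegral he hn hlim has.le).add
    (hr.tendsto_zahleIntegral he hn hlim hsb.le)
  refine tendsto_nhds_unique t1 (t2.congr fun n => ?_)
  have hd := fun t => hasDerivAt_steklov n hωc t
  have hc : Continuous fun t => ((n : ℝ) + 1) • (ω (t + 1 / ((n : ℝ) + 1)) - ω t) := by fun_prop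
  rw [hΨ.zahleIntegral_of_hasDerivAt he.α_pos he.α_lt_one he.α_lt_γ he.γ_lt_one he.α_lt_η hη' hd hc
      (has.trans hsb).le,
    hl.zahleIntegral_of_hasDerivAt he.α_pos he.α_lt_one he.α_lt_γ he.γ_lt_one he.α_lt_η hη' hd hc
      has.le,
    hr.zahleIntegral_of_hasDerivAt he.α_pos he.α_lt_one he.α_lt_γ he.γ_lt_one he.α_lt_η hη' hd hc
      hsb.le]
  have hint : IntervalIntegrable (fun r => (Ψ r).toCLM
      (((n : ℝ) + 1) • (ω (r + 1 / ((n : ℝ) + 1)) - ω r))) volume a b := by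
    obtain ⟨M, hM⟩ := (isCompact_Icc (a := a) (b := b)).exists_bound_of_continuousOn hc.continuousOn
    refine intervalIntegrable_of_norm_le (g := fun _ => K * M) (has.trans hsb).le
      intervalIntegrable_const ?_ fun r hr => ?_
    · exact HS.toCLML.aestronglyMeasurable_comp₂ hΨ.aestronglyMeasurable hc.aestronglyMeasurable
    · exact (HS.norm_apply_le _ _).trans (mul_le_mul (hΨ.norm_le_const r hr)
        (hM r ⟨hr.1.le, hr.2.le⟩) (norm_nonneg _) (hΨ.const_nonneg (has.trans hsb)))
  refine intervalIntegral.integral_add_adjacent_intervals (hint.mono_set ?_) (hint.mono_set ?_)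
  · rw [uIcc_of_le has.le, uIcc_of_le (has.trans hsb).le]
    exact Icc_subset_Icc_right hsb.le
  · rw [uIcc_of_le hsb.le, uIcc_of_le (has.trans hsb).le]
    exact Icc_subset_Icc_left has.le

/-- The right-sided derivative of a Hölder path is bounded and inverts to the path. -/
theorem HolderLine.memFracRight {f : ℝ → ℝ} (hf : HolderLine β C f) (hα : 0 < α) (hα' : α < 1)
    (hβ : β < 1) (hαβ : 1 < α + β) (hab : a < b) :
    MemFracRight (1 - α) ⊤ a b (fun r => f r - f b) := by
  have hβ0 : 0 < β := by linarith
  have hfc := hf.continuous hβ0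
  refine ⟨weylRight α b f, ?_, ?_⟩
  · refine memLp_top_of_bound (aestronglyMeasurable_weylRight hfc)
      (C * rightConst α β * (b - a) ^ (α + β - 1)) ?_
    refine (ae_restrict_iff' measurableSet_Ioo).2 (Eventually.of_forall fun r hr => ?_)
    refine (hf.norm_weylRight_le hα hα' hαβ hr.2).trans ?_
    have h1 := rightConst_nonneg hα hα' hαβ
    have h2 := hf.1
    refine mul_le_mul_of_nonneg_left ?_ (by positivity)
    exact Real.rpow_le_rpow (by linarith [hr.2]) (by linarith [hr.1]) (by linarith)
  · -- the reflected path is admissible for the left-sided inversion of order `1 - α`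
    obtain ⟨M, hM⟩ := (isCompact_Icc (a := a) (b := b)).exists_bound_of_continuousOn
      (f := fun r => f r - f b) (by fun_prop)
    have hM0 : 0 ≤ M := (norm_nonneg _).trans (hM a ⟨le_rfl, hab.le⟩)
    have hC := hf.1
    have hba : 0 < b - a := sub_pos.2 hab
    have hadm : Admissible (-b) (-a) β β 0 (max M (C * (b - a) ^ β))
        (fun z => f (-z) - f b) := by
      refine ⟨by fun_prop, fun r hr => ?_, fun q r hq hqr hr => ?_⟩
      · rw [neg_zero, Real.rpow_zero, mul_one]
        exact (hM (-r) ⟨by linarith [hr.2], by linarith [hr.1]⟩).trans (le_max_left _ _)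
      · have h1 := hf.2 (-r) (-q) (by linarith)
        have h2 : 0 < r - q := sub_pos.2 hqr
        have h3 : 0 < -a - r := by linarith
        have h4 : 0 < q - -b := by linarith
        rw [sub_sub_sub_cancel_right, norm_sub_rev]
        have h5 : 1 ≤ (b - a) ^ β * (-a - r) ^ (-β) := by
          rw [Real.rpow_neg h3.le, ← div_eq_mul_inv, one_le_div (by positivity)]
          exact Real.rpow_le_rpow h3.le (by linarith) hβ0.le
        rw [show -q - -r = r - q by ring] at h1
        refine h1.trans ?_
        have h6 : C * (r - q) ^ β ≤ C * (b - a) ^ β * ((-a - r) ^ (-β) * (r - q) ^ β) := by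
          have h7 := mul_le_mul_of_nonneg_left h5 (show 0 ≤ C * (r - q) ^ β by positivity)
          linarith
        refine h6.trans ?_
        refine mul_le_mul (le_max_right _ _) ?_ (by positivity) (le_max_of_le_left hM0)
        rw [neg_zero, zero_sub]
        have h8 : 0 ≤ (-a - r) ^ (0 : ℝ) * ((q - -b) ^ (-β) * (r - q) ^ β) := by positivity
        linarith
    have h1 := ae_eq_fractional_integral_weylLeft (α := 1 - α) (by linarith) (by linarith)
      (by linarith : -b ≤ -a) hadm.aestronglyMeasurable hadm.norm_le_const
      (hadm.integrableOn_kernel (by linarith) (by linarith) hβ (by linarith) hβ)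
    rw [ae_restrict_iff' measurableSet_Ioo] at h1 ⊢
    have h2 := (Measure.measurePreserving_neg (volume : Measure ℝ)).quasiMeasurePreserving.ae h1
    filter_upwards [h2] with x hx hxab
    have h3 := hx ⟨by linarith [hxab.2], by linarith [hxab.1]⟩
    rw [neg_neg] at h3
    rw [h3, smul_eq_mul]
    congr 1
    have h4 := intervalIntegral.integral_comp_neg (fun y => (y - x) ^ (1 - α - 1) *
      weylRight α b f y) (a := -b) (b := -x)
    rw [neg_neg, neg_neg] at h4
    rw [← h4]
    refine intervalIntegral.integral_congr fun y _ => ?_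
    rw [weylLeft_reflect, smul_eq_mul, show -x - y = -y - x by ring]

/-- The pathwise integral of an admissible integrand against a Hölder path is well defined. -/
theorem Admissible.zahleIntegrable (he : Exponents α β γ η 0) (hη' : η < 1) (hβ : β < 1)
    (hΨ : Admissible a b γ η 0 K Ψ) (hω : HolderLine β C ω) (hab : a < b)
    (hlim : ∀ x y, ∃ l, Tendsto (fun r => inner ℝ x ((Ψ r).toCLM y)) (𝓝[>] a) (𝓝 l)) :
    ZahleIntegrable α a b Ψ ω where
  frac := by
    refine ⟨1, ⊤, le_rfl, le_top, ?_, by simp, fun j i => ?_, fun i => ?_⟩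
    · rw [mul_one, ENNReal.ofReal_lt_one]
      exact he.α_lt_one
    · have h1 := hΨ.clm_comp (HS.coeff (onb V j) (onb V i))
      have h2 := h1.integrableOn_kernel hab.le he.α_lt_γ he.γ_lt_one he.α_lt_η hη'
      refine ⟨weylLeft α a (hsCoord Ψ j i), ?_, ?_⟩
      · rw [memLp_one_iff_integrable]
        exact (intervalIntegrable_iff_integrableOn_Ioo_of_le hab.le).1
          (intervalIntegrable_weylLeft he.α_lt_one hab.le h1.aestronglyMeasurable
            h1.norm_le_const h2)
      · exact ae_eq_fractional_integral_weylLeft he.α_pos he.α_lt_one hab.le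
          h1.aestronglyMeasurable h1.norm_le_const h2
    · have h1 : HolderLine β C fun r => inner ℝ (ω r) (onb V i) := by
        refine ⟨hω.1, fun s t hst => ?_⟩
        rw [← inner_sub_left]
        refine (norm_inner_le_norm _ _).trans ?_
        rw [(onb V).orthonormal.1 i, mul_one]
        exact hω.2 s t hst
      have h2 := h1.memFracRight he.α_pos he.α_lt_one hβ he.one_lt hab
      simpa only [← inner_sub_left] using h2
  limit j i := hlim _ _
  left := (ae_restrict_iff' measurableSet_Ioo).2 (Eventually.of_forall fun r hr =>
    hΨ.intervalIntegrable_kernel he.α_lt_γ he.γ_lt_one he.α_lt_η hr)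
  right := (ae_restrict_iff' measurableSet_Ioo).2 (Eventually.of_forall fun r hr =>
    hω.intervalIntegrable_kernel he.β_pos he.one_lt hr.2.le)
  norm_mul := by
    refine intervalIntegrable_of_norm_le hab.le
      ((he.intervalIntegrable_pairWeight hab.le).const_mul
        (K * C * (leftConst α γ η * rightConst α β))) ?_ fun r hr => ?_
    · exact hΨ.aestronglyMeasurable_weylLeft.norm.mul
        (aestronglyMeasurable_weylRight (hω.continuous he.β_pos)).norm
    · rw [norm_mul, norm_norm, norm_norm]
      exact hΨ.norm_weyl_mul_le he hω hr
  integrand := hΨ.intervalIntegrable_pair he hω hab.le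

end Additivity

/-! ### Convolutions with a smoothing semigroup -/

section Composition

variable {V : Type*} [NormedAddCommGroup V] [InnerProductSpace ℝ V] [CompleteSpace V]

theorem HS.norm_comp_le (S : V →L[ℝ] V) (Φ : HS V) : ‖HS.comp S Φ‖ ≤ ‖S‖ * ‖Φ‖ := by
  have h1 := HS.norm_sq_eq (HS.comp S Φ)
  have h2 := HS.norm_sq_eq Φ
  have hs : Summable fun i => ‖Φ.toCLM (onb V i)‖ ^ 2 := by
    simpa using Φ.memℓp.summable (by simp)
  have h3 : ‖HS.comp S Φ‖ ^ 2 ≤ (‖S‖ * ‖Φ‖) ^ 2 := by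
    have hle : ∀ i, ‖(HS.comp S Φ).toCLM (onb V i)‖ ^ 2 ≤
        ‖S‖ ^ 2 * ‖Φ.toCLM (onb V i)‖ ^ 2 := fun i => by
      rw [← mul_pow]
      exact pow_le_pow_left₀ (norm_nonneg _) (S.le_opNorm _) 2
    rw [mul_pow, h1, h2, ← tsum_mul_left]
    exact Summable.tsum_le_tsum hle
      (Summable.of_nonneg_of_le (fun i => by positivity) hle (hs.mul_left _)) (hs.mul_left _)
  exact le_of_sq_le_sq h3 (by positivity)

/-- Composition of bounded and Hilbert-Schmidt operators as a bounded bilinear map. -/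
def HS.compL : (V →L[ℝ] V) →L[ℝ] HS V →L[ℝ] HS V :=
  LinearMap.mkContinuous₂
    (LinearMap.mk₂ ℝ HS.comp
      (fun S₁ S₂ Φ => Subtype.ext (ContinuousLinearMap.add_comp S₁ S₂ Φ.toCLM))
      (fun c S Φ => Subtype.ext (ContinuousLinearMap.smul_comp c S Φ.toCLM))
      (fun S Φ₁ Φ₂ => Subtype.ext (ContinuousLinearMap.comp_add S Φ₁.toCLM Φ₂.toCLM))
      (fun c S Φ => Subtype.ext (ContinuousLinearMap.comp_smul S c Φ.toCLM)))
    1 fun S Φ => by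
      rw [one_mul]
      exact HS.norm_comp_le S Φ

theorem HS.compL_apply (S : V →L[ℝ] V) (Φ : HS V) : HS.compL S Φ = HS.comp S Φ := rfl

theorem HS.comp_sub_left (S₁ S₂ : V →L[ℝ] V) (Φ : HS V) :
    HS.comp (S₁ - S₂) Φ = HS.comp S₁ Φ - HS.comp S₂ Φ := by
  simp only [← HS.compL_apply, map_sub, sub_apply]

theorem HS.comp_sub_right (S : V →L[ℝ] V) (Φ₁ Φ₂ : HS V) :
    HS.comp S (Φ₁ - Φ₂) = HS.comp S Φ₁ - HS.comp S Φ₂ := by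
  simp only [← HS.compL_apply, map_sub]

theorem HS.continuousOn_comp {s : Set ℝ} {S : ℝ → V →L[ℝ] V} {Φ : ℝ → HS V}
    (hS : ContinuousOn S s) (hΦ : ContinuousOn Φ s) :
    ContinuousOn (fun r => HS.comp (S r) (Φ r)) s :=
  (HS.compL (V := V)).continuous₂.comp_continuousOn (hS.prodMk hΦ)

end Composition

section Weighted

/-- The bounds defining the ball of radius `K` of `C^{γ,∼}([0, T])` for the norm with the
exponential weight `exp (-ρ t)`. Large `ρ` make the convolutions small. -/
structure WeightedBound {E : Type*} [NormedAddCommGroup E] (γ T ρ K : ℝ) (u : ℝ → E) : Prop where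
  norm_le : ∀ t, 0 ≤ t → t ≤ T → ‖u t‖ ≤ K * Real.exp (ρ * t)
  norm_sub_le : ∀ s t, 0 < s → s < t → t ≤ T →
    ‖u t - u s‖ ≤ K * Real.exp (ρ * t) * (s ^ (-γ) * (t - s) ^ γ)

variable {E : Type*} [NormedAddCommGroup E] {γ T ρ K : ℝ} {u v : ℝ → E}

theorem WeightedBound.const_nonneg (h : WeightedBound γ T ρ K u) (hT : 0 ≤ T) : 0 ≤ K :=
  nonneg_of_mul_nonneg_left ((norm_nonneg _).trans (h.norm_le 0 le_rfl hT)) (Real.exp_pos _)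

theorem WeightedBound.mono {K' : ℝ} (h : WeightedBound γ T ρ K u) (hK : K ≤ K') :
    WeightedBound γ T ρ K' u := by
  refine ⟨fun t h0 hT => (h.norm_le t h0 hT).trans
    (mul_le_mul_of_nonneg_right hK (Real.exp_pos _).le), fun s t h0 hst hT =>
    (h.norm_sub_le s t h0 hst hT).trans ?_⟩
  have h1 : 0 < t - s := sub_pos.2 hst
  exact mul_le_mul_of_nonneg_right (mul_le_mul_of_nonneg_right hK (Real.exp_pos _).le)
    (by positivity)

theorem WeightedBound.add {K' : ℝ} (hu : WeightedBound γ T ρ K u) (hv : WeightedBound γ T ρ K' v) :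
    WeightedBound γ T ρ (K + K') fun t => u t + v t := by
  refine ⟨fun t h0 hT => (norm_add_le _ _).trans ?_, fun s t h0 hst hT => ?_⟩
  · rw [add_mul]
    exact add_le_add (hu.norm_le t h0 hT) (hv.norm_le t h0 hT)
  · rw [add_sub_add_comm, add_mul, add_mul]
    exact (norm_add_le _ _).trans
      (add_le_add (hu.norm_sub_le s t h0 hst hT) (hv.norm_sub_le s t h0 hst hT))

theorem WeightedBound.congr (hu : WeightedBound γ T ρ K u) (h : ∀ t ∈ Icc 0 T, v t = u t) :
    WeightedBound γ T ρ K v := by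
  refine ⟨fun t h0 hT => ?_, fun s t h0 hst hT => ?_⟩
  · rw [h t ⟨h0, hT⟩]
    exact hu.norm_le t h0 hT
  · rw [h t ⟨(h0.trans hst).le, hT⟩, h s ⟨h0.le, hst.le.trans hT⟩]
    exact hu.norm_sub_le s t h0 hst hT

/-- A weighted bound forces continuity away from the initial time. -/
theorem WeightedBound.continuousOn (h : WeightedBound γ T ρ K u) (hγ : 0 < γ) (hρ : 0 ≤ ρ)
    (h0 : ContinuousWithinAt u (Icc 0 T) 0) : ContinuousOn u (Icc 0 T) := by
  intro t ht
  rcases ht.1.eq_or_lt with rfl | ht0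
  · exact h0
  have hK := h.const_nonneg (ht0.le.trans ht.2)
  rw [ContinuousWithinAt, tendsto_iff_norm_sub_tendsto_zero]
  have h1 : Tendsto (fun s : ℝ => K * Real.exp (ρ * T) * ((t / 2) ^ (-γ) * |s - t| ^ γ))
      (𝓝[Icc 0 T] t) (𝓝 0) := by
    have : Continuous fun s : ℝ => K * Real.exp (ρ * T) * ((t / 2) ^ (-γ) * |s - t| ^ γ) :=
      continuous_const.mul (continuous_const.mul
        (Continuous.rpow_const (by fun_prop) fun _ => Or.inr hγ.le))
    have h2 := this.tendsto t
    rw [sub_self, abs_zero, Real.zero_rpow hγ.ne', mul_zero, mul_zero] at h2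
    exact h2.mono_left nhdsWithin_le_nhds
  refine squeeze_zero' (Eventually.of_forall fun s => norm_nonneg _) ?_ h1
  have key : ∀ s r, t / 2 < s → s < r → r ≤ T →
      ‖u r - u s‖ ≤ K * Real.exp (ρ * T) * ((t / 2) ^ (-γ) * (r - s) ^ γ) := by
    intro s r hs hsr hr
    have hs0 : 0 < s := by linarith
    have hrs : 0 < r - s := sub_pos.2 hsr
    refine (h.norm_sub_le s r hs0 hsr hr).trans ?_
    have h3 : Real.exp (ρ * r) ≤ Real.exp (ρ * T) :=
      Real.exp_le_exp.2 (mul_le_mul_of_nonneg_left hr hρ)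
    have h4 : s ^ (-γ) ≤ (t / 2) ^ (-γ) :=
      Real.rpow_le_rpow_of_nonpos (by linarith) hs.le (by linarith)
    gcongr
  filter_upwards [self_mem_nhdsWithin,
    nhdsWithin_le_nhds (lt_mem_nhds (half_lt_self ht0))] with s hs hs2
  rcases lt_trichotomy s t with hst | rfl | hst
  · rw [norm_sub_rev, abs_of_neg (by linarith), neg_sub]
    exact key s t hs2 hst ht.2
  · simp [Real.zero_rpow hγ.ne']
  · rw [abs_of_pos (by linarith)]
    exact key t s (half_lt_self ht0) hst hs.2

/-- The exponential weight produces a negative power of `ρ`, at the price of a singularity. -/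
theorem exp_weight_le {ε r t : ℝ} (hρ : 0 < ρ) (hε : 0 ≤ ε) (hε' : ε ≤ 1) (hrt : r < t) :
    Real.exp (ρ * r) ≤ Real.exp (ρ * t) * ρ ^ (-ε) * (t - r) ^ (-ε) := by
  have h1 : 0 < t - r := sub_pos.2 hrt
  have h2 := rpow_mul_exp_neg_le_one hε hε' (mul_pos hρ h1).le
  rw [Real.mul_rpow hρ.le h1.le] at h2
  have h3 : Real.exp (ρ * r) = Real.exp (ρ * t) * Real.exp (-(ρ * (t - r))) := by
    rw [← Real.exp_add]
    ring_nf
  have h4 : ρ ^ (-ε) * ρ ^ ε = 1 := by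
    rw [← Real.rpow_add hρ]
    simp
  have h5 : (t - r) ^ (-ε) * (t - r) ^ ε = 1 := by
    rw [← Real.rpow_add h1]
    simp
  have h6 : Real.exp (-(ρ * (t - r))) ≤ ρ ^ (-ε) * (t - r) ^ (-ε) := by
    calc Real.exp (-(ρ * (t - r)))
        = (ρ ^ (-ε) * ρ ^ ε) * ((t - r) ^ (-ε) * (t - r) ^ ε) * Real.exp (-(ρ * (t - r))) := by
          rw [h4, h5]; ring
      _ = ρ ^ (-ε) * (t - r) ^ (-ε) * (ρ ^ ε * (t - r) ^ ε * Real.exp (-(ρ * (t - r)))) := by ring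
      _ ≤ ρ ^ (-ε) * (t - r) ^ (-ε) * 1 := mul_le_mul_of_nonneg_left h2 (by positivity)
      _ = _ := mul_one _
  rw [h3, mul_assoc]
  exact mul_le_mul_of_nonneg_left h6 (Real.exp_pos _).le

/-- The elementary estimate turning the two parts of an increment into the weighted Hölder
form. -/
theorem increment_le {p s t X Y Z : ℝ} (hX : 0 ≤ X) (hY : 0 ≤ Y) (hγ : 0 < γ)
    (hp : γ ≤ p) (hs : 0 < s) (hst : s < t) (ht : t ≤ T)
    (hZ : Z ≤ X * (t - s) ^ p + Y * ((t - s) ^ γ * s ^ (p - γ))) :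
    Z ≤ (X + Y) * T ^ p * (s ^ (-γ) * (t - s) ^ γ) := by
  have h1 : 0 < t - s := sub_pos.2 hst
  have hT : 0 < T := by linarith
  have h2 : (t - s) ^ p ≤ T ^ p * (s ^ (-γ) * (t - s) ^ γ) := by
    have h3 : (t - s) ^ p = (t - s) ^ (p - γ) * (t - s) ^ γ := by
      rw [← Real.rpow_add h1]
      ring_nf
    have h4 : T ^ p = T ^ (p - γ) * T ^ γ := by
      rw [← Real.rpow_add hT]
      ring_nf
    have h5 : (t - s) ^ (p - γ) ≤ T ^ (p - γ) :=
      Real.rpow_le_rpow h1.le (by linarith) (by linarith)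
    have h6 : 1 ≤ T ^ γ * s ^ (-γ) := by
      rw [Real.rpow_neg hs.le, ← div_eq_mul_inv, one_le_div (by positivity)]
      exact Real.rpow_le_rpow hs.le (by linarith) hγ.le
    rw [h3, h4]
    calc (t - s) ^ (p - γ) * (t - s) ^ γ ≤ T ^ (p - γ) * (t - s) ^ γ :=
          mul_le_mul_of_nonneg_right h5 (by positivity)
      _ ≤ (T ^ (p - γ) * (t - s) ^ γ) * (T ^ γ * s ^ (-γ)) :=
          le_mul_of_one_le_right (by positivity) h6
      _ = _ := by ring
  have h7 : (t - s) ^ γ * s ^ (p - γ) ≤ T ^ p * (s ^ (-γ) * (t - s) ^ γ) := by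
    have h8 : s ^ (p - γ) = s ^ p * s ^ (-γ) := by
      rw [← Real.rpow_add hs]
      ring_nf
    have h9 : s ^ p ≤ T ^ p := Real.rpow_le_rpow hs.le (by linarith) (by linarith)
    rw [h8]
    calc (t - s) ^ γ * (s ^ p * s ^ (-γ)) = s ^ p * (s ^ (-γ) * (t - s) ^ γ) := by ring
      _ ≤ _ := mul_le_mul_of_nonneg_right h9 (by positivity)
  calc Z ≤ _ := hZ
    _ ≤ X * (T ^ p * (s ^ (-γ) * (t - s) ^ γ)) + Y * (T ^ p * (s ^ (-γ) * (t - s) ^ γ)) :=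
        add_le_add (mul_le_mul_of_nonneg_left h2 hX) (mul_le_mul_of_nonneg_left h7 hY)
    _ = _ := by ring

theorem continuousOn_shift {F : Type*} [TopologicalSpace F] {S : ℝ → F}
    (hS : ContinuousOn S (Ioi 0)) {t b : ℝ} (hbt : b ≤ t) (a : ℝ) :
    ContinuousOn (fun r => S (t - r)) (Ioo a b) :=
  hS.comp (by fun_prop) fun r hr => sub_pos.2 (hr.2.trans_le hbt)

end Weighted

section ZahleConvolution

variable {V : Type*} [NormedAddCommGroup V] [InnerProductSpace ℝ V] [CompleteSpace V]
  {S : ℝ → V →L[ℝ] V} {α β γ η ε T ρ K C : ℝ} {Ψ : ℝ → HS V} {ω : ℝ → V}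

/-- The integrand of the convolution at time `t` is admissible. -/
theorem WeightedBound.admissible (hΨ : WeightedBound γ T ρ K Ψ) (hc : ContinuousOn Ψ (Icc 0 T))
    (hS : IsSmoothing S) (hρ : 0 < ρ) (hε : 0 ≤ ε) (hε' : ε ≤ 1) (hη : 0 ≤ η) (hη' : η ≤ 1)
    {t : ℝ} (ht0 : 0 < t) (ht : t ≤ T) :
    Admissible 0 t γ η ε (K * (Real.exp (ρ * t) * ρ ^ (-ε)))
      fun r => HS.comp (S (t - r)) (Ψ r) := by
  have hK := hΨ.const_nonneg (ht0.le.trans ht)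
  refine ⟨HS.continuousOn_comp (continuousOn_shift hS.continuousOn_norm le_rfl 0)
    (hc.mono fun r hr => ⟨hr.1.le, hr.2.le.trans ht⟩), fun r hr => ?_, fun q r hq hqr hrt => ?_⟩
  · have h1 := exp_weight_le hρ hε hε' hr.2
    calc ‖HS.comp (S (t - r)) (Ψ r)‖ ≤ ‖S (t - r)‖ * ‖Ψ r‖ := HS.norm_comp_le _ _
      _ ≤ 1 * (K * Real.exp (ρ * r)) := mul_le_mul (hS.norm_le_one _ (by linarith [hr.2]))
          (hΨ.norm_le r hr.1.le (hr.2.le.trans ht)) (norm_nonneg _) zero_le_one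
      _ ≤ K * (Real.exp (ρ * t) * ρ ^ (-ε) * (t - r) ^ (-ε)) := by
          rw [one_mul]
          exact mul_le_mul_of_nonneg_left h1 hK
      _ = _ := by ring
  · have h1 := exp_weight_le hρ hε hε' hrt
    have hr0 : 0 < r := hq.trans hqr
    have htr : 0 < t - r := sub_pos.2 hrt
    have hrq : 0 < r - q := sub_pos.2 hqr
    have e1 : HS.comp (S (t - r)) (Ψ r) - HS.comp (S (t - q)) (Ψ q) =
        HS.comp (S (t - r)) (Ψ r - Ψ q) - HS.comp (S (t - q) - S (t - r)) (Ψ q) := by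
      rw [HS.comp_sub_left, HS.comp_sub_right]
      abel
    have h2 := hS.norm_sub_le η hη hη' (t - r) (t - q) htr (by linarith)
    rw [sub_sub_sub_cancel_left] at h2
    have h3 : ‖Ψ q‖ ≤ K * Real.exp (ρ * r) := (hΨ.norm_le q hq.le (by linarith)).trans
      (mul_le_mul_of_nonneg_left (Real.exp_le_exp.2 (mul_le_mul_of_nonneg_left hqr.le hρ.le)) hK)
    have h4 := hΨ.norm_sub_le q r hq hqr (by linarith)
    rw [e1, sub_zero]
    calc _ ≤ ‖S (t - r)‖ * ‖Ψ r - Ψ q‖ + ‖S (t - q) - S (t - r)‖ * ‖Ψ q‖ :=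
          (_root_.norm_sub_le _ _).trans (add_le_add (HS.norm_comp_le _ _) (HS.norm_comp_le _ _))
      _ ≤ 1 * (K * Real.exp (ρ * r) * (q ^ (-γ) * (r - q) ^ γ)) +
          ((r - q) ^ η * (t - r) ^ (-η)) * (K * Real.exp (ρ * r)) :=
          add_le_add (mul_le_mul (hS.norm_le_one _ htr.le) h4 (norm_nonneg _) zero_le_one)
            (mul_le_mul h2 h3 (norm_nonneg _) (by positivity))
      _ = K * Real.exp (ρ * r) * (q ^ (-γ) * (r - q) ^ γ + (t - r) ^ (-η) * (r - q) ^ η) := by ring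
      _ ≤ K * (Real.exp (ρ * t) * ρ ^ (-ε) * (t - r) ^ (-ε)) *
          (q ^ (-γ) * (r - q) ^ γ + (t - r) ^ (-η) * (r - q) ^ η) :=
          mul_le_mul_of_nonneg_right (mul_le_mul_of_nonneg_left h1 hK) (by positivity)
      _ = _ := by
          rw [sub_eq_add_neg (-ε) η, Real.rpow_add htr]
          ring

/-- The increment of the integrand in the outer time variable is admissible, with a stronger
singularity at `s` and a small constant. -/
theorem WeightedBound.admissible_sub (hΨ : WeightedBound γ T ρ K Ψ)
    (hc : ContinuousOn Ψ (Icc 0 T)) (hS : IsSmoothing S) (hρ : 0 < ρ) (hε : 0 ≤ ε) (hε' : ε ≤ 1)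
    (hη : 0 ≤ η) (hη' : η ≤ 1) (hγ : 0 ≤ γ) (hγ' : γ ≤ 1) {s t : ℝ} (hs0 : 0 < s) (hst : s < t)
    (ht : t ≤ T) :
    Admissible 0 s γ η (γ + ε) (4 * K * (Real.exp (ρ * s) * ρ ^ (-ε)) * (t - s) ^ γ)
      fun r => HS.comp (S (t - r) - S (s - r)) (Ψ r) := by
  have hK := hΨ.const_nonneg (hs0.le.trans (hst.le.trans ht))
  have hτ : 0 < t - s := sub_pos.2 hst
  have hsm : ∀ r, r < s → ‖S (t - r) - S (s - r)‖ ≤ (t - s) ^ γ * (s - r) ^ (-γ) := by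
    intro r hr
    have h := hS.norm_sub_le γ hγ hγ' (s - r) (t - r) (sub_pos.2 hr) (by linarith)
    rwa [sub_sub_sub_cancel_right] at h
  refine ⟨HS.continuousOn_comp ((continuousOn_shift hS.continuousOn_norm hst.le 0).sub
    (continuousOn_shift hS.continuousOn_norm le_rfl 0))
    (hc.mono fun r hr => ⟨hr.1.le, hr.2.le.trans (hst.le.trans ht)⟩), fun r hr => ?_,
    fun q r hq hqr hrs => ?_⟩
  · have h1 := exp_weight_le hρ hε hε' hr.2
    have hsr : 0 < s - r := sub_pos.2 hr.2
    calc _ ≤ ‖S (t - r) - S (s - r)‖ * ‖Ψ r‖ := HS.norm_comp_le _ _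
      _ ≤ ((t - s) ^ γ * (s - r) ^ (-γ)) *
          (K * (Real.exp (ρ * s) * ρ ^ (-ε) * (s - r) ^ (-ε))) :=
          mul_le_mul (hsm r hr.2) ((hΨ.norm_le r hr.1.le (by linarith [hr.2])).trans
            (mul_le_mul_of_nonneg_left h1 hK)) (norm_nonneg _) (by positivity)
      _ = K * (Real.exp (ρ * s) * ρ ^ (-ε)) * (t - s) ^ γ * (s - r) ^ (-(γ + ε)) := by
          rw [neg_add, Real.rpow_add hsr]
          ring
      _ ≤ _ := by
          have : 0 ≤ K * (Real.exp (ρ * s) * ρ ^ (-ε)) * (t - s) ^ γ * (s - r) ^ (-(γ + ε)) := by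
            positivity
          linarith
  · have h1 := exp_weight_le hρ hε hε' hrs
    have hr0 : 0 < r := hq.trans hqr
    have hsr : 0 < s - r := sub_pos.2 hrs
    have hrq : 0 < r - q := sub_pos.2 hqr
    have e1 : HS.comp (S (t - r) - S (s - r)) (Ψ r) - HS.comp (S (t - q) - S (s - q)) (Ψ q) =
        HS.comp (S (t - r) - S (s - r)) (Ψ r - Ψ q) +
          HS.comp ((S (t - r) - S (s - r)) - (S (t - q) - S (s - q))) (Ψ q) := by
      rw [HS.comp_sub_left (S (t - r) - S (s - r)) (S (t - q) - S (s - q)), HS.comp_sub_right]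
      abel
    have h2 := hS.norm_sub_sub_sub_le hγ hγ' hη hη' hsr hτ.le hrq.le
    rw [show s - r + (t - s) = t - r by ring, show s - r + (r - q) + (t - s) = t - q by ring,
      show s - r + (r - q) = s - q by ring] at h2
    have h3 : ‖Ψ q‖ ≤ K * Real.exp (ρ * r) := (hΨ.norm_le q hq.le (by linarith)).trans
      (mul_le_mul_of_nonneg_left (Real.exp_le_exp.2 (mul_le_mul_of_nonneg_left hqr.le hρ.le)) hK)
    have h4 := hΨ.norm_sub_le q r hq hqr (by linarith)
    rw [e1, sub_zero]
    calc _ ≤ ‖S (t - r) - S (s - r)‖ * ‖Ψ r - Ψ q‖ +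
          ‖(S (t - r) - S (s - r)) - (S (t - q) - S (s - q))‖ * ‖Ψ q‖ :=
          (norm_add_le _ _).trans (add_le_add (HS.norm_comp_le _ _) (HS.norm_comp_le _ _))
      _ ≤ ((t - s) ^ γ * (s - r) ^ (-γ)) * (K * Real.exp (ρ * r) * (q ^ (-γ) * (r - q) ^ γ)) +
          (4 * (t - s) ^ γ * (r - q) ^ η * (s - r) ^ (-γ - η)) * (K * Real.exp (ρ * r)) :=
          add_le_add (mul_le_mul (hsm r hrs) h4 (norm_nonneg _) (by positivity))
            (mul_le_mul h2 h3 (norm_nonneg _) (by positivity))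
      _ ≤ ((4 * (t - s) ^ γ) * (s - r) ^ (-γ)) *
          (K * Real.exp (ρ * r) * (q ^ (-γ) * (r - q) ^ γ)) +
          (4 * (t - s) ^ γ * (r - q) ^ η * (s - r) ^ (-γ - η)) * (K * Real.exp (ρ * r)) := by
          gcongr
          have : 0 ≤ (t - s) ^ γ := by positivity
          linarith
      _ = K * Real.exp (ρ * r) * (4 * (t - s) ^ γ * ((s - r) ^ (-γ) * (q ^ (-γ) * (r - q) ^ γ) +
          (s - r) ^ (-γ - η) * (r - q) ^ η)) := by ring
      _ ≤ K * (Real.exp (ρ * s) * ρ ^ (-ε) * (s - r) ^ (-ε)) *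
          (4 * (t - s) ^ γ * ((s - r) ^ (-γ) * (q ^ (-γ) * (r - q) ^ γ) +
          (s - r) ^ (-γ - η) * (r - q) ^ η)) :=
          mul_le_mul_of_nonneg_right (mul_le_mul_of_nonneg_left h1 hK) (by positivity)
      _ = _ := by
          rw [show -(γ + ε) = -γ + -ε by ring, show -γ + -ε - η = (-γ - η) + -ε by ring,
            Real.rpow_add hsr, Real.rpow_add hsr]
          ring

/-- The relations between the exponents of the convolution estimates: `ε` measures the gain from
the exponential weight and `η` the smoothing of the semigroup that is used up. -/
structure ConvExponents (α β γ η ε : ℝ) : Prop where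
  α_pos : 0 < α
  α_lt_γ : α < γ
  γ_lt_β : γ < β
  β_lt_one : β < 1
  α_lt_η : α < η
  η_lt_one : η < 1
  ε_pos : 0 < ε
  one_lt : 1 < α + β
  add_lt : γ + ε + η < α + β
  add_lt' : γ + ε < β

theorem ConvExponents.exponents (h : ConvExponents α β γ η ε) {σ : ℝ} (hσ : 0 ≤ σ)
    (hσ' : σ ≤ γ + ε) : Exponents α β γ η σ :=
  ⟨h.α_pos, by linarith [h.α_lt_γ, h.γ_lt_β, h.β_lt_one], h.α_lt_γ,
    by linarith [h.γ_lt_β, h.β_lt_one], h.α_lt_η, h.one_lt, hσ, by linarith [h.add_lt]⟩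

theorem ConvExponents.γ_pos (h : ConvExponents α β γ η ε) : 0 < γ := h.α_pos.trans h.α_lt_γ

theorem ConvExponents.γ_lt_one (h : ConvExponents α β γ η ε) : γ < 1 := h.γ_lt_β.trans h.β_lt_one

theorem ConvExponents.ε_lt_one (h : ConvExponents α β γ η ε) : ε < 1 := by
  linarith [h.add_lt', h.γ_pos, h.β_lt_one]

/-- The pathwise convolution `∫_0^t S(t-r) Ψ(r) dω(r)`. -/
def zahleConv (α : ℝ) (S : ℝ → V →L[ℝ] V) (Ψ : ℝ → HS V) (ω : ℝ → V) (t : ℝ) : V :=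
  zahleIntegral α 0 t (fun r => HS.comp (S (t - r)) (Ψ r)) ω

/-- The constant in the estimate of the pathwise convolution. -/
def zahleConvConst (α β γ η ε C T : ℝ) : ℝ :=
  C * (zahleConst α β γ η ε + 4 * zahleConst α β γ η (γ + ε)) * T ^ (β - ε)

theorem WeightedBound.norm_zahleConv_le (he : ConvExponents α β γ η ε)
    (hΨ : WeightedBound γ T ρ K Ψ) (hc : ContinuousOn Ψ (Icc 0 T)) (hS : IsSmoothing S)
    (hω : HolderLine β C ω) (hρ : 0 < ρ) {t : ℝ} (ht0 : 0 < t) (ht : t ≤ T) :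
    ‖zahleConv α S Ψ ω t‖ ≤
      zahleConst α β γ η ε * C * (K * (Real.exp (ρ * t) * ρ ^ (-ε))) * t ^ (β - ε) := by
  have h1 := hΨ.admissible hc hS hρ he.ε_pos.le he.ε_lt_one.le (he.α_pos.trans he.α_lt_η).le
    he.η_lt_one.le ht0 ht
  have h2 := h1.norm_zahleIntegral_le
    (he.exponents he.ε_pos.le (by linarith [he.γ_pos])) hω ht0
  rwa [sub_zero] at h2

/-- The increments of the pathwise convolution split into an integral over the new interval and an
integral of the increment of the semigroup. -/
theorem WeightedBound.zahleConv_sub (he : ConvExponents α β γ η ε)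
    (hΨ : WeightedBound γ T ρ K Ψ) (hc : ContinuousOn Ψ (Icc 0 T)) (hS : IsSmoothing S)
    (hω : HolderLine β C ω) (hρ : 0 < ρ) {s t : ℝ} (hs0 : 0 < s) (hst : s < t) (ht : t ≤ T) :
    zahleConv α S Ψ ω t - zahleConv α S Ψ ω s =
      zahleIntegral α s t (fun r => HS.comp (S (t - r)) (Ψ r)) ω +
        zahleIntegral α 0 s (fun r => HS.comp (S (t - r) - S (s - r)) (Ψ r)) ω := by
  have hη0 := (he.α_pos.trans he.α_lt_η).le
  have e0 := he.exponents le_rfl (by linarith [he.γ_pos, he.ε_pos])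
  have ht1 := hΨ.admissible hc hS hρ le_rfl zero_le_one hη0 he.η_lt_one.le (hs0.trans hst) ht
  have hs1 := hΨ.admissible hc hS hρ le_rfl zero_le_one hη0 he.η_lt_one.le hs0 (hst.le.trans ht)
  have h1 := ht1.zahleIntegral_add e0 he.η_lt_one hω hs0 hst
  have h2 := (ht1.restrict_left hs0 hst.le le_rfl hη0).zahleIntegral_sub e0 e0 hs1 hω hs0.le
  simp only [HS.comp_sub_left]
  rw [h2, zahleConv, zahleConv, h1]
  abel

/-- The pathwise convolution is bounded between the weighted spaces, with a constant that decays
like `ρ ^ (-ε)`. -/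
theorem WeightedBound.zahleConv (he : ConvExponents α β γ η ε)
    (hΨ : WeightedBound γ T ρ K Ψ) (hc : ContinuousOn Ψ (Icc 0 T)) (hS : IsSmoothing S)
    (hω : HolderLine β C ω) (hρ : 0 < ρ) (hT : 0 < T) :
    WeightedBound γ T ρ (zahleConvConst α β γ η ε C T * ρ ^ (-ε) * K) (zahleConv α S Ψ ω) := by
  have hK := hΨ.const_nonneg hT.le
  have hC := hω.1
  have hz1 := (he.exponents he.ε_pos.le (by linarith [he.γ_pos])).zahleConst_nonneg
  have e2 := he.exponents (σ := γ + ε) (by linarith [he.γ_pos, he.ε_pos]) le_rfl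
  have hz2 := e2.zahleConst_nonneg
  have hη0 := (he.α_pos.trans he.α_lt_η).le
  refine ⟨fun t ht0 ht => ?_, fun s t hs0 hst ht => ?_⟩
  · rcases ht0.eq_or_lt with rfl | ht0
    · rw [MixedEvolution.zahleConv, zahleIntegral, intervalIntegral.integral_same, neg_zero,
        norm_zero, zahleConvConst]
      positivity
    · refine (hΨ.norm_zahleConv_le he hc hS hω hρ ht0 ht).trans ?_
      have h1 : t ^ (β - ε) ≤ T ^ (β - ε) :=
        Real.rpow_le_rpow ht0.le ht (by linarith [he.add_lt', he.γ_pos])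
      have h2 : zahleConst α β γ η ε * C * (K * (Real.exp (ρ * t) * ρ ^ (-ε))) * t ^ (β - ε) ≤
          zahleConst α β γ η ε * C * (K * (Real.exp (ρ * t) * ρ ^ (-ε))) * T ^ (β - ε) :=
        mul_le_mul_of_nonneg_left h1 (by positivity)
      refine h2.trans ?_
      have h3 : 0 ≤ 4 * zahleConst α β γ η (γ + ε) * C * (K * (Real.exp (ρ * t) * ρ ^ (-ε))) *
        T ^ (β - ε) := by positivity
      rw [zahleConvConst]
      nlinarith
  · have hτ : 0 < t - s := sub_pos.2 hst
    have hexp : Real.exp (ρ * s) ≤ Real.exp (ρ * t) :=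
      Real.exp_le_exp.2 (mul_le_mul_of_nonneg_left hst.le hρ.le)
    have h1 := ((hΨ.admissible hc hS hρ he.ε_pos.le he.ε_lt_one.le hη0 he.η_lt_one.le
      (hs0.trans hst) ht).restrict_right hs0.le hst he.γ_pos.le).norm_zahleIntegral_le
      (he.exponents he.ε_pos.le (by linarith [he.γ_pos])) hω hst
    have h2 := (hΨ.admissible_sub hc hS hρ he.ε_pos.le he.ε_lt_one.le hη0 he.η_lt_one.le
      he.γ_pos.le he.γ_lt_one.le hs0 hst ht).norm_zahleIntegral_le e2 hω hs0
    rw [sub_zero] at h2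
    have h3 : zahleConst α β γ η (γ + ε) * C *
        (4 * K * (Real.exp (ρ * s) * ρ ^ (-ε)) * (t - s) ^ γ) * s ^ (β - (γ + ε)) ≤
        zahleConst α β γ η (γ + ε) * C *
        (4 * K * (Real.exp (ρ * t) * ρ ^ (-ε)) * (t - s) ^ γ) * s ^ (β - (γ + ε)) := by
      gcongr
    have h4 := increment_le (γ := γ) (p := β - ε) (T := T)
      (X := zahleConst α β γ η ε * C * (K * (Real.exp (ρ * t) * ρ ^ (-ε))))
      (Y := zahleConst α β γ η (γ + ε) * C * (4 * K * (Real.exp (ρ * t) * ρ ^ (-ε))))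
      (by positivity) (by positivity) he.γ_pos (by linarith [he.add_lt']) hs0 hst ht
      (Z := ‖MixedEvolution.zahleConv α S Ψ ω t - MixedEvolution.zahleConv α S Ψ ω s‖) (by
        rw [hΨ.zahleConv_sub he hc hS hω hρ hs0 hst ht]
        refine (norm_add_le _ _).trans ((add_le_add h1 (h2.trans h3)).trans (le_of_eq ?_))
        rw [show β - ε - γ = β - (γ + ε) by ring]
        ring)
    refine h4.trans (le_of_eq ?_)
    rw [zahleConvConst]
    ring

theorem WeightedBound.continuousOn_zahleConv (he : ConvExponents α β γ η ε)
    (hΨ : WeightedBound γ T ρ K Ψ) (hc : ContinuousOn Ψ (Icc 0 T)) (hS : IsSmoothing S)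
    (hω : HolderLine β C ω) (hρ : 0 < ρ) (hT : 0 < T) :
    ContinuousOn (MixedEvolution.zahleConv α S Ψ ω) (Icc 0 T) := by
  refine (hΨ.zahleConv he hc hS hω hρ hT).continuousOn he.γ_pos hρ.le ?_
  have hK := hΨ.const_nonneg hT.le
  have hC := hω.1
  have hz1 := (he.exponents he.ε_pos.le (by linarith [he.γ_pos])).zahleConst_nonneg
  have h0 : MixedEvolution.zahleConv α S Ψ ω 0 = 0 := by
    rw [MixedEvolution.zahleConv, zahleIntegral, intervalIntegral.integral_same, neg_zero]
  have hp : 0 < β - ε := by linarith [he.add_lt', he.γ_pos]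
  rw [ContinuousWithinAt, h0]
  have h1 : Tendsto (fun t : ℝ => zahleConst α β γ η ε * C *
      (K * (Real.exp (ρ * t) * ρ ^ (-ε))) * t ^ (β - ε)) (𝓝[Icc 0 T] 0) (𝓝 0) := by
    have : Continuous fun t : ℝ => zahleConst α β γ η ε * C *
        (K * (Real.exp (ρ * t) * ρ ^ (-ε))) * t ^ (β - ε) :=
      (by fun_prop : Continuous fun t : ℝ => zahleConst α β γ η ε * C *
        (K * (Real.exp (ρ * t) * ρ ^ (-ε)))).mul
        (continuous_id.rpow_const fun _ => Or.inr hp.le)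
    have h2 := this.tendsto 0
    rw [Real.zero_rpow hp.ne', mul_zero] at h2
    exact h2.mono_left nhdsWithin_le_nhds
  refine squeeze_zero_norm' ?_ h1
  filter_upwards [self_mem_nhdsWithin] with t ht
  rcases ht.1.eq_or_lt with rfl | ht0
  · rw [h0, norm_zero, Real.zero_rpow hp.ne', mul_zero]
  · exact hΨ.norm_zahleConv_le he hc hS hω hρ ht0 ht.2

end ZahleConvolution

section DriftConvolution

variable {E : Type*} [NormedAddCommGroup E] [NormedSpace ℝ E]
  {S : ℝ → E →L[ℝ] E} {γ ε T ρ K : ℝ} {f : ℝ → E}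

/-- The convolution `∫_0^t S(t-r) f(r) dr`. -/
def bochnerConv (S : ℝ → E →L[ℝ] E) (f : ℝ → E) (t : ℝ) : E := ∫ r in (0 : ℝ)..t, S (t - r) (f r)

theorem intervalIntegrable_conv (hS : IsSmoothing S) (hf : ContinuousOn f (Icc 0 T)) {s t : ℝ}
    (hs0 : 0 ≤ s) (hst : s ≤ t) (hs : s ≤ T) :
    IntervalIntegrable (fun r => S (t - r) (f r)) volume 0 s := by
  obtain ⟨M, hM⟩ := isCompact_Icc.exists_bound_of_continuousOn hf
  refine intervalIntegrable_of_norm_le (g := fun _ => M) hs0 intervalIntegrable_const ?_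
    fun r hr => ?_
  · refine ContinuousOn.aestronglyMeasurable ?_ measurableSet_Ioo
    exact (continuousOn_shift hS.continuousOn_norm hst 0).clm_apply
      (hf.mono fun r hr => ⟨hr.1.le, hr.2.le.trans hs⟩)
  · have h1 := (S (t - r)).le_opNorm (f r)
    have h2 := hS.norm_le_one (t - r) (by linarith [hr.2])
    have h3 := hM r ⟨hr.1.le, hr.2.le.trans hs⟩
    exact h1.trans ((mul_le_mul h2 h3 (norm_nonneg _) zero_le_one).trans (one_mul M).le)

theorem norm_bochnerConv_part_le (hS : IsSmoothing S)
    (hfK : ∀ t, 0 ≤ t → t ≤ T → ‖f t‖ ≤ K * Real.exp (ρ * t)) (hρ : 0 < ρ) (hε : 0 ≤ ε)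
    (hε' : ε < 1) {s t : ℝ} (hs0 : 0 ≤ s) (hst : s ≤ t) (ht : t ≤ T) (hK : 0 ≤ K) :
    ‖∫ r in s..t, S (t - r) (f r)‖ ≤
      K * (Real.exp (ρ * t) * ρ ^ (-ε)) * (1 - ε)⁻¹ * (t - s) ^ (1 - ε) := by
  have h1 : IntervalIntegrable (fun r => K * (Real.exp (ρ * t) * ρ ^ (-ε)) * (t - r) ^ (-ε))
      volume s t := (intervalIntegrable_rpow_left (by linarith)).const_mul _
  refine (norm_integral_le_of_norm_le_Ioo hst h1 fun r hr => ?_).trans (le_of_eq ?_)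
  · have h2 := hS.norm_le_one (t - r) (by linarith [hr.2])
    have h3 := hfK r (hs0.trans hr.1.le) (hr.2.le.trans ht)
    have h4 := exp_weight_le hρ hε hε'.le hr.2
    calc _ ≤ ‖S (t - r)‖ * ‖f r‖ := (S (t - r)).le_opNorm _
      _ ≤ 1 * (K * Real.exp (ρ * r)) := mul_le_mul h2 h3 (norm_nonneg _) zero_le_one
      _ ≤ K * (Real.exp (ρ * t) * ρ ^ (-ε) * (t - r) ^ (-ε)) := by
          rw [one_mul]
          exact mul_le_mul_of_nonneg_left h4 hK
      _ = _ := by ring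
  · rw [intervalIntegral.integral_const_mul, integral_rpow_left (by linarith),
      show -ε + 1 = 1 - ε by ring]
    ring

/-- The constant in the estimate of the convolution. -/
def bochnerConvConst (γ ε T : ℝ) : ℝ := ((1 - ε)⁻¹ + (1 - (γ + ε))⁻¹) * T ^ (1 - ε)

/-- The convolution maps bounded functions to the weighted Hölder space, with a constant that
decays like `ρ ^ (-ε)`. -/
theorem weightedBound_bochnerConv (hS : IsSmoothing S) (hf : ContinuousOn f (Icc 0 T))
    (hfK : ∀ t, 0 ≤ t → t ≤ T → ‖f t‖ ≤ K * Real.exp (ρ * t)) (hρ : 0 < ρ) (hε : 0 < ε)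
    (hγ : 0 < γ) (hγε : γ + ε < 1) (hT : 0 < T) :
    WeightedBound γ T ρ (bochnerConvConst γ ε T * ρ ^ (-ε) * K) (bochnerConv S f) := by
  have hK : 0 ≤ K := nonneg_of_mul_nonneg_left
    ((norm_nonneg _).trans (hfK 0 le_rfl hT.le)) (Real.exp_pos _)
  have c1 : 0 < (1 - ε)⁻¹ := inv_pos.2 (by linarith)
  have c2 : 0 < (1 - (γ + ε))⁻¹ := inv_pos.2 (by linarith)
  refine ⟨fun t ht0 ht => ?_, fun s t hs0 hst ht => ?_⟩
  · have h1 := norm_bochnerConv_part_le hS hfK hρ hε.le (by linarith) le_rfl ht0 ht hK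
    rw [sub_zero] at h1
    refine h1.trans ?_
    have h2 : t ^ (1 - ε) ≤ T ^ (1 - ε) := Real.rpow_le_rpow ht0 ht (by linarith)
    have h3 : K * (Real.exp (ρ * t) * ρ ^ (-ε)) * (1 - ε)⁻¹ * t ^ (1 - ε) ≤
        K * (Real.exp (ρ * t) * ρ ^ (-ε)) * (1 - ε)⁻¹ * T ^ (1 - ε) :=
      mul_le_mul_of_nonneg_left h2 (by positivity)
    have h4 : 0 ≤ K * (Real.exp (ρ * t) * ρ ^ (-ε)) * (1 - (γ + ε))⁻¹ * T ^ (1 - ε) := by positivity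
    rw [bochnerConvConst]
    nlinarith
  · have hτ : 0 < t - s := sub_pos.2 hst
    have hi1 := intervalIntegrable_conv hS hf (hs0.trans hst).le le_rfl ht
    have hi2 := intervalIntegrable_conv hS hf hs0.le hst.le (hst.le.trans ht)
    have hi3 := intervalIntegrable_conv hS hf hs0.le le_rfl (hst.le.trans ht)
    have hi4 : IntervalIntegrable (fun r => S (t - r) (f r)) volume s t := hi2.symm.trans hi1
    have e1 : bochnerConv S f t - bochnerConv S f s = (∫ r in s..t, S (t - r) (f r)) +
        ∫ r in (0 : ℝ)..s, (S (t - r) - S (s - r)) (f r) := by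
      simp only [sub_apply]
      rw [intervalIntegral.integral_sub hi2 hi3, bochnerConv, bochnerConv,
        ← intervalIntegral.integral_add_adjacent_intervals hi2 hi4]
      abel
    have h1 := norm_bochnerConv_part_le hS hfK hρ hε.le (by linarith) hs0.le hst.le ht hK
    have h2 : ‖∫ r in (0 : ℝ)..s, (S (t - r) - S (s - r)) (f r)‖ ≤
        K * (Real.exp (ρ * t) * ρ ^ (-ε)) * (1 - (γ + ε))⁻¹ *
          ((t - s) ^ γ * s ^ (1 - ε - γ)) := by
      have h3 : IntervalIntegrable (fun r => K * (Real.exp (ρ * t) * ρ ^ (-ε)) * (t - s) ^ γ *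
          (s - r) ^ (-(γ + ε))) volume 0 s :=
        (intervalIntegrable_rpow_left (by linarith)).const_mul _
      refine (norm_integral_le_of_norm_le_Ioo hs0.le h3 fun r hr => ?_).trans (le_of_eq ?_)
      · have hsr : 0 < s - r := sub_pos.2 hr.2
        have h4 := hS.norm_sub_le γ hγ.le (by linarith) (s - r) (t - r) hsr (by linarith)
        rw [sub_sub_sub_cancel_right] at h4
        have h5 := hfK r hr.1.le (by linarith [hr.2])
        have h6 := exp_weight_le hρ hε.le (by linarith) hr.2
        have hexp : Real.exp (ρ * s) ≤ Real.exp (ρ * t) :=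
          Real.exp_le_exp.2 (mul_le_mul_of_nonneg_left hst.le hρ.le)
        calc _ ≤ ‖S (t - r) - S (s - r)‖ * ‖f r‖ := (S (t - r) - S (s - r)).le_opNorm _
          _ ≤ ((t - s) ^ γ * (s - r) ^ (-γ)) *
              (K * (Real.exp (ρ * s) * ρ ^ (-ε) * (s - r) ^ (-ε))) :=
              mul_le_mul h4 (h5.trans (mul_le_mul_of_nonneg_left h6 hK)) (norm_nonneg _)
                (by positivity)
          _ ≤ ((t - s) ^ γ * (s - r) ^ (-γ)) *
              (K * (Real.exp (ρ * t) * ρ ^ (-ε) * (s - r) ^ (-ε))) := by gcongr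
          _ = _ := by
              rw [neg_add, Real.rpow_add hsr]
              ring
      · rw [intervalIntegral.integral_const_mul, integral_rpow_left (by linarith), sub_zero,
          show -(γ + ε) + 1 = 1 - (γ + ε) by ring, show 1 - ε - γ = 1 - (γ + ε) by ring]
        ring
    have h4 := increment_le (γ := γ) (p := 1 - ε) (T := T)
      (X := K * (Real.exp (ρ * t) * ρ ^ (-ε)) * (1 - ε)⁻¹)
      (Y := K * (Real.exp (ρ * t) * ρ ^ (-ε)) * (1 - (γ + ε))⁻¹)
      (by positivity) (by positivity) hγ (by linarith) hs0 hst ht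
      (Z := ‖bochnerConv S f t - bochnerConv S f s‖) (by
        rw [e1]
        exact (norm_add_le _ _).trans (add_le_add h1 h2))
    refine h4.trans (le_of_eq ?_)
    rw [bochnerConvConst]
    ring

theorem continuousOn_bochnerConv (hS : IsSmoothing S) (hf : ContinuousOn f (Icc 0 T)) (hT : 0 < T) :
    ContinuousOn (bochnerConv S f) (Icc 0 T) := by
  obtain ⟨M, hM⟩ := isCompact_Icc.exists_bound_of_continuousOn hf
  have hM0 : 0 ≤ M := (norm_nonneg _).trans (hM 0 ⟨le_rfl, hT.le⟩)
  have hfK : ∀ t, 0 ≤ t → t ≤ T → ‖f t‖ ≤ M * Real.exp (1 * t) := fun t ht0 ht =>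
    (hM t ⟨ht0, ht⟩).trans (le_mul_of_one_le_right hM0 (Real.one_le_exp (by linarith)))
  refine (weightedBound_bochnerConv (γ := 1 / 2) (ε := 1 / 4) hS hf hfK one_pos (by norm_num)
    (by norm_num) (by norm_num) hT).continuousOn (by norm_num) zero_le_one ?_
  have h0 : bochnerConv S f 0 = 0 := by
    rw [bochnerConv, intervalIntegral.integral_same]
  rw [ContinuousWithinAt, h0]
  have h1 : Tendsto (fun t : ℝ => M * t) (𝓝[Icc 0 T] 0) (𝓝 0) := by
    have : Continuous fun t : ℝ => M * t := by fun_prop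
    have h2 := this.tendsto 0
    rw [mul_zero] at h2
    exact h2.mono_left nhdsWithin_le_nhds
  refine squeeze_zero_norm' ?_ h1
  filter_upwards [self_mem_nhdsWithin] with t ht
  have h3 := norm_integral_le_of_norm_le_Ioo (f := fun r => S (t - r) (f r)) (g := fun _ => M)
    ht.1 intervalIntegrable_const fun r hr => by
      have h2 := hS.norm_le_one (t - r) (by linarith [hr.2])
      exact ((S (t - r)).le_opNorm _).trans ((mul_le_mul h2 (hM r ⟨hr.1.le, hr.2.le.trans ht.2⟩)
        (norm_nonneg _) zero_le_one).trans (one_mul M).le)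
  rw [intervalIntegral.integral_const, sub_zero, smul_eq_mul, mul_comm] at h3
  exact h3

/-- The orbit of an initial value. -/
theorem weightedBound_orbit (hS : IsSmoothing S) (x : E) (hγ : 0 ≤ γ) (hγ' : γ ≤ 1) (hρ : 0 ≤ ρ) :
    WeightedBound γ T ρ ‖x‖ fun t => S t x := by
  refine ⟨fun t ht0 ht => ?_, fun s t hs0 hst ht => ?_⟩
  · have h1 := (S t).le_opNorm x
    have h2 := mul_le_mul_of_nonneg_right (hS.norm_le_one t ht0) (norm_nonneg x)
    rw [one_mul] at h2
    exact h1.trans (h2.trans (le_mul_of_one_le_right (norm_nonneg _)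
      (Real.one_le_exp (mul_nonneg hρ ht0))))
  · have hτ : 0 < t - s := sub_pos.2 hst
    have h1 := hS.norm_sub_le γ hγ hγ' s t hs0 hst.le
    rw [← sub_apply]
    refine ((S t - S s).le_opNorm x).trans ((mul_le_mul_of_nonneg_right h1 (norm_nonneg x)).trans ?_)
    have h2 : 1 ≤ Real.exp (ρ * t) := Real.one_le_exp (mul_nonneg hρ (hs0.trans hst).le)
    calc (t - s) ^ γ * s ^ (-γ) * ‖x‖ = ‖x‖ * 1 * (s ^ (-γ) * (t - s) ^ γ) := by ring
      _ ≤ _ := by gcongr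

end DriftConvolution

/-! ### The stochastic convolution and the Ornstein-Uhlenbeck process -/

section Scalar

variable {f : ℝ → ℝ} {l : ℝ}

theorem integral_exp_neg_mul_sub (hl : l ≠ 0) (s t : ℝ) :
    ∫ r in s..t, Real.exp (-l * (t - r)) = (1 - Real.exp (-l * (t - s))) / l := by
  have h : ∀ r ∈ uIcc s t, HasDerivAt (fun r => Real.exp (-l * (t - r)) / l)
      (Real.exp (-l * (t - r))) r := by
    intro r _
    have h1 : HasDerivAt (fun r => -l * (t - r)) (-l * -1) r :=
      ((hasDerivAt_id r).const_sub t).const_mul (-l)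
    have h2 := h1.exp.div_const l
    refine h2.congr_deriv ?_
    field_simp
  rw [intervalIntegral.integral_eq_sub_of_hasDerivAt h (by
    apply Continuous.intervalIntegrable
    fun_prop)]
  rw [sub_self, mul_zero, Real.exp_zero]
  ring

/-- The stochastic convolution in one coordinate: with eigenvalue `-l` and noise `f`. -/
def scalarConv (l : ℝ) (f : ℝ → ℝ) (t : ℝ) : ℝ :=
  -l * (∫ r in (0 : ℝ)..t, Real.exp (-l * (t - r)) * f r) + f t

theorem scalarConv_eq (hl : l ≠ 0) (hf : Continuous f) (t : ℝ) :
    scalarConv l f t = (∫ r in (0 : ℝ)..t, -l * Real.exp (-l * (t - r)) * (f r - f t)) +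
      Real.exp (-l * t) * f t := by
  have h1 : ∫ r in (0 : ℝ)..t, -l * Real.exp (-l * (t - r)) * (f r - f t) =
      -l * (∫ r in (0 : ℝ)..t, Real.exp (-l * (t - r)) * f r) -
        -l * f t * ∫ r in (0 : ℝ)..t, Real.exp (-l * (t - r)) := by
    rw [← intervalIntegral.integral_const_mul, ← intervalIntegral.integral_const_mul,
      ← intervalIntegral.integral_sub]
    · refine intervalIntegral.integral_congr fun r _ => ?_
      ring
    · apply Continuous.intervalIntegrable
      fun_prop
    · apply Continuous.intervalIntegrable
      fun_prop
  rw [scalarConv, h1, integral_exp_neg_mul_sub hl, sub_zero]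
  field_simp
  ring

theorem scalarConv_shift (hl : l ≠ 0) (hf : Continuous f) (s t : ℝ) :
    scalarConv l f t = scalarConv l (fun r => f (r + s) - f s) (t - s) +
      Real.exp (-l * (t - s)) * scalarConv l f s := by
  have h1 : ∫ r in (0 : ℝ)..(t - s), Real.exp (-l * (t - s - r)) * (f (r + s) - f s) =
      (∫ r in s..t, Real.exp (-l * (t - r)) * f r) -
        f s * ∫ r in s..t, Real.exp (-l * (t - r)) := by
    have h2 := intervalIntegral.integral_comp_add_right (a := 0) (b := t - s)
      (fun r => Real.exp (-l * (t - r)) * (f r - f s)) s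
    rw [zero_add, sub_add_cancel] at h2
    rw [← intervalIntegral.integral_const_mul, ← intervalIntegral.integral_sub]
    · refine Eq.trans ?_ (h2.trans ?_)
      · refine intervalIntegral.integral_congr fun r _ => ?_
        rw [sub_sub, add_comm s r]
      · refine intervalIntegral.integral_congr fun r _ => ?_
        ring
    · apply Continuous.intervalIntegrable
      fun_prop
    · apply Continuous.intervalIntegrable
      fun_prop
  have h3 : ∫ r in (0 : ℝ)..t, Real.exp (-l * (t - r)) * f r =
      Real.exp (-l * (t - s)) * (∫ r in (0 : ℝ)..s, Real.exp (-l * (s - r)) * f r) +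
        ∫ r in s..t, Real.exp (-l * (t - r)) * f r := by
    rw [← intervalIntegral.integral_const_mul,
      ← intervalIntegral.integral_add_adjacent_intervals (b := s)]
    · congr 1
      refine intervalIntegral.integral_congr fun r _ => ?_
      rw [← mul_assoc, ← Real.exp_add]
      ring_nf
    · apply Continuous.intervalIntegrable
      fun_prop
    · apply Continuous.intervalIntegrable
      fun_prop
  rw [scalarConv, scalarConv, scalarConv, h1, h3, integral_exp_neg_mul_sub hl, sub_add_cancel]
  field_simp
  ring

/-- The stationary Ornstein-Uhlenbeck variable in one coordinate. -/
def scalarOU (l : ℝ) (f : ℝ → ℝ) : ℝ := -l * ∫ q in Iic (0 : ℝ), Real.exp (l * q) * f q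

theorem scalarConv_eq_scalarOU (hl : 0 < l) (hf : Continuous f)
    (hi : IntegrableOn (fun q => Real.exp (l * q) * f q) (Iic 0)) {t : ℝ} :
    scalarConv l f t = scalarOU l (fun q => f (q + t) - f t) -
      Real.exp (-l * t) * scalarOU l f := by
  have hi0 : IntegrableOn (fun r => Real.exp (-l * (t - r)) * f r) (Iic 0) := by
    refine (hi.const_mul (Real.exp (-l * t))).congr (Eventually.of_forall fun r => ?_)
    simp only
    rw [← mul_assoc, ← Real.exp_add]
    ring_nf
  have hit : IntegrableOn (fun r => Real.exp (-l * (t - r)) * f r) (Iic t) := by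
    have hc : Continuous fun r => Real.exp (-l * (t - r)) * f r := by fun_prop
    refine (hi0.union (hc.integrableOn_Icc (a := 0) (b := t))).mono_set fun r hr => ?_
    rcases le_total r 0 with h | h
    · exact Or.inl h
    · exact Or.inr ⟨h, hr⟩
  have he : IntegrableOn (fun r => Real.exp (-l * (t - r))) (Iic t) := by
    refine ((integrableOn_exp_mul_Iic hl t).const_mul (Real.exp (-l * t))).congr
      (Eventually.of_forall fun r => ?_)
    simp only
    rw [← Real.exp_add]
    ring_nf
  have h1 : ∫ q in Iic (0 : ℝ), Real.exp (l * q) * (f (q + t) - f t) =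
      ∫ r in Iic t, Real.exp (-l * (t - r)) * (f r - f t) := by
    have h0 := (measurePreserving_add_right volume t).setIntegral_preimage_emb
      (measurableEmbedding_addRight t) (fun r => Real.exp (-l * (t - r)) * (f r - f t)) (Iic t)
    rw [preimage_add_const_Iic, sub_self] at h0
    rw [← h0]
    refine setIntegral_congr_fun measurableSet_Iic fun q _ => ?_
    ring_nf
  have h2 : ∫ r in Iic t, Real.exp (-l * (t - r)) * (f r - f t) =
      (∫ r in Iic t, Real.exp (-l * (t - r)) * f r) - f t * l⁻¹ := by
    have h3 : ∫ r in Iic t, Real.exp (-l * (t - r)) = l⁻¹ := by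
      have h4 : ∀ r, Real.exp (-l * (t - r)) = Real.exp (-l * t) * Real.exp (l * r) := fun r => by
        rw [← Real.exp_add]
        ring_nf
      simp only [h4]
      rw [integral_const_mul, integral_exp_mul_Iic hl, mul_div_assoc', ← Real.exp_add]
      simp
    rw [← h3, ← integral_const_mul, ← integral_sub hit (he.const_mul (f t))]
    refine setIntegral_congr_fun measurableSet_Iic fun q _ => ?_
    ring
  have h5 := intervalIntegral.integral_Iic_sub_Iic hi0 hit
  have h6 : Real.exp (-l * t) * ∫ q in Iic (0 : ℝ), Real.exp (l * q) * f q =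
      ∫ r in Iic (0 : ℝ), Real.exp (-l * (t - r)) * f r := by
    rw [← integral_const_mul]
    refine setIntegral_congr_fun measurableSet_Iic fun q _ => ?_
    rw [← mul_assoc, ← Real.exp_add]
    ring_nf
  rw [scalarConv, scalarOU, scalarOU, h1, h2, mul_left_comm, h6, ← h5]
  field_simp
  ring

end Scalar

section Convolution

variable {V : Type*} [NormedAddCommGroup V] [InnerProductSpace ℝ V]
  {ι : Type*} {B : V →ₗ.[ℝ] V} {b : HilbertBasis ι ℝ V} {lam : ι → ℝ} {c : ℝ}
  {R : ℝ → V →L[ℝ] V} {ω : ℝ → V}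

/-- The family `R t = B S(t)`, `t > 0`, of bounded operators. -/
structure IsGeneratorComp (B : V →ₗ.[ℝ] V) (b : HilbertBasis ι ℝ V) (lam : ι → ℝ) (c : ℝ)
    (R : ℝ → V →L[ℝ] V) : Prop where
  coord : ∀ t, 0 < t → ∀ x i, inner ℝ (b i) (R t x) =
    -lam i * Real.exp (-lam i * t) * inner ℝ (b i) x
  norm_le : ∀ t, 0 < t → ‖R t‖ ≤ t⁻¹ * Real.exp (-(c / 2) * t)
  add : ∀ t x, 0 ≤ t → 0 < x → R (t + x) = semigroup B t ∘L R x
  continuousOn : ContinuousOn R (Ioi 0)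

theorem IsDiagonal.opApply_eq (hD : IsDiagonal B b lam c) {x y : V}
    (h : ∀ i, inner ℝ (b i) y = -lam i * inner ℝ (b i) x) :
    x ∈ B.domain ∧ opApply B x = y := by
  have h1 := (hD.mem_graph x y).2 h
  have h2 : x ∈ B.domain := LinearPMap.mem_domain_of_mem_graph h1
  refine ⟨h2, ?_⟩
  rw [opApply, dif_pos h2]
  obtain ⟨z, hz1, hz2⟩ := (LinearPMap.mem_graph_iff B).1 h1
  simp only at hz1 hz2
  rw [← hz2]
  congr 1
  exact Subtype.ext hz1.symm

theorem IsGeneratorComp.norm_le_inv (hR : IsGeneratorComp B b lam c R) (hc : 0 < c) {t : ℝ}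
    (ht : 0 < t) : ‖R t‖ ≤ t⁻¹ := by
  refine (hR.norm_le t ht).trans (mul_le_of_le_one_right (by positivity) ?_)
  rw [Real.exp_le_one_iff]
  nlinarith [mul_pos hc ht]

theorem IsGeneratorComp.intervalIntegrable (hR : IsGeneratorComp B b lam c R) (hc : 0 < c)
    (hω : Continuous ω) {C p t : ℝ} (ht : 0 ≤ t) (hp : 0 < p)
    (hC : ∀ r, 0 ≤ r → r < t → ‖ω t - ω r‖ ≤ C * (t - r) ^ p) :
    IntervalIntegrable (fun r => R (t - r) (ω r - ω t)) volume 0 t := by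
  have h1 : IntervalIntegrable (fun r => C * (t - r) ^ (p - 1)) volume 0 t :=
    (intervalIntegrable_rpow_left (by linarith)).const_mul _
  refine intervalIntegrable_of_norm_le ht h1 ?_ fun r hr => ?_
  · refine ContinuousOn.aestronglyMeasurable ?_ measurableSet_Ioo
    exact (continuousOn_shift hR.continuousOn le_rfl 0).clm_apply
      (hω.sub continuous_const).continuousOn
  · have h2 : 0 < t - r := sub_pos.2 hr.2
    have h3 := hC r hr.1.le hr.2
    rw [norm_sub_rev] at h3
    refine ((R (t - r)).le_opNorm _).trans
      ((mul_le_mul (hR.norm_le_inv hc h2) h3 (norm_nonneg _) (by positivity)).trans (le_of_eq ?_))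
    rw [Real.rpow_sub_one h2.ne']
    field_simp

theorem IsGeneratorComp.norm_integral_le (hR : IsGeneratorComp B b lam c R) (hc : 0 < c)
    {C p t : ℝ} (ht : 0 ≤ t) (hp : 0 < p)
    (hC : ∀ r, 0 ≤ r → r < t → ‖ω t - ω r‖ ≤ C * (t - r) ^ p) :
    ‖∫ r in (0 : ℝ)..t, R (t - r) (ω r - ω t)‖ ≤ C * p⁻¹ * t ^ p := by
  have h1 : IntervalIntegrable (fun r => C * (t - r) ^ (p - 1)) volume 0 t :=
    (intervalIntegrable_rpow_left (by linarith)).const_mul _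
  refine (norm_integral_le_of_norm_le_Ioo ht h1 fun r hr => ?_).trans (le_of_eq ?_)
  · have h2 : 0 < t - r := sub_pos.2 hr.2
    have h3 := hC r hr.1.le hr.2
    rw [norm_sub_rev] at h3
    refine ((R (t - r)).le_opNorm _).trans
      ((mul_le_mul (hR.norm_le_inv hc h2) h3 (norm_nonneg _) (by positivity)).trans (le_of_eq ?_))
    rw [Real.rpow_sub_one h2.ne']
    field_simp
  · rw [intervalIntegral.integral_const_mul, integral_rpow_left (by linarith), sub_zero,
      sub_add_cancel]
    ring

variable [CompleteSpace V]

theorem IsDiagonal.exists_isGeneratorComp (hD : IsDiagonal B b lam c) :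
    ∃ R, IsGeneratorComp B b lam c R := by
  obtain ⟨R, h1, h2, h3, h4⟩ := hD.exists_generator_comp
  exact ⟨R, h1, h2, h3, h4⟩

/-- `(S(τ) - 1) B S(x)` in terms of the smoothing of the semigroup. -/
theorem IsGeneratorComp.norm_semigroup_sub_le (hR : IsGeneratorComp B b lam c R)
    (hD : IsDiagonal B b lam c) {θ τ x : ℝ} (hθ : 0 ≤ θ) (hθ' : θ ≤ 1) (hτ : 0 ≤ τ) (hx : 0 < x)
    (y : V) : ‖semigroup B τ (R x y) - R x y‖ ≤ 4 * τ ^ θ * x ^ (-θ - 1) * ‖y‖ := by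
  have hx2 : 0 < x / 2 := by linarith
  have hS := hD.isSmoothing
  have e : semigroup B τ (R x y) - R x y =
      (semigroup B (x / 2 + τ) - semigroup B (x / 2)) (R (x / 2) y) := by
    have h1 := hR.add (x / 2) (x / 2) hx2.le hx2
    rw [add_halves] at h1
    rw [h1, sub_apply, add_comm, hS.add τ (x / 2) hτ hx2.le]
    rfl
  have h2 := hS.norm_sub_le θ hθ hθ' (x / 2) (x / 2 + τ) hx2 (by linarith)
  rw [add_sub_cancel_left] at h2
  have h3 := hR.norm_le_inv hD.pos hx2
  have h4 := half_rpow_neg_le hθ' hx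
  rw [e]
  calc _ ≤ ‖semigroup B (x / 2 + τ) - semigroup B (x / 2)‖ * (‖R (x / 2)‖ * ‖y‖) :=
        (ContinuousLinearMap.le_opNorm _ _).trans
          (mul_le_mul_of_nonneg_left (ContinuousLinearMap.le_opNorm _ _) (norm_nonneg _))
    _ ≤ (τ ^ θ * (2 * x ^ (-θ))) * ((x / 2)⁻¹ * ‖y‖) := by
        refine mul_le_mul (h2.trans (mul_le_mul_of_nonneg_left h4 (by positivity)))
          (mul_le_mul_of_nonneg_right h3 (norm_nonneg y)) (by positivity) (by positivity)
    _ = _ := by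
        rw [Real.rpow_sub_one hx.ne']
        field_simp
        ring

theorem inner_intervalIntegral {f : ℝ → V} {s t : ℝ} (x : V)
    (hf : IntervalIntegrable f volume s t) :
    inner ℝ x (∫ r in s..t, f r) = ∫ r in s..t, inner ℝ x (f r) :=
  ((innerSL ℝ x).intervalIntegral_comp_comm hf).symm

/-- Subtracting the value of the noise at the endpoint removes the singularity of `B S(t-r)`: the
stochastic convolution exists and is computed by an absolutely convergent integral. -/
theorem IsGeneratorComp.stochConv (hR : IsGeneratorComp B b lam c R) (hD : IsDiagonal B b lam c)
    (hω : Continuous ω) {C p t : ℝ} (ht : 0 ≤ t) (hp : 0 < p)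
    (hC : ∀ r, 0 ≤ r → r < t → ‖ω t - ω r‖ ≤ C * (t - r) ^ p) :
    StochConvExists B ω t ∧
      stochConv B ω t = (∫ r in (0 : ℝ)..t, R (t - r) (ω r - ω t)) + semigroup B t (ω t) ∧
      ∀ i, inner ℝ (b i) (stochConv B ω t) =
        scalarConv (lam i) (fun r => inner ℝ (b i) (ω r)) t := by
  have hi := intervalIntegrable_conv (T := t) hD.isSmoothing (hω.continuousOn) ht le_rfl le_rfl
  have hi2 := hR.intervalIntegrable hD.pos hω ht hp hC
  have hcx : ∀ i, inner ℝ (b i) (∫ r in (0 : ℝ)..t, semigroup B (t - r) (ω r)) =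
      ∫ r in (0 : ℝ)..t, Real.exp (-lam i * (t - r)) * inner ℝ (b i) (ω r) := fun i => by
    rw [inner_intervalIntegral _ hi]
    refine intervalIntegral.integral_congr fun r hr => ?_
    rw [uIcc_of_le ht] at hr
    exact hD.semigroup_coord (by linarith [hr.2]) _ _
  have hcy : ∀ i, inner ℝ (b i) ((∫ r in (0 : ℝ)..t, R (t - r) (ω r - ω t)) +
      semigroup B t (ω t)) = scalarConv (lam i) (fun r => inner ℝ (b i) (ω r)) t := fun i => by
    rw [scalarConv_eq (hD.lam_pos i).ne' (by fun_prop), inner_add_right,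
      inner_intervalIntegral _ hi2, hD.semigroup_coord ht]
    congr 1
    refine intervalIntegral.integral_congr_Ioo_of_le ht fun r hr => ?_
    rw [hR.coord _ (sub_pos.2 hr.2), inner_sub_right]
  obtain ⟨h1, h2⟩ := hD.opApply_eq (x := ∫ r in (0 : ℝ)..t, semigroup B (t - r) (ω r))
    (y := (∫ r in (0 : ℝ)..t, R (t - r) (ω r - ω t)) + semigroup B t (ω t) - ω t) fun i => by
      rw [inner_sub_right, hcy, hcx, scalarConv]
      ring
  have h3 : MixedEvolution.stochConv B ω t =
      (∫ r in (0 : ℝ)..t, R (t - r) (ω r - ω t)) + semigroup B t (ω t) := by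
    rw [MixedEvolution.stochConv, h2, sub_add_cancel]
  exact ⟨⟨hi, h1⟩, h3, fun i => by rw [h3, hcy]⟩

end Convolution

section Growth

variable {E : Type*} [NormedAddCommGroup E] {ω : ℝ → E}

/-- Subexponential paths are dominated by every exponential. -/
theorem Subexponential.exists_norm_le (hsub : Subexponential ω) (hω : Continuous ω) {k : ℝ}
    (hk : 0 < k) (t : ℝ) : ∃ M, ∀ r, r ≤ t → ‖ω r‖ ≤ M * Real.exp (-k * r) := by
  obtain ⟨n, hn⟩ := exists_nat_one_div_lt hk
  have h1 := (hsub (n + 1) (by omega)).2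
  obtain ⟨N, hN⟩ := eventually_atBot.1 (h1.eventually (gt_mem_nhds one_pos))
  obtain ⟨M, hM⟩ := (isCompact_Icc (a := min N 0) (b := t)).exists_bound_of_continuousOn
    hω.continuousOn
  refine ⟨max 1 (M * Real.exp (k * t)), fun r hr => ?_⟩
  rcases le_total r (min N 0) with h | h
  · have h2 := hN r (h.trans (min_le_left _ _))
    have hr0 : r ≤ 0 := h.trans (min_le_right _ _)
    rw [abs_of_nonpos hr0, neg_mul_neg] at h2
    have h3 : ‖ω r‖ ≤ Real.exp (-(1 / ((n + 1 : ℕ) : ℝ) * r)) := by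
      have h4 := mul_le_mul_of_nonneg_right h2.le (Real.exp_pos (-(1 / ((n + 1 : ℕ) : ℝ) * r))).le
      rwa [mul_assoc, ← Real.exp_add, add_neg_cancel, Real.exp_zero, mul_one, one_mul] at h4
    refine h3.trans ?_
    have h5 : Real.exp (-(1 / ((n + 1 : ℕ) : ℝ) * r)) ≤ Real.exp (-k * r) := by
      refine Real.exp_le_exp.2 ?_
      push_cast
      nlinarith
    exact h5.trans (le_mul_of_one_le_left (Real.exp_pos _).le (le_max_left _ _))
  · have h2 := hM r ⟨h, hr⟩
    have hM0 : 0 ≤ M := (norm_nonneg _).trans h2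
    have h3 : 1 ≤ Real.exp (k * t) * Real.exp (-k * r) := by
      rw [← Real.exp_add]
      refine Real.one_le_exp ?_
      nlinarith
    calc ‖ω r‖ ≤ M * (Real.exp (k * t) * Real.exp (-k * r)) := h2.trans (le_mul_of_one_le_right hM0 h3)
      _ = M * Real.exp (k * t) * Real.exp (-k * r) := by ring
      _ ≤ _ := mul_le_mul_of_nonneg_right (le_max_right _ _) (Real.exp_pos _).le

end Growth

section Convolution

variable {V : Type*} [NormedAddCommGroup V] [InnerProductSpace ℝ V] [CompleteSpace V]
  {ι : Type*} {B : V →ₗ.[ℝ] V} {b : HilbertBasis ι ℝ V} {lam : ι → ℝ} {c : ℝ}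
  {R : ℝ → V →L[ℝ] V} {ω : ℝ → V} {γ p C T : ℝ}

theorem IsGeneratorComp.norm_stochConv_le (hR : IsGeneratorComp B b lam c R)
    (hD : IsDiagonal B b lam c) (hω : Continuous ω) (h0 : ω 0 = 0) {t : ℝ} (ht : 0 ≤ t)
    (hp : 0 < p) (hC : ∀ r, 0 ≤ r → r < t → ‖ω t - ω r‖ ≤ C * (t - r) ^ p) :
    ‖MixedEvolution.stochConv B ω t‖ ≤ C * (p⁻¹ + 1) * t ^ p := by
  rw [(hR.stochConv hD hω ht hp hC).2.1]
  have h1 := hR.norm_integral_le hD.pos ht hp hC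
  have h2 : ‖ω t‖ ≤ C * t ^ p := by
    rcases ht.eq_or_lt with rfl | ht0
    · rw [h0, Real.zero_rpow hp.ne', norm_zero, mul_zero]
    · have := hC 0 le_rfl ht0
      rwa [h0, sub_zero, sub_zero] at this
  have h3 : ‖semigroup B t (ω t)‖ ≤ C * t ^ p :=
    ((semigroup B t).le_opNorm _).trans ((mul_le_mul (hD.isSmoothing.norm_le_one t ht) h2
      (norm_nonneg _) zero_le_one).trans (one_mul _).le)
  refine (norm_add_le _ _).trans ((add_le_add h1 h3).trans (le_of_eq ?_))
  ring

/-- Flow property of the stochastic convolution along the Wiener shift. -/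
theorem IsGeneratorComp.stochConv_shift (hR : IsGeneratorComp B b lam c R)
    (hD : IsDiagonal B b lam c) (hω : Continuous ω) {s t : ℝ} (hs : 0 ≤ s) (hst : s ≤ t)
    (hp : 0 < p) (hC : ∀ q r, 0 ≤ q → q < r → r ≤ t → ‖ω r - ω q‖ ≤ C * (r - q) ^ p) :
    MixedEvolution.stochConv B ω t = MixedEvolution.stochConv B (shift s ω) (t - s) +
      semigroup B (t - s) (MixedEvolution.stochConv B ω s) := by
  have hω' : Continuous (shift s ω) := by unfold shift; fun_prop
  refine ext_coord b fun i => ?_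
  rw [inner_add_right, hD.semigroup_coord (sub_nonneg.2 hst),
    (hR.stochConv hD hω (hs.trans hst) hp fun r h1 h2 => hC r t h1 h2 le_rfl).2.2,
    (hR.stochConv hD hω hs hp fun r h1 h2 => hC r s h1 h2 hst).2.2,
    (hR.stochConv (C := C) (p := p) hD hω' (sub_nonneg.2 hst) hp fun r h1 h2 => by
      have h3 := hC (r + s) t (by linarith) (by linarith) le_rfl
      simp only [shift, sub_add_cancel, sub_sub_sub_cancel_right]
      rwa [sub_sub, add_comm s r]).2.2, scalarConv_shift (hD.lam_pos i).ne' (by fun_prop) s t]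
  simp only [shift, inner_sub_right]

theorem IsGeneratorComp.norm_semigroup_stochConv_sub_le (hR : IsGeneratorComp B b lam c R)
    (hD : IsDiagonal B b lam c) (hω : Continuous ω) (h0 : ω 0 = 0) {s τ : ℝ} (hs : 0 < s)
    (hτ : 0 ≤ τ) (hγ : 0 ≤ γ) (hγ' : γ ≤ 1) (hp : γ < p)
    (hC : ∀ r, 0 ≤ r → r < s → ‖ω s - ω r‖ ≤ C * (s - r) ^ p) :
    ‖semigroup B τ (MixedEvolution.stochConv B ω s) - MixedEvolution.stochConv B ω s‖ ≤
      C * (4 * (p - γ)⁻¹ + 1) * (τ ^ γ * s ^ (p - γ)) := by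
  have hp0 : 0 < p := hγ.trans_lt hp
  have hi := hR.intervalIntegrable hD.pos hω hs.le hp0 hC
  have e1 : semigroup B τ (MixedEvolution.stochConv B ω s) - MixedEvolution.stochConv B ω s =
      (∫ r in (0 : ℝ)..s, (semigroup B τ (R (s - r) (ω r - ω s)) - R (s - r) (ω r - ω s))) +
        (semigroup B (s + τ) - semigroup B s) (ω s) := by
    have h1 := (semigroup B τ).intervalIntegral_comp_comm hi
    have hi2 : IntervalIntegrable (fun r => semigroup B τ (R (s - r) (ω r - ω s))) volume 0 s :=
      ⟨(semigroup B τ).integrable_comp hi.1, (semigroup B τ).integrable_comp hi.2⟩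
    rw [(hR.stochConv hD hω hs.le hp0 hC).2.1, intervalIntegral.integral_sub hi2 hi, h1, map_add,
      sub_apply, add_comm s τ, hD.isSmoothing.add τ s hτ hs.le, ContinuousLinearMap.comp_apply]
    abel
  have h1 : IntervalIntegrable (fun r => 4 * τ ^ γ * C * (s - r) ^ (p - γ - 1)) volume 0 s :=
    (intervalIntegrable_rpow_left (by linarith)).const_mul _
  have h2 : ‖∫ r in (0 : ℝ)..s,
      (semigroup B τ (R (s - r) (ω r - ω s)) - R (s - r) (ω r - ω s))‖ ≤
      4 * τ ^ γ * C * (s ^ (p - γ) / (p - γ)) := by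
    refine (norm_integral_le_of_norm_le_Ioo hs.le h1 fun r hr => ?_).trans (le_of_eq ?_)
    · have hsr : 0 < s - r := sub_pos.2 hr.2
      have h3 := hC r hr.1.le hr.2
      rw [norm_sub_rev] at h3
      refine (hR.norm_semigroup_sub_le hD hγ hγ' hτ hsr _).trans
        ((mul_le_mul_of_nonneg_left h3 (by positivity)).trans (le_of_eq ?_))
      rw [show p - γ - 1 = (-γ - 1) + p by ring, Real.rpow_add hsr]
      ring
    · rw [intervalIntegral.integral_const_mul, integral_rpow_left (by linarith), sub_zero,
        sub_add_cancel]
  have h4 : ‖(semigroup B (s + τ) - semigroup B s) (ω s)‖ ≤ C * (τ ^ γ * s ^ (p - γ)) := by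
    have h5 := hD.isSmoothing.norm_sub_le γ hγ hγ' s (s + τ) hs (by linarith)
    rw [add_sub_cancel_left] at h5
    have h6 := hC 0 le_rfl hs
    rw [h0, sub_zero, sub_zero] at h6
    refine (ContinuousLinearMap.le_opNorm _ _).trans
      ((mul_le_mul h5 h6 (norm_nonneg _) (by positivity)).trans (le_of_eq ?_))
    rw [show p - γ = -γ + p by ring, Real.rpow_add hs]
    ring
  rw [e1]
  refine (norm_add_le _ _).trans ((add_le_add h2 h4).trans (le_of_eq ?_))
  ring

/-- The stochastic convolution of a Hölder path lies in the weighted Hölder space, for any smaller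
exponent. -/
theorem IsGeneratorComp.exists_weightedBound_stochConv (hR : IsGeneratorComp B b lam c R)
    (hD : IsDiagonal B b lam c) (hω : Continuous ω) (h0 : ω 0 = 0) (hγ : 0 < γ) (hγ' : γ ≤ 1)
    (hp : γ < p) (hCn : 0 ≤ C) (hT : 0 < T)
    (hC : ∀ q r, 0 ≤ q → q < r → r ≤ T → ‖ω r - ω q‖ ≤ C * (r - q) ^ p) :
    ∃ K, WeightedBound γ T 0 K (MixedEvolution.stochConv B ω) := by
  have hp0 : 0 < p := hγ.trans hp
  have hpγ : 0 < p - γ := sub_pos.2 hp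
  have hTp : 0 < T ^ p := Real.rpow_pos_of_pos hT p
  refine ⟨(C * (p⁻¹ + 1) + C * (4 * (p - γ)⁻¹ + 1)) * T ^ p, fun t ht0 ht => ?_,
    fun s t hs hst ht => ?_⟩
  · rw [zero_mul, Real.exp_zero, mul_one]
    refine (hR.norm_stochConv_le hD hω h0 ht0 hp0 fun r h1 h2 => hC r t h1 h2 ht).trans ?_
    have h1 : t ^ p ≤ T ^ p := Real.rpow_le_rpow ht0 ht hp0.le
    refine mul_le_mul ?_ h1 (by positivity) (by positivity)
    have : 0 ≤ C * (4 * (p - γ)⁻¹ + 1) := by positivity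
    linarith
  · rw [zero_mul, Real.exp_zero, mul_one]
    refine increment_le (p := p) (by positivity) (by positivity) hγ hp.le hs hst ht ?_
    have hω' : Continuous (shift s ω) := by unfold shift; fun_prop
    have h1 := hR.norm_stochConv_le (C := C) (p := p) hD hω' (by simp [shift])
      (sub_nonneg.2 hst.le) hp0 fun r h1 h2 => by
        have h3 := hC (r + s) t (by linarith) (by linarith) ht
        simp only [shift, sub_add_cancel, sub_sub_sub_cancel_right]
        rwa [sub_sub, add_comm s r]
    have h2 := hR.norm_semigroup_stochConv_sub_le hD hω h0 hs (sub_nonneg.2 hst.le) hγ.le hγ' hp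
      fun r h1 h2 => hC r s h1 h2 (hst.le.trans ht)
    rw [hR.stochConv_shift hD hω hs.le hst.le hp0
      fun q r h1 h2 h3 => hC q r h1 h2 (h3.trans ht), add_sub_assoc]
    exact (norm_add_le _ _).trans (add_le_add h1 h2)

theorem IsGeneratorComp.continuousOn_stochConv (hR : IsGeneratorComp B b lam c R)
    (hD : IsDiagonal B b lam c) (hω : Continuous ω) (h0 : ω 0 = 0) (hγ : 0 < γ) (hγ' : γ ≤ 1)
    (hp : γ < p) (hCn : 0 ≤ C) (hT : 0 < T)
    (hC : ∀ q r, 0 ≤ q → q < r → r ≤ T → ‖ω r - ω q‖ ≤ C * (r - q) ^ p) :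
    ContinuousOn (MixedEvolution.stochConv B ω) (Icc 0 T) := by
  obtain ⟨K, hK⟩ := hR.exists_weightedBound_stochConv hD hω h0 hγ hγ' hp hCn hT hC
  have hp0 : 0 < p := hγ.trans hp
  have hb : ∀ t ∈ Icc 0 T, ‖MixedEvolution.stochConv B ω t‖ ≤ C * (p⁻¹ + 1) * t ^ p := fun t ht =>
    hR.norm_stochConv_le hD hω h0 ht.1 hp0 fun r h1 h2 => hC r t h1 h2 ht.2
  refine hK.continuousOn hγ le_rfl ?_
  have hz : MixedEvolution.stochConv B ω 0 = 0 := by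
    have h1 := hb 0 ⟨le_rfl, hT.le⟩
    rw [Real.zero_rpow hp0.ne', mul_zero] at h1
    exact norm_le_zero_iff.1 h1
  rw [ContinuousWithinAt, hz]
  have h1 : Tendsto (fun t : ℝ => C * (p⁻¹ + 1) * t ^ p) (𝓝[Icc 0 T] 0) (𝓝 0) := by
    have h3 : Continuous fun t : ℝ => C * (p⁻¹ + 1) * t ^ p :=
      continuous_const.mul (continuous_id.rpow_const fun _ => Or.inr hp0.le)
    have h2 := h3.tendsto 0
    rw [Real.zero_rpow hp0.ne', mul_zero] at h2
    exact h2.mono_left nhdsWithin_le_nhds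
  refine squeeze_zero_norm' ?_ h1
  filter_upwards [self_mem_nhdsWithin] with t ht using hb t ht

theorem IsDiagonal.norm_semigroup_le (hD : IsDiagonal B b lam c) {t : ℝ} (ht : 0 ≤ t) :
    ‖semigroup B t‖ ≤ Real.exp (-c * t) :=
  norm_clm_le_of_coord b (Real.exp_pos _).le (fun x i => hD.semigroup_coord ht x i) fun i => by
    rw [abs_of_pos (Real.exp_pos _)]
    exact Real.exp_le_exp.2 (by nlinarith [hD.le i])

/-- The Ornstein-Uhlenbeck variable of a path that grows slower than the semigroup decays and is
Hölder continuous at `0`. -/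
theorem IsGeneratorComp.ouZ (hR : IsGeneratorComp B b lam c R) (hD : IsDiagonal B b lam c)
    (hω : Continuous ω) (hp : 0 < p) (hC : ∀ q, -1 ≤ q → q < 0 → ‖ω q‖ ≤ C * (-q) ^ p) {M : ℝ}
    (hM : ∀ q, q ≤ 0 → ‖ω q‖ ≤ M * Real.exp (-(c / 4) * q)) :
    OuZExists B ω ∧ ∀ i, inner ℝ (b i) (ouZ B ω) = scalarOU (lam i) (fun r => inner ℝ (b i) (ω r)) ∧
      IntegrableOn (fun q => Real.exp (lam i * q) * inner ℝ (b i) (ω q)) (Iic 0) := by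
  have hc := hD.pos
  have hM0 : 0 ≤ M := by
    have h1 := (norm_nonneg _).trans (hM 0 le_rfl)
    rwa [mul_zero, Real.exp_zero, mul_one] at h1
  have hSc : ContinuousOn (fun q => semigroup B (-q)) (Iio 0) :=
    hD.isSmoothing.continuousOn_norm.comp (by fun_prop) fun q (hq : q < 0) => neg_pos.2 hq
  have hRc : ContinuousOn (fun q => R (-q)) (Iio 0) :=
    hR.continuousOn.comp (by fun_prop) fun q (hq : q < 0) => neg_pos.2 hq
  have hi : IntegrableOn (fun q => semigroup B (-q) (ω q)) (Iic 0) := by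
    rw [integrableOn_Iic_iff_integrableOn_Iio]
    have h1 : IntegrableOn (fun q => M * Real.exp (c / 2 * q)) (Iio 0) :=
      IntegrableOn.mono_set ((integrableOn_exp_mul_Iic (a := c / 2) (by linarith) 0).const_mul M)
        Iio_subset_Iic_self
    refine Integrable.mono' h1
      ((hSc.clm_apply hω.continuousOn).aestronglyMeasurable measurableSet_Iio)
      ((ae_restrict_iff' measurableSet_Iio).2 (Eventually.of_forall fun q (hq : q < 0) => ?_))
    refine ((semigroup B (-q)).le_opNorm _).trans ((mul_le_mul
      (hD.norm_semigroup_le (neg_pos.2 hq).le) (hM q hq.le) (norm_nonneg _)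
      (Real.exp_pos _).le).trans ?_)
    rw [mul_left_comm, ← Real.exp_add]
    refine mul_le_mul_of_nonneg_left (Real.exp_le_exp.2 ?_) hM0
    nlinarith
  have hi2 : IntegrableOn (fun q => R (-q) (ω q)) (Iic 0) := by
    rw [integrableOn_Iic_iff_integrableOn_Iio]
    have hm : ∀ s ⊆ Iio (0 : ℝ), MeasurableSet s →
        AEStronglyMeasurable (fun q => R (-q) (ω q)) (volume.restrict s) := fun s hs hsm =>
      ((hRc.clm_apply hω.continuousOn).mono hs).aestronglyMeasurable hsm
    have h1 : IntegrableOn (fun q => R (-q) (ω q)) (Iic (-1)) := by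
      refine Integrable.mono' (((integrableOn_exp_mul_Iic (a := c / 4) (by linarith) (-1)).const_mul
        M)) (hm _ (fun q (hq : q ≤ -1) => by simp only [mem_Iio]; linarith) measurableSet_Iic)
        ((ae_restrict_iff' measurableSet_Iic).2 (Eventually.of_forall fun q (hq : q ≤ -1) => ?_))
      have h2 : ‖R (-q)‖ ≤ Real.exp (-(c / 2) * -q) :=
        (hR.norm_le (-q) (by linarith)).trans
          (mul_le_of_le_one_left (Real.exp_pos _).le (inv_le_one_of_one_le₀ (by linarith)))
      refine ((R (-q)).le_opNorm _).trans ((mul_le_mul h2 (hM q (by linarith)) (norm_nonneg _)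
        (Real.exp_pos _).le).trans (le_of_eq ?_))
      rw [mul_left_comm, ← Real.exp_add]
      ring_nf
    have h2 : IntegrableOn (fun q => R (-q) (ω q)) (Ioo (-1) 0) := by
      have h3 : IntervalIntegrable (fun q : ℝ => C * (0 - q) ^ (p - 1)) volume (-1) 0 :=
        (intervalIntegrable_rpow_left (by linarith)).const_mul _
      refine (intervalIntegrable_iff_integrableOn_Ioo_of_le (by norm_num)).1
        (intervalIntegrable_of_norm_le (by norm_num) h3
          (hm _ (fun q hq => hq.2) measurableSet_Ioo) fun q hq => ?_)
      have h4 : 0 < -q := neg_pos.2 hq.2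
      refine ((R (-q)).le_opNorm _).trans ((mul_le_mul (hR.norm_le_inv hc h4)
        (hC q hq.1.le hq.2) (norm_nonneg _) (by positivity)).trans (le_of_eq ?_))
      rw [zero_sub, Real.rpow_sub_one h4.ne']
      field_simp
    refine (h1.union h2).mono_set fun q (hq : q < 0) => ?_
    rcases le_or_gt q (-1) with h | h
    · exact Or.inl h
    · exact Or.inr ⟨h, hq⟩
  have hcx : ∀ i, inner ℝ (b i) (∫ q in Iic (0 : ℝ), semigroup B (-q) (ω q)) =
      ∫ q in Iic (0 : ℝ), Real.exp (lam i * q) * inner ℝ (b i) (ω q) := fun i => by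
    refine (((innerSL ℝ (b i)).integral_comp_comm hi).symm).trans ?_
    refine setIntegral_congr_fun measurableSet_Iic fun q (hq : q ≤ 0) => ?_
    have h1 := hD.semigroup_coord (neg_nonneg.2 hq) (ω q) i
    rw [neg_mul_neg] at h1
    exact h1
  have hcy : ∀ i, inner ℝ (b i) (∫ q in Iic (0 : ℝ), R (-q) (ω q)) =
      scalarOU (lam i) (fun r => inner ℝ (b i) (ω r)) := fun i => by
    refine (((innerSL ℝ (b i)).integral_comp_comm hi2).symm).trans ?_
    rw [scalarOU, ← integral_const_mul, integral_Iic_eq_integral_Iio, integral_Iic_eq_integral_Iio]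
    refine setIntegral_congr_fun measurableSet_Iio fun q (hq : q < 0) => ?_
    have h1 := hR.coord (-q) (neg_pos.2 hq) (ω q) i
    rw [neg_mul_neg, mul_assoc] at h1
    exact h1
  obtain ⟨h1, h2⟩ := hD.opApply_eq (x := ∫ q in Iic (0 : ℝ), semigroup B (-q) (ω q))
    (y := ∫ q in Iic (0 : ℝ), R (-q) (ω q)) fun i => by rw [hcx, hcy, scalarOU]
  refine ⟨⟨hi, h1⟩, fun i => ⟨?_, ?_⟩⟩
  · rw [MixedEvolution.ouZ, h2, hcy]
  · refine (((innerSL ℝ (b i)).integrable_comp hi)).congr ?_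
    refine (ae_restrict_iff' measurableSet_Iic).2 (Eventually.of_forall fun q (hq : q ≤ 0) => ?_)
    have h1 := hD.semigroup_coord (neg_nonneg.2 hq) (ω q) i
    rw [neg_mul_neg] at h1
    exact h1

theorem IsGeneratorComp.ouZ_shift (hR : IsGeneratorComp B b lam c R) (hD : IsDiagonal B b lam c)
    (hω : MemΩ₂ p ω) (hsub : Subexponential ω) (hp : 0 < p) (t : ℝ) :
    OuZExists B (shift t ω) ∧ ∀ i, inner ℝ (b i) (MixedEvolution.ouZ B (shift t ω)) =
        scalarOU (lam i) (fun r => inner ℝ (b i) (shift t ω r)) ∧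
      IntegrableOn (fun q => Real.exp (lam i * q) * inner ℝ (b i) (shift t ω q)) (Iic 0) := by
  have hωc := hω.1
  have hω' : Continuous (shift t ω) := by unfold shift; fun_prop
  have hc := hD.pos
  obtain ⟨C, hC⟩ := hω.2.2 (t - 1) t (by linarith)
  obtain ⟨M, hM⟩ := hsub.exists_norm_le hωc (k := c / 4) (by linarith) t
  refine hR.ouZ (M := M * Real.exp (-(c / 4) * t) + ‖ω t‖) hD hω' hp (C := C)
    (fun q hq hq0 => ?_) fun q hq => ?_
  · have h1 := hC (q + t) t (by linarith) (by linarith) le_rfl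
    rw [norm_sub_rev] at h1
    simpa [shift] using h1
  · have h1 := hM (q + t) (by linarith)
    have h2 : 1 ≤ Real.exp (-(c / 4) * q) := Real.one_le_exp (by nlinarith)
    calc ‖shift t ω q‖ ≤ ‖ω (q + t)‖ + ‖ω t‖ := norm_sub_le _ _
      _ ≤ M * Real.exp (-(c / 4) * (q + t)) + ‖ω t‖ * Real.exp (-(c / 4) * q) :=
          add_le_add h1 (le_mul_of_one_le_right (norm_nonneg _) h2)
      _ = _ := by
          rw [mul_add, Real.exp_add]
          ring

/-- The stochastic convolution is the stationary Ornstein-Uhlenbeck process started at `0`. -/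
theorem IsGeneratorComp.stochConv_eq_ouZ (hR : IsGeneratorComp B b lam c R)
    (hD : IsDiagonal B b lam c) (hω : MemΩ₂ p ω) (hsub : Subexponential ω) (hp : 0 < p) {t : ℝ}
    (ht : 0 ≤ t) : MixedEvolution.stochConv B ω t =
      MixedEvolution.ouZ B (shift t ω) - semigroup B t (MixedEvolution.ouZ B ω) := by
  have hωc := hω.1
  obtain ⟨C, hC⟩ := hω.2.2 0 (t + 1) (by linarith)
  have h0 : shift 0 ω = ω := by
    funext s
    simp [shift, hω.2.1]
  refine ext_coord b fun i => ?_
  have h1 := (hR.ouZ_shift hD hω hsub hp 0).2 i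
  rw [h0] at h1
  rw [inner_sub_right, hD.semigroup_coord ht, h1.1, ((hR.ouZ_shift hD hω hsub hp t).2 i).1,
    (hR.stochConv hD hωc ht hp fun r h1 h2 => hC r t h1 h2 (by linarith)).2.2,
    scalarConv_eq_scalarOU (hD.lam_pos i) (by fun_prop) h1.2]
  simp only [shift, inner_sub_right]

end Convolution

/-! ### Block diagonal operators -/

section Reduction

variable {E V : Type*} [NormedAddCommGroup E] [InnerProductSpace ℝ E]
  [NormedAddCommGroup V] [InnerProductSpace ℝ V] {L : E →ₗ.[ℝ] E} {M : V →ₗ.[ℝ] V}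

/-- The structural assumptions pass to the part of an operator in a complemented subspace that
reduces it: `j` embeds the subspace and `π` projects onto it. -/
theorem IsNegWithCompactInverse.of_reducing (hL : IsNegWithCompactInverse L) (j : V →ₗᵢ[ℝ] E)
    (π : E →L[ℝ] V) (hπ : ∀ x, π (j x) = x)
    (hj : ∀ x y, (x, y) ∈ M.graph ↔ (j x, j y) ∈ L.graph)
    (hπL : ∀ p q, (p, q) ∈ L.graph → (π p, π q) ∈ M.graph) : IsNegWithCompactInverse M := by
  have hdom : ∀ x : M.domain, ∃ h : j x ∈ L.domain, L ⟨j x, h⟩ = j (M x) := fun x => by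
    obtain ⟨z, hz1, hz2⟩ := (LinearPMap.mem_graph_iff L).1 ((hj _ _).1 (M.mem_graph x))
    simp only at hz1 hz2
    refine ⟨hz1 ▸ z.2, ?_⟩
    rw [← hz2]
    congr 1
    exact Subtype.ext hz1.symm
  refine ⟨?_, ?_, fun x y => ?_, fun x hx => ?_, ?_⟩
  · have hs : Function.Surjective π := fun x => ⟨j x, hπ x⟩
    refine (hs.denseRange.dense_image π.continuous hL.dense).mono ?_
    rintro _ ⟨p, hp, rfl⟩
    exact LinearPMap.mem_domain_of_mem_graph (hπL _ _ (L.mem_graph ⟨p, hp⟩))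
  · have h1 : (M.graph : Set (V × V)) = Prod.map j j ⁻¹' (L.graph : Set (E × E)) := by
      ext ⟨x, y⟩
      exact hj x y
    rw [LinearPMap.IsClosed, h1]
    exact IsClosed.preimage (j.continuous.prodMap j.continuous) hL.closed
  · obtain ⟨hx, hx'⟩ := hdom x
    obtain ⟨hy, hy'⟩ := hdom y
    have h1 := hL.symm ⟨j x, hx⟩ ⟨j y, hy⟩
    rwa [hx', hy', j.inner_map_map, j.inner_map_map] at h1
  · obtain ⟨hx', hx''⟩ := hdom x
    have h1 := hL.pos ⟨j x, hx'⟩ (fun h => hx (j.injective (h.trans (map_zero j).symm)))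
    rwa [hx'', ← map_neg, j.inner_map_map] at h1
  · obtain ⟨K, hK, hKr, hKl⟩ := hL.compact_inv
    refine ⟨π ∘L K ∘L j.toContinuousLinearMap,
      (hK.comp_clm j.toContinuousLinearMap).clm_comp π, fun y => ?_, fun x => ?_⟩
    · obtain ⟨hy, hy'⟩ := hKr (j y)
      have h1 := hπL _ _ (L.mem_graph ⟨K (j y), hy⟩)
      rw [← neg_neg (L ⟨K (j y), hy⟩), hy', map_neg, hπ] at h1
      obtain ⟨z, hz1, hz2⟩ := (LinearPMap.mem_graph_iff M).1 h1
      simp only at hz1 hz2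
      have hz : π (K (j y)) ∈ M.domain := hz1 ▸ z.2
      refine ⟨hz, ?_⟩
      rw [neg_eq_iff_eq_neg, ← hz2]
      congr 1
      exact Subtype.ext hz1.symm
    · obtain ⟨hx, hx'⟩ := hdom x
      have h1 := hKl ⟨j x, hx⟩
      rw [hx', ← map_neg] at h1
      change π (K (j (-M x))) = x
      rw [h1, hπ]

/-- The semigroup of the part of an operator in a reducing subspace is the restriction of the
semigroup. -/
theorem IsDiagonal.semigroup_apply_embed [CompleteSpace E] [CompleteSpace V] {ι ι' : Type*}
    {b : HilbertBasis ι ℝ V} {lam : ι → ℝ} {c : ℝ} (hM : IsDiagonal M b lam c)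
    {b' : HilbertBasis ι' ℝ E} {lam' : ι' → ℝ} {c' : ℝ} (hL : IsDiagonal L b' lam' c')
    (j : V →ₗᵢ[ℝ] E) (hj : ∀ x y, (x, y) ∈ M.graph ↔ (j x, j y) ∈ L.graph) {t : ℝ} (ht : 0 ≤ t)
    (x : V) : semigroup L t (j x) = j (semigroup M t x) := by
  have h1 : semigroup L t ∘L j.toContinuousLinearMap = j.toContinuousLinearMap ∘L semigroup M t := by
    refine ContinuousLinearMap.ext_on (s := range b) ?_ ?_
    · have := b.dense_span
      rw [Submodule.dense_iff_topologicalClosure_eq_top]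
      exact this
    · rintro _ ⟨i, rfl⟩
      have h2 := hM.eigenvector_mem_graph i
      have h3 := (hj _ _).1 h2
      rw [map_smul] at h3
      change semigroup L t (j (b i)) = j (semigroup M t (b i))
      rw [hM.generates_semigroup.apply_eigenvector h2 ht,
        hL.generates_semigroup.apply_eigenvector h3 ht, map_smul]
  exact DFunLike.congr_fun h1 x

end Reduction

section Block

variable {V : Type*} [NormedAddCommGroup V] [InnerProductSpace ℝ V] {A B : V →ₗ.[ℝ] V}

/-- The embedding of the first component. -/
def embFst (V : Type*) [NormedAddCommGroup V] [InnerProductSpace ℝ V] :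
    V →ₗᵢ[ℝ] WithLp 2 (V × V) where
  toFun x := WithLp.toLp 2 (x, 0)
  map_add' x y := by rw [← WithLp.toLp_add, Prod.mk_add_mk, add_zero]
  map_smul' c x := by rw [RingHom.id_apply, ← WithLp.toLp_smul, Prod.smul_mk, smul_zero]
  norm_map' x := WithLp.norm_toLp_fst 2 V V x

/-- The embedding of the second component. -/
def embSnd (V : Type*) [NormedAddCommGroup V] [InnerProductSpace ℝ V] :
    V →ₗᵢ[ℝ] WithLp 2 (V × V) where
  toFun x := WithLp.toLp 2 (0, x)
  map_add' x y := by rw [← WithLp.toLp_add, Prod.mk_add_mk, add_zero]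
  map_smul' c x := by rw [RingHom.id_apply, ← WithLp.toLp_smul, Prod.smul_mk, smul_zero]
  norm_map' x := WithLp.norm_toLp_snd 2 V V x

theorem embFst_add_embSnd (x y : V) : embFst V x + embSnd V y = WithLp.toLp 2 (x, y) := by
  change WithLp.toLp 2 (x, 0) + WithLp.toLp 2 (0, y) = _
  rw [← WithLp.toLp_add, Prod.mk_add_mk, add_zero, zero_add]

theorem mem_graph_blockDiag (p q : WithLp 2 (V × V)) :
    (p, q) ∈ (blockDiag A B).graph ↔ (p.fst, q.fst) ∈ A.graph ∧ (p.snd, q.snd) ∈ B.graph := by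
  simp only [LinearPMap.mem_graph_iff]
  constructor
  · rintro ⟨z, hz1, hz2⟩
    subst hz1 hz2
    exact ⟨⟨⟨_, z.2.1⟩, rfl, rfl⟩, ⟨⟨_, z.2.2⟩, rfl, rfl⟩⟩
  · rintro ⟨⟨x, hx1, hx2⟩, y, hy1, hy2⟩
    refine ⟨⟨p, by rw [← hx1]; exact x.2, by rw [← hy1]; exact y.2⟩, rfl, ?_⟩
    have h1 : x = ⟨p.fst, by rw [← hx1]; exact x.2⟩ := Subtype.ext hx1
    have h2 : y = ⟨p.snd, by rw [← hy1]; exact y.2⟩ := Subtype.ext hy1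
    change WithLp.toLp 2 (A ⟨p.fst, _⟩, B ⟨p.snd, _⟩) = q
    rw [← h1, ← h2, hx2, hy2]
    rfl

theorem mem_graph_embFst (x y : V) :
    (x, y) ∈ A.graph ↔ (embFst V x, embFst V y) ∈ (blockDiag A B).graph := by
  rw [mem_graph_blockDiag]
  exact (and_iff_left B.graph.zero_mem).symm

theorem mem_graph_embSnd (x y : V) :
    (x, y) ∈ B.graph ↔ (embSnd V x, embSnd V y) ∈ (blockDiag A B).graph := by
  rw [mem_graph_blockDiag]
  exact (and_iff_right A.graph.zero_mem).symm

theorem IsNegWithCompactInverse.fst (h : IsNegWithCompactInverse (blockDiag A B)) :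
    IsNegWithCompactInverse A :=
  h.of_reducing (embFst V) (WithLp.fstL 2 ℝ V V) (fun _ => rfl) mem_graph_embFst
    fun p q hpq => ((mem_graph_blockDiag p q).1 hpq).1

theorem IsNegWithCompactInverse.snd (h : IsNegWithCompactInverse (blockDiag A B)) :
    IsNegWithCompactInverse B :=
  h.of_reducing (embSnd V) (WithLp.sndL 2 ℝ V V) (fun _ => rfl) mem_graph_embSnd
    fun p q hpq => ((mem_graph_blockDiag p q).1 hpq).2

/-- The semigroup of `diag(A, B)` is `diag(S_A, S_B)`. -/
theorem semigroup_blockDiag [CompleteSpace V] (h : IsNegWithCompactInverse (blockDiag A B)) {t : ℝ}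
    (ht : 0 ≤ t) (p : WithLp 2 (V × V)) :
    semigroup (blockDiag A B) t p =
      WithLp.toLp 2 (semigroup A t p.fst, semigroup B t p.snd) := by
  obtain ⟨_, _, _, _, hJ⟩ := h.exists_isDiagonal
  obtain ⟨_, _, _, _, hA⟩ := h.fst.exists_isDiagonal
  obtain ⟨_, _, _, _, hB⟩ := h.snd.exists_isDiagonal
  have e : p = embFst V p.fst + embSnd V p.snd := (embFst_add_embSnd _ _).symm
  conv_lhs => rw [e]
  rw [map_add, hA.semigroup_apply_embed hJ (embFst V) mem_graph_embFst ht,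
    hB.semigroup_apply_embed hJ (embSnd V) mem_graph_embSnd ht, embFst_add_embSnd]

end Block

/-! ### Fixed points in the weighted spaces -/

section FixedPoint

variable {E : Type*} [NormedAddCommGroup E] {γ T ρ K : ℝ} {u v : ℝ → E}

theorem WeightedBound.sub {K' : ℝ} (hu : WeightedBound γ T ρ K u) (hv : WeightedBound γ T ρ K' v) :
    WeightedBound γ T ρ (K + K') fun t => u t - v t := by
  refine ⟨fun t h0 hT => (_root_.norm_sub_le _ _).trans ?_, fun s t h0 hst hT => ?_⟩
  · rw [add_mul]
    exact add_le_add (hu.norm_le t h0 hT) (hv.norm_le t h0 hT)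
  · rw [sub_sub_sub_comm, add_mul, add_mul]
    exact (_root_.norm_sub_le _ _).trans
      (add_le_add (hu.norm_sub_le s t h0 hst hT) (hv.norm_sub_le s t h0 hst hT))

/-- The norms for different weights are equivalent on the bounded interval `[0, T]`; see also
`WeightedBound.unweight`. -/
theorem WeightedBound.of_unweighted (h : WeightedBound γ T 0 K u) (hρ : 0 ≤ ρ) (hT : 0 ≤ T) :
    WeightedBound γ T ρ K u := by
  have hK := h.const_nonneg hT
  have h1 : ∀ t, 0 ≤ t → K * Real.exp (0 * t) ≤ K * Real.exp (ρ * t) := fun t ht =>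
    mul_le_mul_of_nonneg_left (Real.exp_le_exp.2 (mul_le_mul_of_nonneg_right hρ ht)) hK
  refine ⟨fun t ht0 ht => (h.norm_le t ht0 ht).trans (h1 t ht0), fun s t hs hst ht =>
    (h.norm_sub_le s t hs hst ht).trans ?_⟩
  have h2 : 0 < t - s := sub_pos.2 hst
  exact mul_le_mul_of_nonneg_right (h1 t (hs.trans hst).le) (by positivity)

theorem WeightedBound.unweight (h : WeightedBound γ T ρ K u) (hρ : 0 ≤ ρ) (hT : 0 ≤ T) :
    WeightedBound γ T 0 (K * Real.exp (ρ * T)) u := by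
  have hK := h.const_nonneg hT
  have h1 : ∀ t, t ≤ T → K * Real.exp (ρ * t) ≤ K * Real.exp (ρ * T) * Real.exp (0 * t) :=
    fun t ht => by
      rw [zero_mul, Real.exp_zero, mul_one]
      exact mul_le_mul_of_nonneg_left (Real.exp_le_exp.2 (mul_le_mul_of_nonneg_left ht hρ)) hK
  refine ⟨fun t ht0 ht => (h.norm_le t ht0 ht).trans (h1 t ht), fun s t hs hst ht =>
    (h.norm_sub_le s t hs hst ht).trans ?_⟩
  have h2 : 0 < t - s := sub_pos.2 hst
  exact mul_le_mul_of_nonneg_right (h1 t ht) (by positivity)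

theorem WeightedBound.of_tendsto {f : ℕ → ℝ → E} (h : ∀ n, WeightedBound γ T ρ K (f n))
    (hf : ∀ t ∈ Icc 0 T, Tendsto (fun n => f n t) atTop (𝓝 (u t))) : WeightedBound γ T ρ K u := by
  refine ⟨fun t ht0 ht => ?_, fun s t hs hst ht => ?_⟩
  · exact le_of_tendsto' (hf t ⟨ht0, ht⟩).norm fun n => (h n).norm_le t ht0 ht
  · exact le_of_tendsto' ((hf t ⟨(hs.trans hst).le, ht⟩).sub (hf s ⟨hs.le, hst.le.trans ht⟩)).norm
      fun n => (h n).norm_sub_le s t hs hst ht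

theorem WeightedBound.eqOn_zero
    (h : ∀ n : ℕ, WeightedBound γ T ρ ((1 / 2) ^ n * K) u) : ∀ t ∈ Icc 0 T, u t = 0 := by
  intro t ht
  have h1 : Tendsto (fun n : ℕ => (1 / 2 : ℝ) ^ n * K * Real.exp (ρ * t)) atTop (𝓝 0) := by
    have h2 := ((tendsto_pow_atTop_nhds_zero_of_lt_one (by norm_num : (0 : ℝ) ≤ 1 / 2)
      (by norm_num)).mul_const K).mul_const (Real.exp (ρ * t))
    simpa using h2
  exact norm_le_zero_iff.1 (ge_of_tendsto' h1 fun n => (h n).norm_le t ht.1 ht.2)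

theorem exists_weight {ε C : ℝ} (hε : 0 < ε) : ∃ ρ : ℝ, 1 ≤ ρ ∧ C * ρ ^ (-ε) ≤ 1 / 2 := by
  have h1 := (tendsto_rpow_neg_atTop hε).const_mul C
  rw [mul_zero] at h1
  obtain ⟨ρ, h2, h3⟩ := ((h1.eventually (ge_mem_nhds (by norm_num : (0 : ℝ) < 1 / 2))).and
    (eventually_ge_atTop 1)).exists
  exact ⟨ρ, h3, h2⟩

/-- The estimates on a map of the weighted space that make Picard iteration work: the map grows
linearly, and it is Lipschitz on bounded sets, in both cases with a constant that becomes small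
when the weight `ρ` is large. -/
structure IsPicardMap (γ T ε : ℝ) (Θ : (ℝ → E) → ℝ → E) : Prop where
  continuousOn : ∀ u R, ContinuousOn u (Icc 0 T) → WeightedBound γ T 0 R u →
    ContinuousOn (Θ u) (Icc 0 T)
  growth : ∃ C₀ C, ∀ ρ M u, 1 ≤ ρ → ContinuousOn u (Icc 0 T) → WeightedBound γ T ρ M u →
    WeightedBound γ T ρ (C₀ + C * ρ ^ (-ε) * (1 + M)) (Θ u)
  lipschitz : ∀ R, ∃ C, ∀ ρ M u v, 1 ≤ ρ → ContinuousOn u (Icc 0 T) → ContinuousOn v (Icc 0 T) →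
    WeightedBound γ T 0 R u → WeightedBound γ T 0 R v →
    WeightedBound γ T ρ M (fun t => u t - v t) →
    WeightedBound γ T ρ (C * ρ ^ (-ε) * M) fun t => Θ u t - Θ v t

variable {ε : ℝ} {Θ : (ℝ → E) → ℝ → E}

/-- For a suitable weight the map halves distances within a given bounded set. -/
theorem IsPicardMap.exists_contraction (h : IsPicardMap γ T ε Θ) (hε : 0 < ε) (hT : 0 ≤ T) (R : ℝ) :
    ∃ ρ, 1 ≤ ρ ∧ ∀ M u v, ContinuousOn u (Icc 0 T) → ContinuousOn v (Icc 0 T) →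
      WeightedBound γ T 0 R u → WeightedBound γ T 0 R v →
      WeightedBound γ T ρ M (fun t => u t - v t) →
      WeightedBound γ T ρ (1 / 2 * M) fun t => Θ u t - Θ v t := by
  obtain ⟨C, hC⟩ := h.lipschitz R
  obtain ⟨ρ, hρ, hρ'⟩ := exists_weight (C := C) hε
  exact ⟨ρ, hρ, fun M u v hu hv hu' hv' huv => (hC ρ M u v hρ hu hv hu' hv' huv).mono
    (mul_le_mul_of_nonneg_right hρ' (huv.const_nonneg hT))⟩

/-- Two fixed points lie in a common bounded set, on which the map is a contraction for a suitable
weight. -/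
theorem IsPicardMap.eqOn (h : IsPicardMap γ T ε Θ) (hε : 0 < ε) (hT : 0 ≤ T)
    (hu : ContinuousOn u (Icc 0 T)) (hv : ContinuousOn v (Icc 0 T))
    (hu' : ∃ R, WeightedBound γ T 0 R u) (hv' : ∃ R, WeightedBound γ T 0 R v)
    (hfu : ∀ t ∈ Icc 0 T, u t = Θ u t) (hfv : ∀ t ∈ Icc 0 T, v t = Θ v t) :
    EqOn u v (Icc 0 T) := by
  obtain ⟨R₁, hu'⟩ := hu'
  obtain ⟨R₂, hv'⟩ := hv'
  obtain ⟨ρ, hρ, hc⟩ := h.exists_contraction hε hT (max R₁ R₂)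
  have hρ0 : 0 ≤ ρ := by linarith
  have h1 : ∀ n : ℕ, WeightedBound γ T ρ ((1 / 2) ^ n * (R₁ + R₂)) fun t => u t - v t := by
    intro n
    induction n with
    | zero =>
      rw [pow_zero, one_mul]
      exact (hu'.sub hv').of_unweighted hρ0 hT
    | succ n ih =>
      have h2 := hc _ u v hu hv (hu'.mono (le_max_left _ _)) (hv'.mono (le_max_right _ _)) ih
      rw [pow_succ', mul_assoc]
      refine h2.congr fun t ht => ?_
      rw [← hfu t ht, ← hfv t ht]
  intro t ht
  exact sub_eq_zero.1 (WeightedBound.eqOn_zero h1 t ht)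

theorem IsPicardMap.exists_fixedPoint [CompleteSpace E] (h : IsPicardMap γ T ε Θ) (hε : 0 < ε)
    (hT : 0 ≤ T) : ∃ u : ℝ → E, ContinuousOn u (Icc 0 T) ∧
      (∃ R, WeightedBound γ T 0 R u) ∧ ∀ t ∈ Icc 0 T, u t = Θ u t := by
  obtain ⟨C₀, C, hg⟩ := h.growth
  obtain ⟨ρ₁, hρ₁, hρ₁'⟩ := exists_weight (C := C) hε
  have hρ₁0 : 0 ≤ ρ₁ := by linarith
  have hC₀ : 0 ≤ 2 * |C₀| + 1 := by positivity
  -- the ball of radius `2 |C₀| + 1` for the weight `ρ₁` is invariant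
  have hball : ∀ u, ContinuousOn u (Icc 0 T) → WeightedBound γ T ρ₁ (2 * |C₀| + 1) u →
      WeightedBound γ T ρ₁ (2 * |C₀| + 1) (Θ u) := fun u hu hu' => by
    refine (hg ρ₁ _ u hρ₁ hu hu').mono ?_
    have h1 : C * ρ₁ ^ (-ε) * (1 + (2 * |C₀| + 1)) ≤ 1 / 2 * (1 + (2 * |C₀| + 1)) :=
      mul_le_mul_of_nonneg_right hρ₁' (by positivity)
    linarith [le_abs_self C₀]
  set R := (2 * |C₀| + 1) * Real.exp (ρ₁ * T) with hR
  obtain ⟨ρ, hρ, hc⟩ := h.exists_contraction hε hT R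
  have hρ0 : 0 ≤ ρ := by linarith
  set f : ℕ → ℝ → E := fun n => Θ^[n] fun _ => 0 with hf
  have hfs : ∀ n, f (n + 1) = Θ (f n) := fun n => Function.iterate_succ_apply' Θ n _
  have hfb : ∀ n, ContinuousOn (f n) (Icc 0 T) ∧ WeightedBound γ T ρ₁ (2 * |C₀| + 1) (f n) := by
    intro n
    induction n with
    | zero =>
      refine ⟨continuousOn_const, fun t ht0 ht => ?_, fun s t hs hst ht => ?_⟩
      · simp only [hf, Function.iterate_zero, id_eq, norm_zero]
        positivity
      · have : 0 < t - s := sub_pos.2 hst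
        simp only [hf, Function.iterate_zero, id_eq, sub_zero, norm_zero]
        positivity
    | succ n ih =>
      rw [hfs]
      exact ⟨h.continuousOn _ _ ih.1 (ih.2.unweight hρ₁0 hT), hball _ ih.1 ih.2⟩
  have hfR : ∀ n, WeightedBound γ T 0 R (f n) := fun n => (hfb n).2.unweight hρ₁0 hT
  have hdiff : ∀ n k : ℕ, WeightedBound γ T ρ ((1 / 2) ^ n * (R + R))
      fun t => f (n + k) t - f n t := by
    intro n
    induction n with
    | zero => 
      intro k
      rw [pow_zero, one_mul]
      exact ((hfR _).sub (hfR _)).of_unweighted hρ0 hT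
    | succ n ih =>
      intro k
      rw [pow_succ', mul_assoc, add_right_comm, hfs, hfs]
      exact hc _ _ _ (hfb _).1 (hfb _).1 (hfR _) (hfR _) (ih k)
  have hR0 : 0 ≤ R := by positivity
  have hnorm : ∀ t ∈ Icc 0 T, ∀ n k : ℕ, ‖f (n + k) t - f n t‖ ≤
      (1 / 2) ^ n * ((R + R) * Real.exp (ρ * T)) := fun t ht n k => by
    refine ((hdiff n k).norm_le t ht.1 ht.2).trans ?_
    rw [← mul_assoc]
    exact mul_le_mul_of_nonneg_left
      (Real.exp_le_exp.2 (mul_le_mul_of_nonneg_left ht.2 hρ0)) (by positivity)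
  have hlim0 : Tendsto (fun n : ℕ => (1 / 2 : ℝ) ^ n * ((R + R) * Real.exp (ρ * T))) atTop
      (𝓝 0) := by
    have h2 := (tendsto_pow_atTop_nhds_zero_of_lt_one (by norm_num : (0 : ℝ) ≤ 1 / 2)
      (by norm_num)).mul_const ((R + R) * Real.exp (ρ * T))
    simpa using h2
  have hex : ∀ t, ∃ x, t ∈ Icc 0 T → Tendsto (fun n => f n t) atTop (𝓝 x) := by
    intro t
    by_cases ht : t ∈ Icc 0 T
    · have hcau : CauchySeq fun n => f n t := by
        refine cauchySeq_of_le_tendsto_0' _ (fun n m hnm => ?_) hlim0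
        obtain ⟨k, rfl⟩ := Nat.exists_eq_add_of_le hnm
        rw [dist_comm, dist_eq_norm]
        exact hnorm t ht n k
      obtain ⟨x, hx⟩ := cauchySeq_tendsto_of_complete hcau
      exact ⟨x, fun _ => hx⟩
    · exact ⟨0, fun h => absurd h ht⟩
  choose u hu using hex
  have hub : WeightedBound γ T ρ₁ (2 * |C₀| + 1) u := .of_tendsto (fun n => (hfb n).2) hu
  have huR : WeightedBound γ T 0 R u := hub.unweight hρ₁0 hT
  have hud : ∀ n, WeightedBound γ T ρ ((1 / 2) ^ n * (R + R)) fun t => u t - f n t := fun n =>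
    .of_tendsto (fun k => hdiff n k) fun t ht => by
      refine Tendsto.sub_const ?_ _
      have h1 := (hu t ht).comp (tendsto_add_atTop_nat n)
      refine h1.congr fun k => ?_
      rw [Function.comp_apply, add_comm]
  have huc : ContinuousOn u (Icc 0 T) := by
    refine TendstoUniformlyOn.continuousOn (F := f) (p := atTop) ?_
      (Frequently.of_forall fun n => (hfb n).1)
    rw [Metric.tendstoUniformlyOn_iff]
    intro δ hδ
    filter_upwards [hlim0.eventually (gt_mem_nhds hδ)] with n hn t ht
    rw [dist_eq_norm]
    refine (((hud n).norm_le t ht.1 ht.2).trans ?_).trans_lt hn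
    rw [← mul_assoc]
    exact mul_le_mul_of_nonneg_left
      (Real.exp_le_exp.2 (mul_le_mul_of_nonneg_left ht.2 hρ0)) (by positivity)
  refine ⟨u, huc, ⟨R, huR⟩, fun t ht => ?_⟩
  have h1 : Tendsto (fun n => f (n + 1) t) atTop (𝓝 (u t)) :=
    (hu t ht).comp (tendsto_add_atTop_nat 1)
  have h2 : Tendsto (fun n => f (n + 1) t) atTop (𝓝 (Θ u t)) := by
    rw [tendsto_iff_norm_sub_tendsto_zero]
    refine squeeze_zero (fun n => norm_nonneg _) (fun n => ?_) hlim0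
    have h3 := (hc _ _ _ huc (hfb n).1 huR (hfR n) (hud n)).norm_le t ht.1 ht.2
    rw [hfs, norm_sub_rev]
    refine h3.trans ?_
    rw [mul_assoc, mul_assoc]
    have h4 : (R + R) * Real.exp (ρ * t) ≤ (R + R) * Real.exp (ρ * T) :=
      mul_le_mul_of_nonneg_left
        (Real.exp_le_exp.2 (mul_le_mul_of_nonneg_left ht.2 hρ0)) (by positivity)
    have h5 : 0 ≤ (1 / 2 : ℝ) ^ n * ((R + R) * Real.exp (ρ * t)) := by positivity
    have h6 : (1 / 2 : ℝ) ^ n * ((R + R) * Real.exp (ρ * t)) ≤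
      (1 / 2 : ℝ) ^ n * ((R + R) * Real.exp (ρ * T)) := mul_le_mul_of_nonneg_left h4 (by positivity)
    linarith
  exact tendsto_nhds_unique h1 h2

end FixedPoint

/-! ### The nonlinear coefficients -/

section Nonlinear

variable {E F : Type*} [NormedAddCommGroup E] [NormedAddCommGroup F] {γ T ρ K R M : ℝ}
  {u v : ℝ → E}

/-- Lipschitz maps act on the weighted spaces. -/
theorem WeightedBound.comp_lipschitz {g : E → F} {L : ℝ} (hL : 0 ≤ L)
    (hg : ∀ x y, ‖g x - g y‖ ≤ L * ‖x - y‖) (hu : WeightedBound γ T ρ K u) (hρ : 0 ≤ ρ) :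
    WeightedBound γ T ρ (‖g 0‖ + L * K) fun t => g (u t) := by
  refine ⟨fun t ht0 ht => ?_, fun s t hs hst ht => ?_⟩
  · have h1 := hg (u t) 0
    rw [sub_zero] at h1
    have h2 := mul_le_mul_of_nonneg_left (hu.norm_le t ht0 ht) hL
    have h3 : ‖g 0‖ ≤ ‖g 0‖ * Real.exp (ρ * t) :=
      le_mul_of_one_le_right (norm_nonneg _) (Real.one_le_exp (mul_nonneg hρ ht0))
    have h4 := norm_le_norm_add_norm_sub' (g (u t)) (g 0)
    linarith
  · have h1 := (hg (u t) (u s)).trans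
      (mul_le_mul_of_nonneg_left (hu.norm_sub_le s t hs hst ht) hL)
    have h2 : 0 < t - s := sub_pos.2 hst
    have h3 : 0 ≤ ‖g 0‖ * Real.exp (ρ * t) * (s ^ (-γ) * (t - s) ^ γ) := by positivity
    refine h1.trans ?_
    linarith

variable [NormedSpace ℝ E] [NormedSpace ℝ F] {h : E → F} {L₁ L₂ : ℝ}

theorem norm_sub_le_of_norm_fderiv_le {g : E → F} {L : ℝ} (hg : Differentiable ℝ g)
    (hL : ∀ x, ‖fderiv ℝ g x‖ ≤ L) (x y : E) : ‖g x - g y‖ ≤ L * ‖x - y‖ :=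
  convex_univ.norm_image_sub_le_of_norm_fderiv_le (fun z _ => hg z) (fun z _ => hL z)
    (mem_univ y) (mem_univ x)

/-- The second difference of a map with bounded first and second derivatives, from the mean value
inequality along the segments `y + θ (x - y)` and `y' + θ (x' - y')`. -/
theorem norm_sub_sub_sub_le_of_fderiv (hh₁ : Differentiable ℝ h)
    (hh₂ : Differentiable ℝ (fderiv ℝ h)) (hL₁ : ∀ x, ‖fderiv ℝ h x‖ ≤ L₁)
    (hL₂ : ∀ x, ‖fderiv ℝ (fderiv ℝ h) x‖ ≤ L₂) {x y x' y' : E} {D : ℝ} (hx : ‖x - x'‖ ≤ D)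
    (hy : ‖y - y'‖ ≤ D) :
    ‖h x - h y - (h x' - h y')‖ ≤ L₁ * ‖x - y - (x' - y')‖ + L₂ * D * ‖x' - y'‖ := by
  have hL₂0 : 0 ≤ L₂ := (norm_nonneg (fderiv ℝ (fderiv ℝ h) 0)).trans (hL₂ 0)
  have hseg : ∀ (a w : E) (θ : ℝ), HasDerivAt (fun θ : ℝ => h (a + θ • w))
      (fderiv ℝ h (a + θ • w) w) θ := fun a w θ => by
    have h1 : HasDerivAt (fun θ : ℝ => a + θ • w) w θ := by
      simpa using ((hasDerivAt_id θ).smul_const w).const_add a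
    exact (hh₁ (a + θ • w)).hasFDerivAt.comp_hasDerivAt θ h1
  have h1 := norm_image_sub_le_of_norm_deriv_le_segment_01'
    (f := fun θ : ℝ => h (y + θ • (x - y)) - h (y' + θ • (x' - y')))
    (f' := fun θ => fderiv ℝ h (y + θ • (x - y)) (x - y) -
      fderiv ℝ h (y' + θ • (x' - y')) (x' - y'))
    (C := L₁ * ‖x - y - (x' - y')‖ + L₂ * D * ‖x' - y'‖)
    (fun θ _ => ((hseg y (x - y) θ).sub (hseg y' (x' - y') θ)).hasDerivWithinAt) fun θ hθ => by
      set p := y + θ • (x - y) with hp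
      set p' := y' + θ • (x' - y') with hp'
      have e1 : fderiv ℝ h p (x - y) - fderiv ℝ h p' (x' - y') =
          fderiv ℝ h p (x - y - (x' - y')) + (fderiv ℝ h p - fderiv ℝ h p') (x' - y') := by
        rw [sub_apply, map_sub (fderiv ℝ h p) (x - y) (x' - y')]
        abel
      have e2 : p - p' = (1 - θ) • (y - y') + θ • (x - x') := by
        rw [hp, hp']
        module
      have h2 : ‖p - p'‖ ≤ D := by
        rw [e2]
        refine (norm_add_le _ _).trans ?_
        rw [norm_smul, norm_smul, Real.norm_of_nonneg hθ.1,
          Real.norm_of_nonneg (by linarith [hθ.2])]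
        have := mul_le_mul_of_nonneg_left hx hθ.1
        have := mul_le_mul_of_nonneg_left hy (sub_nonneg.2 hθ.2.le)
        linarith
      have h3 : ‖fderiv ℝ h p - fderiv ℝ h p'‖ ≤ L₂ * D :=
        (norm_sub_le_of_norm_fderiv_le hh₂ hL₂ p p').trans (mul_le_mul_of_nonneg_left h2 hL₂0)
      rw [e1]
      refine (norm_add_le _ _).trans (add_le_add ?_ ?_)
      · exact ((fderiv ℝ h p).le_opNorm _).trans
          (mul_le_mul_of_nonneg_right (hL₁ p) (norm_nonneg _))
      · exact ((fderiv ℝ h p - fderiv ℝ h p').le_opNorm _).trans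
          (mul_le_mul_of_nonneg_right h3 (norm_nonneg _))
  simp only [one_smul, zero_smul, add_zero, add_sub_cancel] at h1
  have e3 : h x - h y - (h x' - h y') = h x - h x' - (h y - h y') := by abel
  rwa [e3]

/-- Superposition with a map with bounded first and second derivatives is Lipschitz on bounded
sets of the weighted space. -/
theorem WeightedBound.comp_sub_comp (hh₁ : Differentiable ℝ h)
    (hh₂ : Differentiable ℝ (fderiv ℝ h)) (hL₁ : ∀ x, ‖fderiv ℝ h x‖ ≤ L₁)
    (hL₂ : ∀ x, ‖fderiv ℝ (fderiv ℝ h) x‖ ≤ L₂) (hT : 0 ≤ T) (hρ : 0 ≤ ρ)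
    (hu : WeightedBound γ T 0 R u) (hv : WeightedBound γ T 0 R v)
    (huv : WeightedBound γ T ρ M fun t => u t - v t) :
    WeightedBound γ T ρ ((L₁ + L₂ * R) * M) fun t => h (u t) - h (v t) := by
  have hM := huv.const_nonneg hT
  have hR := hu.const_nonneg hT
  have hL₁0 : 0 ≤ L₁ := (norm_nonneg _).trans (hL₁ 0)
  have hL₂0 : 0 ≤ L₂ := (norm_nonneg (fderiv ℝ (fderiv ℝ h) 0)).trans (hL₂ 0)
  refine ⟨fun t ht0 ht => ?_, fun s t hs hst ht => ?_⟩
  · refine (norm_sub_le_of_norm_fderiv_le hh₁ hL₁ _ _).trans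
      ((mul_le_mul_of_nonneg_left (huv.norm_le t ht0 ht) hL₁0).trans ?_)
    have : 0 ≤ L₂ * R * M * Real.exp (ρ * t) := by positivity
    linarith
  · have hts : 0 < t - s := sub_pos.2 hst
    have h1 := hu.norm_sub_le s t hs hst ht
    have h2 := hv.norm_sub_le s t hs hst ht
    rw [zero_mul, Real.exp_zero, mul_one] at h1 h2
    have h3 : ‖u s - v s‖ ≤ M * Real.exp (ρ * t) :=
      (huv.norm_le s hs.le (hst.le.trans ht)).trans (mul_le_mul_of_nonneg_left
        (Real.exp_le_exp.2 (mul_le_mul_of_nonneg_left hst.le hρ)) hM)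
    refine (norm_sub_sub_sub_le_of_fderiv hh₁ hh₂ hL₁ hL₂ h1 h2).trans ?_
    have h4 := mul_le_mul_of_nonneg_left (huv.norm_sub_le s t hs hst ht) hL₁0
    have h5 : L₂ * (R * (s ^ (-γ) * (t - s) ^ γ)) * ‖u s - v s‖ ≤
        L₂ * (R * (s ^ (-γ) * (t - s) ^ γ)) * (M * Real.exp (ρ * t)) :=
      mul_le_mul_of_nonneg_left h3 (by positivity)
    linarith

theorem WeightedBound.map_isometry (j : E →ₗᵢ[ℝ] F) (hu : WeightedBound γ T ρ K u) :
    WeightedBound γ T ρ K fun t => j (u t) := by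
  refine ⟨fun t ht0 ht => ?_, fun s t hs hst ht => ?_⟩
  · rw [j.norm_map]
    exact hu.norm_le t ht0 ht
  · rw [← map_sub, j.norm_map]
    exact hu.norm_sub_le s t hs hst ht

theorem WeightedBound.fst {V : Type*} [NormedAddCommGroup V] {u : ℝ → WithLp 2 (V × V)}
    (hu : WeightedBound γ T ρ K u) : WeightedBound γ T ρ K fun t => (u t).fst :=
  ⟨fun t ht0 ht => (WithLp.norm_fst_le _ _ ).trans (hu.norm_le t ht0 ht), fun s t hs hst ht =>
    (WithLp.norm_fst_le _ (u t - u s)).trans (hu.norm_sub_le s t hs hst ht)⟩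

end Nonlinear

/-! ### The fixed point map of the mild equation -/

theorem bochnerConv_sub_eq {E : Type*} [NormedAddCommGroup E] [NormedSpace ℝ E]
    {S : ℝ → E →L[ℝ] E} {T : ℝ} {f f' : ℝ → E} (hS : IsSmoothing S)
    (hf : ContinuousOn f (Icc 0 T)) (hf' : ContinuousOn f' (Icc 0 T)) {t : ℝ} (ht : t ∈ Icc 0 T) :
    bochnerConv S (fun r => f r - f' r) t = bochnerConv S f t - bochnerConv S f' t := by
  simp only [bochnerConv, map_sub]
  exact intervalIntegral.integral_sub (intervalIntegrable_conv hS hf ht.1 le_rfl ht.2)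
    (intervalIntegrable_conv hS hf' ht.1 le_rfl ht.2)

theorem continuous_fst_withLp {V : Type*} [NormedAddCommGroup V] [InnerProductSpace ℝ V] :
    Continuous fun p : WithLp 2 (V × V) => p.fst :=
  (WithLp.fstL 2 ℝ V V).continuous

section MildMap

variable {V : Type*} [NormedAddCommGroup V] [InnerProductSpace ℝ V] [CompleteSpace V]
  {S : ℝ → WithLp 2 (V × V) →L[ℝ] WithLp 2 (V × V)} {S' : ℝ → V →L[ℝ] V}
  {F : WithLp 2 (V × V) → WithLp 2 (V × V)} {h : V → HS V} {ω g : ℝ → V} {u₀ : WithLp 2 (V × V)}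
  {α β γ η ε T C Kg L L₁ L₂ : ℝ}

/-- The right-hand side of the mild equation as a function of the unknown `u`. The semigroups `S`
and `S'`, the stochastic convolution `g` and the noise `ω` are given. -/
def mildMap (α : ℝ) (S : ℝ → WithLp 2 (V × V) →L[ℝ] WithLp 2 (V × V)) (S' : ℝ → V →L[ℝ] V)
    (F : WithLp 2 (V × V) → WithLp 2 (V × V)) (h : V → HS V) (ω g : ℝ → V)
    (u₀ : WithLp 2 (V × V)) (u : ℝ → WithLp 2 (V × V)) (t : ℝ) : WithLp 2 (V × V) :=
  S t u₀ + bochnerConv S (fun r => F (u r)) t +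
    WithLp.toLp 2 (zahleConv α S' (fun r => h (u r).fst) ω t, g t)

theorem mildMap_eq (u : ℝ → WithLp 2 (V × V)) (t : ℝ) : mildMap α S S' F h ω g u₀ u t =
    S t u₀ + embSnd V (g t) + (bochnerConv S (fun r => F (u r)) t +
      embFst V (zahleConv α S' (fun r => h (u r).fst) ω t)) := by
  rw [mildMap, ← embFst_add_embSnd]
  abel

theorem zahleConv_sub_eq {Ψ Φ : ℝ → HS V} {K K' : ℝ} (he : ConvExponents α β γ η ε)
    (hS : IsSmoothing S') (hω : HolderLine β C ω) (hΨ : WeightedBound γ T 1 K Ψ)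
    (hΨc : ContinuousOn Ψ (Icc 0 T)) (hΦ : WeightedBound γ T 1 K' Φ)
    (hΦc : ContinuousOn Φ (Icc 0 T)) {t : ℝ} (ht : t ∈ Icc 0 T) :
    zahleConv α S' (fun r => Ψ r - Φ r) ω t = zahleConv α S' Ψ ω t - zahleConv α S' Φ ω t := by
  rcases ht.1.eq_or_lt with rfl | ht0
  · simp [zahleConv, zahleIntegral]
  · have hη0 := (he.α_pos.trans he.α_lt_η).le
    have e0 := he.exponents le_rfl (by linarith [he.γ_pos, he.ε_pos])
    have h1 := hΨ.admissible hΨc hS one_pos le_rfl zero_le_one hη0 he.η_lt_one.le ht0 ht.2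
    have h2 := hΦ.admissible hΦc hS one_pos le_rfl zero_le_one hη0 he.η_lt_one.le ht0 ht.2
    simp only [zahleConv, HS.comp_sub_right]
    exact h1.zahleIntegral_sub e0 e0 h2 hω ht.1

theorem zahleConvConst_nonneg (he : ConvExponents α β γ η ε) (hC : 0 ≤ C) (hT : 0 ≤ T) :
    0 ≤ zahleConvConst α β γ η ε C T := by
  have hz1 := (he.exponents he.ε_pos.le (by linarith [he.γ_pos])).zahleConst_nonneg
  have hz2 := (he.exponents (σ := γ + ε) (by linarith [he.γ_pos, he.ε_pos])
    le_rfl).zahleConst_nonneg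
  unfold zahleConvConst
  positivity

theorem bochnerConvConst_nonneg (hγ : 0 ≤ γ) (hγε : γ + ε < 1) (hT : 0 ≤ T) :
    0 ≤ bochnerConvConst γ ε T := by
  have c1 : 0 < (1 - ε)⁻¹ := inv_pos.2 (by linarith)
  have c2 : 0 < (1 - (γ + ε))⁻¹ := inv_pos.2 (by linarith)
  unfold bochnerConvConst
  positivity

/-- The right-hand side of the mild equation satisfies the estimates for Picard iteration. -/
theorem isPicardMap_mildMap (he : ConvExponents α β γ η ε) (hT : 0 < T) (hS : IsSmoothing S)
    (hS' : IsSmoothing S') (hω : HolderLine β C ω) (hg : WeightedBound γ T 0 Kg g)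
    (hgc : ContinuousOn g (Icc 0 T)) (hL : 0 ≤ L) (hF : ∀ x y, ‖F x - F y‖ ≤ L * ‖x - y‖)
    (hFc : Continuous F) (hh₁ : Differentiable ℝ h) (hh₂ : Differentiable ℝ (fderiv ℝ h))
    (hL₁ : ∀ x, ‖fderiv ℝ h x‖ ≤ L₁) (hL₂ : ∀ x, ‖fderiv ℝ (fderiv ℝ h) x‖ ≤ L₂) :
    IsPicardMap γ T ε (mildMap α S S' F h ω g u₀) := by
  have hL₁0 : 0 ≤ L₁ := (norm_nonneg _).trans (hL₁ 0)
  have hγε : γ + ε < 1 := he.add_lt'.trans he.β_lt_one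
  have hhl := norm_sub_le_of_norm_fderiv_le hh₁ hL₁
  have hcF : ∀ u : ℝ → WithLp 2 (V × V), ContinuousOn u (Icc 0 T) →
      ContinuousOn (fun r => F (u r)) (Icc 0 T) := fun u hu => hFc.comp_continuousOn hu
  have hch : ∀ u : ℝ → WithLp 2 (V × V), ContinuousOn u (Icc 0 T) →
      ContinuousOn (fun r => h (u r).fst) (Icc 0 T) := fun u hu =>
    hh₁.continuous.comp_continuousOn (continuous_fst_withLp.comp_continuousOn hu)
  have hbB := bochnerConvConst_nonneg he.γ_pos.le hγε hT.le
  have hbZ := zahleConvConst_nonneg he hω.1 hT.le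
  refine ⟨fun u R hu hR => ?_, ⟨‖u₀‖ + Kg, bochnerConvConst γ ε T * (‖F 0‖ + L) +
    zahleConvConst α β γ η ε C T * (‖h 0‖ + L₁), fun ρ M u hρ hu hM => ?_⟩, fun R =>
    ⟨bochnerConvConst γ ε T * L + zahleConvConst α β γ η ε C T * (L₁ + L₂ * R),
      fun ρ M u v hρ hu hv hur hvr huv => ?_⟩⟩
  · have h1 := (hR.of_unweighted zero_le_one hT.le).fst.comp_lipschitz hL₁0 hhl zero_le_one
    have h2 := h1.continuousOn_zahleConv he (hch u hu) hS' hω one_pos hT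
    refine ContinuousOn.congr ?_ fun t _ => mildMap_eq u t
    exact (((hS.continuousOn u₀).mono Icc_subset_Ici_self).add
      ((embSnd V).continuous.comp_continuousOn hgc)).add
      ((continuousOn_bochnerConv hS (hcF u hu) hT).add
        ((embFst V).continuous.comp_continuousOn h2))
  · have hρ0 : 0 < ρ := by linarith
    have hM0 := hM.const_nonneg hT.le
    have h1 := weightedBound_orbit (T := T) hS u₀ he.γ_pos.le he.γ_lt_one.le hρ0.le
    have h2 := (hg.of_unweighted hρ0.le hT.le).map_isometry (embSnd V)
    have h3 := weightedBound_bochnerConv hS (hcF u hu) (hM.comp_lipschitz hL hF hρ0.le).norm_le hρ0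
      he.ε_pos he.γ_pos hγε hT
    have h4 := ((hM.fst.comp_lipschitz hL₁0 hhl hρ0.le).zahleConv he (hch u hu) hS' hω hρ0
      hT).map_isometry (embFst V)
    refine ((h1.add h2).add (h3.add h4)).congr (fun t _ => mildMap_eq u t) |>.mono ?_
    have h5 : ‖F 0‖ + L * M ≤ (‖F 0‖ + L) * (1 + M) := by nlinarith [norm_nonneg (F 0)]
    have h6 : ‖h 0‖ + L₁ * M ≤ (‖h 0‖ + L₁) * (1 + M) := by nlinarith [norm_nonneg (h 0)]
    have h7 := mul_le_mul_of_nonneg_left h5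
      (mul_nonneg hbB (Real.rpow_nonneg hρ0.le (-ε)))
    have h8 := mul_le_mul_of_nonneg_left h6
      (mul_nonneg hbZ (Real.rpow_nonneg hρ0.le (-ε)))
    linarith
  · have hρ0 : 0 < ρ := by linarith
    have hFuv : ∀ t, 0 ≤ t → t ≤ T → ‖F (u t) - F (v t)‖ ≤ L * M * Real.exp (ρ * t) :=
      fun t ht0 ht => (hF _ _).trans
        ((mul_le_mul_of_nonneg_left (huv.norm_le t ht0 ht) hL).trans (mul_assoc _ _ _).ge)
    have h3 := weightedBound_bochnerConv hS ((hcF u hu).sub (hcF v hv)) hFuv hρ0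
      he.ε_pos he.γ_pos hγε hT
    have h4 := ((hur.fst.comp_sub_comp hh₁ hh₂ hL₁ hL₂ hT.le hρ0.le hvr.fst huv.fst).zahleConv he
      ((hch u hu).sub (hch v hv)) hS' hω hρ0 hT).map_isometry (embFst V)
    refine ((h3.add h4).congr fun t ht => ?_).mono (le_of_eq (by ring))
    have h5 := (hur.of_unweighted zero_le_one hT.le).fst.comp_lipschitz hL₁0 hhl zero_le_one
    have h6 := (hvr.of_unweighted zero_le_one hT.le).fst.comp_lipschitz hL₁0 hhl zero_le_one
    rw [mildMap_eq, mildMap_eq, zahleConv_sub_eq he hS' hω h5 (hch u hu) h6 (hch v hv) ht,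
      map_sub]
    have h7 := bochnerConv_sub_eq hS (hcF u hu) (hcF v hv) ht
    change _ = bochnerConv S (fun r => F (u r) - F (v r)) t + _
    rw [h7]
    abel

end MildMap

section Solutions

variable {V : Type*} [NormedAddCommGroup V] [InnerProductSpace ℝ V] [CompleteSpace V]
  {α β γ T : ℝ}

/-- Only the values of the path on `[a, b]` enter the pathwise integral over `(a, b)`. -/
theorem ZahleIntegrable.congr_path {a b : ℝ} {Ψ : ℝ → HS V} {ω ω' : ℝ → V}
    (h : ZahleIntegrable α a b Ψ ω) (hab : a ≤ b) (hω : ∀ r ∈ Icc a b, ω r = ω' r) :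
    ZahleIntegrable α a b Ψ ω' := by
  have hw : ∀ r ∈ Ioo a b, weylRight α b ω r = weylRight α b ω' r := fun r hr =>
    weylRight_congr hr.2.le fun s hs => hω s ⟨hr.1.le.trans hs.1, hs.2⟩
  have hae : ∀ {P Q : ℝ → Prop}, (∀ r ∈ Ioo a b, P r → Q r) →
      (∀ᵐ r ∂(volume.restrict (Ioo a b)), P r) → ∀ᵐ r ∂(volume.restrict (Ioo a b)), Q r :=
    fun hPQ hP => by
      filter_upwards [hP, ae_restrict_mem measurableSet_Ioo] with r h1 h2 using hPQ r h2 h1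
  refine ⟨?_, h.limit, h.left, hae (fun r hr h1 => ?_) h.right, ?_, ?_⟩
  · obtain ⟨p, p', h1, h2, h3, h4, h5, h6⟩ := h.frac
    refine ⟨p, p', h1, h2, h3, h4, h5, fun i => ?_⟩
    obtain ⟨φ, hφ, hφ'⟩ := h6 i
    refine ⟨φ, hφ, hae (fun r hr h7 => ?_) hφ'⟩
    rw [← h7]
    simp only [hω r ⟨hr.1.le, hr.2.le⟩, hω b ⟨hab, le_rfl⟩]
  · refine h1.congr fun q hq => ?_
    rw [uIoc_of_le hr.2.le] at hq
    simp only [weylRightKernel]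
    rw [hω r ⟨hr.1.le, hr.2.le⟩, hω q ⟨hr.1.le.trans hq.1.le, hq.2⟩]
  · rw [intervalIntegrable_iff_integrableOn_Ioo_of_le hab]
    refine IntegrableOn.congr_fun
      ((intervalIntegrable_iff_integrableOn_Ioo_of_le hab).1 h.norm_mul) (fun r hr => ?_)
      measurableSet_Ioo
    rw [hw r hr]
  · rw [intervalIntegrable_iff_integrableOn_Ioo_of_le hab]
    refine IntegrableOn.congr_fun
      ((intervalIntegrable_iff_integrableOn_Ioo_of_le hab).1 h.integrand) (fun r hr => ?_)
      measurableSet_Ioo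
    rw [hw r hr]

/-- The extension of a path on `[0, T]` that is constant on `(-∞, 0]` and on `[T, ∞)`. -/
def clampPath {E : Type*} (T : ℝ) (ω : ℝ → E) (s : ℝ) : E := ω (max 0 (min s T))

theorem clampPath_of_mem {E : Type*} {ω : ℝ → E} {s : ℝ} (hs : s ∈ Icc 0 T) :
    clampPath T ω s = ω s := by
  rw [clampPath, min_eq_left hs.2, max_eq_right hs.1]

theorem HolderOnIcc.exists_holderLine {E : Type*} [NormedAddCommGroup E] {ω : ℝ → E}
    (h : HolderOnIcc β 0 T ω) (hβ : 0 < β) (hT : 0 ≤ T) :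
    ∃ C, HolderLine β C (clampPath T ω) := by
  obtain ⟨C, hC⟩ := h
  refine ⟨max C 0, le_max_right _ _, fun s t hst => ?_⟩
  have h1 : max 0 (min s T) ≤ max 0 (min t T) := max_le_max_left 0 (min_le_min_right T hst)
  have h2 : max 0 (min t T) ≤ T := max_le hT (min_le_right _ _)
  have h3 : max 0 (min t T) - max 0 (min s T) ≤ t - s := by
    rcases le_total s T with h4 | h4 <;> rcases le_total t T with h5 | h5 <;>
      rcases le_total 0 s with h6 | h6 <;> rcases le_total 0 t with h7 | h7 <;>
      simp only [min_eq_left, min_eq_right, max_eq_left, max_eq_right, h4, h5, h6, h7, hT] <;>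
      linarith
  have h0 : 0 ≤ t - s := sub_nonneg.2 hst
  rcases h1.eq_or_lt with h4 | h4
  · rw [clampPath, clampPath, h4, sub_self, norm_zero]
    positivity
  · have h5 := hC _ _ (le_max_left _ _) h4 h2
    have h6 : (max 0 (min t T) - max 0 (min s T)) ^ β ≤ (t - s) ^ β :=
      Real.rpow_le_rpow (sub_pos.2 h4).le h3 hβ.le
    refine h5.trans ?_
    exact mul_le_mul (le_max_left _ _) h6 (Real.rpow_nonneg (sub_pos.2 h4).le _) (le_max_right _ _)

/-- The weighted Hölder space is the union of the balls described by `WeightedBound`. -/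
theorem memWeightedHolder_iff {E : Type*} [NormedAddCommGroup E] {u : ℝ → E} :
    MemWeightedHolder γ T u ↔ ContinuousOn u (Icc 0 T) ∧ ∃ K, WeightedBound γ T 0 K u := by
  refine ⟨fun ⟨hc, C, hC⟩ => ⟨hc, ?_⟩, fun ⟨hc, K, hK⟩ => ⟨hc, K, fun s t hs hst ht => ?_⟩⟩
  · obtain ⟨M, hM⟩ := isCompact_Icc.exists_bound_of_continuousOn hc
    refine ⟨max M C, fun t ht0 ht => ?_, fun s t hs hst ht => ?_⟩
    · rw [zero_mul, Real.exp_zero, mul_one]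
      exact (hM t ⟨ht0, ht⟩).trans (le_max_left _ _)
    · have hts : 0 < t - s := sub_pos.2 hst
      have h1 := hC s t hs hst ht
      rw [zero_mul, Real.exp_zero, mul_one]
      calc ‖u t - u s‖ = s ^ γ * (‖u t - u s‖ / (t - s) ^ γ) * (s ^ (-γ) * (t - s) ^ γ) := by
            rw [Real.rpow_neg hs.le]
            field_simp
        _ ≤ _ := mul_le_mul_of_nonneg_right (h1.trans (le_max_right _ _)) (by positivity)
  · have hts : 0 < t - s := sub_pos.2 hst
    have h1 := hK.norm_sub_le s t hs hst ht
    rw [zero_mul, Real.exp_zero, mul_one] at h1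
    calc s ^ γ * (‖u t - u s‖ / (t - s) ^ γ)
        ≤ s ^ γ * (K * (s ^ (-γ) * (t - s) ^ γ) / (t - s) ^ γ) := by gcongr
      _ = K := by
          rw [Real.rpow_neg hs.le]
          field_simp

end Solutions

/-! ### Mild solutions as fixed points -/

theorem intervalIntegrable_drift {V : Type*} [NormedAddCommGroup V] [InnerProductSpace ℝ V]
    {A B : V →ₗ.[ℝ] V} {F : WithLp 2 (V × V) → WithLp 2 (V × V)} {u : ℝ → WithLp 2 (V × V)} {γ T : ℝ}
    (hJ : IsSmoothing (semigroup (blockDiag A B))) (hF : Continuous F) (hu : MemWeightedHolder γ T u)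
    {t : ℝ} (ht : t ∈ Icc 0 T) :
    IntervalIntegrable (fun r => semigroup (blockDiag A B) (t - r) (F (u r))) volume 0 t :=
  intervalIntegrable_conv hJ (hF.comp_continuousOn hu.1) ht.1 le_rfl ht.2

section Mild

variable {V : Type*} [NormedAddCommGroup V] [InnerProductSpace ℝ V] [CompleteSpace V]
  {A B : V →ₗ.[ℝ] V} {F : WithLp 2 (V × V) → WithLp 2 (V × V)} {h : V → HS V} {ω₁ ω₂ : ℝ → V}
  {u₀ : WithLp 2 (V × V)} {u : ℝ → WithLp 2 (V × V)} {α β γ η ε T C L : ℝ}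

theorem zahleIntegrable_noiseIntegrand (he : ConvExponents α β γ η ε)
    (hA : IsSmoothing (semigroup A)) (hL : 0 ≤ L) (hhc : Continuous h)
    (hh : ∀ x y, ‖h x - h y‖ ≤ L * ‖x - y‖) (hω : HolderLine β C (clampPath T ω₁))
    (hu : MemWeightedHolder γ T u) {t : ℝ} (ht : t ∈ Ioc 0 T) :
    ZahleIntegrable α 0 t (noiseIntegrand A h u t) ω₁ := by
  obtain ⟨huc, K, hK⟩ := memWeightedHolder_iff.1 hu
  have hT : 0 ≤ T := ht.1.le.trans ht.2
  have hc : ContinuousOn (fun r => h (u r).fst) (Icc 0 T) :=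
    hhc.comp_continuousOn (continuous_fst_withLp.comp_continuousOn huc)
  have hb := (hK.of_unweighted zero_le_one hT).fst.comp_lipschitz hL hh zero_le_one
  have e0 := he.exponents le_rfl (by linarith [he.γ_pos, he.ε_pos])
  have had := hb.admissible hc hA one_pos le_rfl zero_le_one (he.α_pos.trans he.α_lt_η).le
    he.η_lt_one.le ht.1 ht.2
  refine (had.zahleIntegrable e0 he.η_lt_one he.β_lt_one hω ht.1 fun x y => ?_).congr_path ht.1.le
    fun r hr => clampPath_of_mem ⟨hr.1, hr.2.trans ht.2⟩
  -- the semigroup is norm continuous at the time `t > 0`, so the integrand is continuous at `0`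
  have h1 : ContinuousOn (fun r => HS.comp (semigroup A (t - r)) (h (u r).fst)) (Ico 0 t) :=
    HS.continuousOn_comp
      (hA.continuousOn_norm.comp (by fun_prop) fun r (hr : r ∈ Ico 0 t) => sub_pos.2 hr.2)
      (hc.mono fun r hr => ⟨hr.1, hr.2.le.trans ht.2⟩)
  have h2 := ((HS.coeff x y).continuous.comp_continuousOn h1) 0 ⟨le_rfl, ht.1⟩
  refine ⟨_, h2.tendsto.mono_left ?_⟩
  rw [← nhdsWithin_Ioo_eq_nhdsGT ht.1]
  exact nhdsWithin_mono 0 Ioo_subset_Ico_self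

theorem mildMap_clampPath {g : ℝ → V} {t : ℝ} (ht : t ∈ Icc 0 T) :
    mildMap α (semigroup (blockDiag A B)) (semigroup A) F h (clampPath T ω₁) g u₀ u t =
      semigroup (blockDiag A B) t u₀ + driftConv A B F u t +
        WithLp.toLp 2 (zahleIntegral α 0 t (noiseIntegrand A h u t) ω₁, g t) := by
  have h1 : zahleConv α (semigroup A) (fun r => h (u r).fst) (clampPath T ω₁) t =
      zahleIntegral α 0 t (noiseIntegrand A h u t) ω₁ :=
    zahleIntegral_congr ht.1 (fun _ _ => rfl)
      fun r hr => clampPath_of_mem ⟨hr.1, hr.2.trans ht.2⟩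
  rw [mildMap, h1]
  rfl

/-- In the weighted space all integrals of the mild equation are well defined, so that the mild
solutions are the fixed points of `mildMap`. -/
theorem isMildSolution_iff (he : ConvExponents α β γ η ε)
    (hJ : IsSmoothing (semigroup (blockDiag A B))) (hA : IsSmoothing (semigroup A))
    (hF : Continuous F) (hL : 0 ≤ L) (hhc : Continuous h)
    (hh : ∀ x y, ‖h x - h y‖ ≤ L * ‖x - y‖) (hω : HolderLine β C (clampPath T ω₁))
    (hB : ∀ t ∈ Icc 0 T, StochConvExists B ω₂ t) (hu : MemWeightedHolder γ T u) :
    IsMildSolution α T A B F h ω₁ ω₂ u₀ u ↔ ∀ t ∈ Icc 0 T, u t =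
      mildMap α (semigroup (blockDiag A B)) (semigroup A) F h (clampPath T ω₁)
        (stochConv B ω₂) u₀ u t := by
  refine ⟨fun hm t ht => ?_, fun hm => ⟨fun t ht => intervalIntegrable_drift hJ hF hu ht,
    fun t ht => zahleIntegrable_noiseIntegrand he hA hL hhc hh hω hu ht, hB, fun t ht => ?_⟩⟩
  · rw [mildMap_clampPath ht]
    exact hm.eq t ht
  · rw [← mildMap_clampPath ht]
    exact hm t ht

/-- The formulation with the stationary Ornstein-Uhlenbeck process describes the same fixed
points. -/
theorem isMildSolutionOU_iff (he : ConvExponents α β γ η ε)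
    (hN : IsNegWithCompactInverse (blockDiag A B))
    (hJ : IsSmoothing (semigroup (blockDiag A B))) (hA : IsSmoothing (semigroup A))
    (hF : Continuous F) (hL : 0 ≤ L) (hhc : Continuous h)
    (hh : ∀ x y, ‖h x - h y‖ ≤ L * ‖x - y‖) (hω : HolderLine β C (clampPath T ω₁))
    (hZ : ∀ t ∈ Icc 0 T, OuZExists B (shift t ω₂))
    (hB : ∀ t ∈ Icc 0 T, stochConv B ω₂ t = ouZ B (shift t ω₂) - semigroup B t (ouZ B ω₂))
    (hu : MemWeightedHolder γ T u) :
    IsMildSolutionOU α T A B F h ω₁ ω₂ u₀ u ↔ ∀ t ∈ Icc 0 T, u t =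
      mildMap α (semigroup (blockDiag A B)) (semigroup A) F h (clampPath T ω₁)
        (stochConv B ω₂) u₀ u t := by
  have key : ∀ t ∈ Icc 0 T, mildMap α (semigroup (blockDiag A B)) (semigroup A) F h
      (clampPath T ω₁) (stochConv B ω₂) u₀ u t =
      WithLp.toLp 2 (semigroup A t u₀.fst, semigroup B t (u₀.snd - ouZ B ω₂)) +
      WithLp.toLp 2 (0, ouZ B (shift t ω₂)) + driftConv A B F u t +
      WithLp.toLp 2 (zahleIntegral α 0 t (noiseIntegrand A h u t) ω₁, 0) := fun t ht => by
    rw [mildMap_clampPath ht, hB t ht, semigroup_blockDiag hN ht.1]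
    simp only [← embFst_add_embSnd, map_sub, map_zero]
    abel
  refine ⟨fun hm t ht => ?_, fun hm => ⟨fun t ht => intervalIntegrable_drift hJ hF hu ht,
    fun t ht => zahleIntegrable_noiseIntegrand he hA hL hhc hh hω hu ht, hZ, fun t ht => ?_⟩⟩
  · rw [key t ht]
    exact hm.eq t ht
  · rw [← key t ht]
    exact hm t ht

end Mild

end MixedEvolution

end

theorem lemma3p5 {V : Type*} [NormedAddCommGroup V] [InnerProductSpace ℝ V] [CompleteSpace V]
    [TopologicalSpace.SeparableSpace V]
    -- (H1), for the operator `J = diag(A, B)`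
    (A B : V →ₗ.[ℝ] V)
    (hJ : MixedEvolution.IsNegWithCompactInverse (MixedEvolution.blockDiag A B))
    -- (H2)
    (F : WithLp 2 (V × V) → WithLp 2 (V × V)) (cDF : ℝ≥0) (hF : LipschitzWith cDF F)
    -- (H3)
    (h : V → MixedEvolution.HS V) (cDh cD2h : ℝ)
    (hh₁ : Differentiable ℝ h) (hh₂ : Differentiable ℝ (fderiv ℝ h))
    (hDh : ∀ x, ‖fderiv ℝ h x‖ ≤ cDh) (hD2h : ∀ x, ‖fderiv ℝ (fderiv ℝ h) x‖ ≤ cD2h)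
    -- the Hurst parameters and the exponents
    (H₁ H₂ α β γ γ' : ℝ)
    (hH₁ : 1 / 2 < H₁) (hH₁' : H₁ < 1) (hH₂ : 1 - H₁ < H₂) (hH₂' : H₂ < 1)
    (hβ : 1 / 2 < β) (hβ' : β < H₁) (hα : 0 < α) (hαγ : α < γ) (hγβ : γ < β)
    (hαβ : 1 < α + β) (hγγ' : γ < γ') (hγ' : γ' < H₂)
    -- time horizon, noise paths and initial value
    (T : ℝ) (hT : 0 < T)
    (ω₁ ω₂ : ℝ → V) (hω₁ : MixedEvolution.MemΩ₁ β T ω₁) (hω₂ : MixedEvolution.MemΩ₂ γ' ω₂)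
    (u₀ : WithLp 2 (V × V)) :
    ∃ u : ℝ → WithLp 2 (V × V),
      MixedEvolution.MemWeightedHolder γ T u ∧
      MixedEvolution.IsMildSolution α T A B F h ω₁ ω₂ u₀ u ∧
      (∀ v : ℝ → WithLp 2 (V × V), MixedEvolution.MemWeightedHolder γ T v →
        MixedEvolution.IsMildSolution α T A B F h ω₁ ω₂ u₀ v → Set.EqOn v u (Set.Icc 0 T)) ∧
      (MixedEvolution.Subexponential ω₂ →
        MixedEvolution.IsMildSolutionOU α T A B F h ω₁ ω₂ u₀ u ∧
        ∀ v : ℝ → WithLp 2 (V × V), MixedEvolution.MemWeightedHolder γ T v →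
          MixedEvolution.IsMildSolutionOU α T A B F h ω₁ ω₂ u₀ v →
          Set.EqOn v u (Set.Icc 0 T)) := by
  -- the room `β - γ` between the exponents is shared between the weight and the smoothing
  have he : MixedEvolution.ConvExponents α β γ (α + (β - γ) / 3) ((β - γ) / 3) :=
    ⟨hα, hαγ, hγβ, by linarith, by linarith, by linarith, by linarith, hαβ, by linarith,
      by linarith⟩
  obtain ⟨_, _, _, _, hDJ⟩ := hJ.exists_isDiagonal
  obtain ⟨_, _, _, _, hDA⟩ := hJ.fst.exists_isDiagonal
  obtain ⟨_, _, _, _, hDB⟩ := hJ.snd.exists_isDiagonal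
  obtain ⟨R, hR⟩ := hDB.exists_isGeneratorComp
  obtain ⟨C₁, hC₁⟩ := hω₁.2.exists_holderLine (by linarith) hT.le
  obtain ⟨C₂, hC₂⟩ := hω₂.2.2 0 T hT
  have hC₂' : ∀ q r, 0 ≤ q → q < r → r ≤ T →
      ‖ω₂ r - ω₂ q‖ ≤ max C₂ 0 * (r - q) ^ γ' := fun q r h1 h2 h3 =>
    (hC₂ q r h1 h2 h3).trans (mul_le_mul_of_nonneg_right (le_max_left _ _)
      (Real.rpow_nonneg (sub_pos.2 h2).le _))
  have hγ'0 : 0 < γ' := he.γ_pos.trans hγγ'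
  obtain ⟨Kg, hKg⟩ := hR.exists_weightedBound_stochConv hDB hω₂.1 hω₂.2.1 he.γ_pos
    he.γ_lt_one.le hγγ' (le_max_right _ _) hT hC₂'
  have hgc := hR.continuousOn_stochConv hDB hω₂.1 hω₂.2.1 he.γ_pos he.γ_lt_one.le hγγ'
    (le_max_right _ _) hT hC₂'
  have hF' : ∀ x y, ‖F x - F y‖ ≤ (cDF : ℝ) * ‖x - y‖ := fun x y => hF.norm_sub_le x y
  have hL₁ : 0 ≤ cDh := (norm_nonneg _).trans (hDh 0)
  have hh := MixedEvolution.norm_sub_le_of_norm_fderiv_le hh₁ hDh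
  have hpic := MixedEvolution.isPicardMap_mildMap (u₀ := u₀) he hT hDJ.isSmoothing
    hDA.isSmoothing hC₁ hKg hgc cDF.coe_nonneg hF' hF.continuous hh₁ hh₂ hDh hD2h
  have hsol : ∀ v, MixedEvolution.MemWeightedHolder γ T v → _ := fun v hv =>
    MixedEvolution.isMildSolution_iff (u₀ := u₀) he hDJ.isSmoothing hDA.isSmoothing
      hF.continuous hL₁ hh₁.continuous hh hC₁ (fun t ht =>
        (hR.stochConv hDB hω₂.1 ht.1 hγ'0 fun r h1 h2 => hC₂' r t h1 h2 ht.2).1) hv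
  have hsolOU : MixedEvolution.Subexponential ω₂ → ∀ v, MixedEvolution.MemWeightedHolder γ T v → _ :=
    fun hsub v hv =>
    MixedEvolution.isMildSolutionOU_iff (u₀ := u₀) he hJ hDJ.isSmoothing hDA.isSmoothing
      hF.continuous hL₁ hh₁.continuous hh hC₁
      (fun t _ => (hR.ouZ_shift hDB hω₂ hsub hγ'0 t).1)
      (fun t ht => hR.stochConv_eq_ouZ hDB hω₂ hsub hγ'0 ht.1) hv
  obtain ⟨u, huc, huR, hfu⟩ := hpic.exists_fixedPoint he.ε_pos hT.le
  have hu := MixedEvolution.memWeightedHolder_iff.2 ⟨huc, huR⟩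
  have huniq : ∀ v, MixedEvolution.MemWeightedHolder γ T v → (∀ t ∈ Set.Icc 0 T, v t = _) →
      Set.EqOn v u (Set.Icc 0 T) := fun v hv hfv =>
    hpic.eqOn he.ε_pos hT.le hv.1 huc (MixedEvolution.memWeightedHolder_iff.1 hv).2 huR hfv hfu
  exact ⟨u, hu, (hsol u hu).2 hfu, fun v hv hm => huniq v hv ((hsol v hv).1 hm),
    fun hsub => ⟨(hsolOU hsub u hu).2 hfu, fun v hv hm => huniq v hv ((hsolOU hsub v hv).1 hm)⟩⟩
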